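/- Let $n,N\ge 1$ and let $\mathcal L\vec u=\vec u_t-\sum_{\alpha,\beta=1}^n D_\alpha(\vec A^{\alpha\beta}D_\beta\vec u)$ be an operator acting on functions $\vec u=(u^1,\dots,u^N)$ on $\mathbb R^{n+1}=\mathbb R\times\mathbb R^n$, where the $\vec A^{\alpha\beta}=(A^{\alpha\beta}_{ij})_{i,j=1}^N$ are measurable real $N\times N$ matrix valued functions on $\mathbb R^{n+1}$ such that, for some $\lambda,\Lambda>0$, $$\sum A^{\alpha\beta}_{ij}(X)\xi^j_\beta\xi^i_\alpha\ge\lambda\sum|\xi^i_\alpha|^2\quad\forall\xi\in\mathbb R^{N\times n},\qquad \sum|A^{\alpha\beta}_{ij}(X)|^2\le\Lambda^2\qquad\forall X\in\mathbb R^{n+1}.$$ Let ${}^t\!\mathcal L\vec u=-\vec u_t-\sum D_\alpha({}^t\!\vec A^{\alpha\beta}D_\beta\vec u)$ with ${}^t\!A^{\alpha\beta}_{ij}=A^{\beta\alpha}_{ji}$ be its transpose. For $X=(t,x)$ put $Q_r^-(X)=(t-r^2,t)\times B_r(x)$ and $Q_r^+(X)=(t,t+r^2)\times B_r(x)$. For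 a cylinder $Q=I\times\Omega$ with $I$ an open interval, $V_2(Q)$ is the space of functions $u$ that are square integrable on $(I\cap(-T,T))\times\Omega$ for all $T>0$, have a weak spatial gradient $Du\in L^2(Q)$, and satisfy $\operatorname{ess\,sup}_{t\in I}\|u(t,\cdot)\|_{L^2(\Omega)}<\infty$. A weak solution of $\mathcal L\vec u=\vec f$ (resp. ${}^t\!\mathcal L\vec u=\vec f$) in $Q$ is a function $\vec u\in V_2(Q)^N$ that satisfies the equation in the sense of distributions, tested with $\vec\phi\in C^\infty_c(Q)^N$. The space $\mathring V_2^{1,0}(\mathbb R^{n+1})$ consists of the $u\in V_2(\mathbb R^{n+1})$ that are continuous in $t$ with values in $L^2(\mathbb R^n)$ and that on every slab $(-T,T)\times\mathbb R^n$ are limits of functions in $C^\infty_c(\mathbb R^{n+1})$ in the norm $\|u\|_{L^2}+\|Du\|_{L^2}$. Assume that $\mathcal L$ and ${}^t\!\mathcal L$ have property (PH) with constants $\mu_0\in(0,1]$, $R_c\in(0,\infty]$, $C_0>0$: for all $X_0\in\mathbb R^{n+1}$ and $0<R<R_c$, all weak solutions $\vec u$ of $\mathcal L\vec u=0$ in $Q_R^-(X_0)$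 satisfy $$\int_{Q_\rho^-(X_0)}|D\vec u|^2\le C_0\Big(\frac\rho r\Big)^{n+2\mu_0}\int_{Q_r^-(X_0)}|D\vec u|^2\qquad\forall\,0<\rho<r\le R,$$ and all weak solutions of ${}^t\!\mathcal L\vec u=0$ in $Q_R^+(X_0)$ satisfy the same with $Q^+$ in place of $Q^-$. Let $\vec\Gamma(X,Y)=\vec\Gamma(t,x,s,y)$ be the fundamental matrix of $\mathcal L$ in $\mathbb R^{n+1}$, that is, the (unique) $N\times N$ matrix valued function that is continuous in $\{X\ne Y\}$, vanishes for $t<s$, is such that $\vec\Gamma(X,\cdot)$ is locally integrable for every $X$, and for which, for every $\vec f\in C^\infty_c(\mathbb R^{n+1})^N$, the function $\vec u(X)=\int_{\mathbb R^{n+1}}\vec\Gamma(X,Y)\vec f(Y)\,dY$ belongs to $\mathring V_2^{1,0}(\mathbb R^{n+1})^N$ and is a weak solution of $\mathcal L\vec u=\vec f$ in $\mathbb R^{n+1}$. Then for all $t>s$ and $x,y\in\mathbb R^n$ $$|\vec\Gamma(t,x,s,y)|_{op}\le C(t-s)^{-n/2}\exp\{-\kappa|x-y|^2/(t-s)+\gamma(t-s)/R_c^2\},$$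 where $\kappa>0$ depends only on $\lambda,\Lambda$, the constants $C,\gamma>0$ depend only on $n,N,\lambda,\Lambda,\mu_0,C_0$, and $|\cdot|_{op}$ is the operator norm. In particular, when $R_c=\infty$, $$|\vec\Gamma(t,x,s,y)|_{op}\le C(t-s)^{-n/2}\exp\{-\kappa|x-y|^2/(t-s)\}.$$ Moreover, for $t>s$, $$\vec\Gamma(t,x,s,y)=\int_{\mathbb R^n}\vec\Gamma(t,x,r,z)\vec\Gamma(r,z,s,y)\,dz\quad\forall x,y\in\mathbb R^n,\ \forall r\in(s,t),\qquad \int_{\mathbb R^n}\vec\Gamma(t,x,s,y)\,dy=\vec I\quad\forall x\in\mathbb R^n,$$ where both integrals converge absolutely and $\vec I$ is the $N\times N$ identity matrix. -/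

import Mathlib

open MeasureTheory Set Filter Topology
open scoped ContDiff ENNReal NNReal

noncomputable section

namespace ParabolicSystem

/-- The space `ℝⁿ` with its Euclidean norm. -/
abbrev Space (n : ℕ) : Type := EuclideanSpace ℝ (Fin n)

/-- The space-time `ℝ × ℝⁿ`; a point is written `X = (t, x)`. -/
abbrev SpaceTime (n : ℕ) : Type := ℝ × Space n

/-- Time derivative `φ_t` of a smooth function. -/
def timeDeriv {n : ℕ} (φ : SpaceTime n → ℝ) (X : SpaceTime n) : ℝ :=
  fderiv ℝ φ X (1, 0)

/-- Spatial partial derivative `D_α φ` of a smooth function. -/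
def spaceDeriv {n : ℕ} (α : Fin n) (φ : SpaceTime n → ℝ) (X : SpaceTime n) : ℝ :=
  fderiv ℝ φ X (0, EuclideanSpace.single α 1)

/-- Spatial gradient `Dφ` of a smooth function. -/
def spaceGrad {n : ℕ} (φ : SpaceTime n → ℝ) (X : SpaceTime n) : Space n :=
  WithLp.toLp 2 (fun α => spaceDeriv α φ X)

/-- `φ ∈ C^∞_c(U)`. -/
structure IsTestFunction {n : ℕ} (U : Set (SpaceTime n)) (φ : SpaceTime n → ℝ) : Prop where
  smooth : ContDiff ℝ ∞ φ
  compact : HasCompactSupport φ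
  support : tsupport φ ⊆ U

/-- `Du` is the weak spatial gradient of `u` in `U`. -/
def IsWeakGrad {n : ℕ} (U : Set (SpaceTime n)) (u : SpaceTime n → ℝ)
    (Du : SpaceTime n → Space n) : Prop :=
  ∀ φ : SpaceTime n → ℝ, IsTestFunction U φ → ∀ α : Fin n,
    ∫ X in U, u X * spaceDeriv α φ X = - ∫ X in U, Du X α * φ X

/-- `u ∈ V₂(I × Ω)` with weak spatial gradient `Du`, for a bounded or unbounded time interval `I`:
`u` is square integrable on the pieces of `I × Ω` that are bounded in time, and the norm
`‖Du‖_{L²} + esssup_t ‖u(t, ·)‖_{L²(Ω)}` is finite. -/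
structure MemV2 {n : ℕ} (I : Set ℝ) (Ω : Set (Space n)) (u : SpaceTime n → ℝ)
    (Du : SpaceTime n → Space n) : Prop where
  memLp : ∀ T : ℝ, 0 < T → MemLp u 2 (volume.restrict ((I ∩ Ioo (-T) T) ×ˢ Ω))
  weakGrad : IsWeakGrad (I ×ˢ Ω) u Du
  memLp_grad : MemLp Du 2 (volume.restrict (I ×ˢ Ω))
  essSup_lt_top :
    essSup (fun t => eLpNorm (fun x => u (t, x)) 2 (volume.restrict Ω)) (volume.restrict I) < ⊤

/-- `u` belongs to the space `V̊₂^{1,0}(ℝⁿ⁺¹)`, with weak spatial gradient `Du`: `u ∈ V₂(ℝⁿ⁺¹)`,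
`u` has a representative that is continuous in `t` with values in `L²(ℝⁿ)`, and on each slab
`(-T, T) × ℝⁿ` it is a limit of smooth functions of compact support in `W₂^{1,0}`. -/
structure MemV10 {n : ℕ} (u : SpaceTime n → ℝ) (Du : SpaceTime n → Space n) : Prop where
  memV2 : MemV2 univ univ u Du
  continuous_time : ∃ U : ℝ → Lp ℝ 2 (volume : Measure (Space n)), Continuous U ∧
    ∀ᵐ t : ℝ, (fun x => u (t, x)) =ᵐ[volume] U t
  approx : ∀ T : ℝ, 0 < T → ∀ ε : ℝ≥0∞, 0 < ε →
    ∃ φ : SpaceTime n → ℝ, IsTestFunction univ φ ∧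
      eLpNorm (fun X => u X - φ X) 2 (volume.restrict (Ioo (-T) T ×ˢ univ)) < ε ∧
      eLpNorm (fun X => Du X - spaceGrad φ X) 2 (volume.restrict (Ioo (-T) T ×ˢ univ)) < ε

/-- Coefficients `A X α β i j = A^{αβ}_{ij}(X)` on space-time. -/
abbrev Coeff (n N : ℕ) : Type := SpaceTime n → Fin n → Fin n → Fin N → Fin N → ℝ

/-- Measurable coefficients that are strongly parabolic with constant `lam` and bounded
by `Lam`. -/
structure IsParabolic {n N : ℕ} (lam Lam : ℝ) (A : Coeff n N) : Prop where
  measurable : ∀ α β i j, AEMeasurable (fun X => A X α β i j) volume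
  parabolic : ∀ (X : SpaceTime n) (ξ : Fin N → Fin n → ℝ),
    lam * ∑ i, ∑ α, ξ i α ^ 2 ≤ ∑ i, ∑ j, ∑ α, ∑ β, A X α β i j * ξ j β * ξ i α
  bounded : ∀ X : SpaceTime n, ∑ i, ∑ j, ∑ α, ∑ β, A X α β i j ^ 2 ≤ Lam ^ 2

/-- The transposed coefficients `ᵗA^{αβ}_{ij} = A^{βα}_{ji}`. -/
def transposeCoeff {n N : ℕ} (A : Coeff n N) : Coeff n N := fun X α β i j => A X β α j i

/-- The integrand `A^{αβ}_{ij} D_β u^j D_α φ^i`, summed over all indices. -/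
def ellipticForm {n N : ℕ} (A : Coeff n N) (Du : Fin N → SpaceTime n → Space n)
    (φ : Fin N → SpaceTime n → ℝ) (X : SpaceTime n) : ℝ :=
  ∑ i, ∑ j, ∑ α, ∑ β, A X α β i j * Du j X β * spaceDeriv α (φ i) X

/-- `u = (u¹, …, u^N)`, with weak spatial gradients `Du`, is a weak solution of
`𝓛u = u_t - D_α(A^{αβ} D_β u) = f` in `I × Ω`. -/
structure IsWeakSolution {n N : ℕ} (A : Coeff n N) (I : Set ℝ) (Ω : Set (Space n))
    (f u : Fin N → SpaceTime n → ℝ) (Du : Fin N → SpaceTime n → Space n) : Prop where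
  memV2 : ∀ i, MemV2 I Ω (u i) (Du i)
  eqn : ∀ φ : Fin N → SpaceTime n → ℝ, (∀ i, IsTestFunction (I ×ˢ Ω) (φ i)) →
    - (∫ X in I ×ˢ Ω, ∑ i, u i X * timeDeriv (φ i) X) + ∫ X in I ×ˢ Ω, ellipticForm A Du φ X
      = ∫ X in I ×ˢ Ω, ∑ i, f i X * φ i X

/-- `u = (u¹, …, u^N)`, with weak spatial gradients `Du`, is a weak solution of
`ᵗ𝓛u = -u_t - D_α(ᵗA^{αβ} D_β u) = f` in `I × Ω`, where `A` are the coefficients of `𝓛`. -/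
structure IsAdjointWeakSolution {n N : ℕ} (A : Coeff n N) (I : Set ℝ) (Ω : Set (Space n))
    (f u : Fin N → SpaceTime n → ℝ) (Du : Fin N → SpaceTime n → Space n) : Prop where
  memV2 : ∀ i, MemV2 I Ω (u i) (Du i)
  eqn : ∀ φ : Fin N → SpaceTime n → ℝ, (∀ i, IsTestFunction (I ×ˢ Ω) (φ i)) →
    (∫ X in I ×ˢ Ω, ∑ i, u i X * timeDeriv (φ i) X)
        + ∫ X in I ×ˢ Ω, ellipticForm (transposeCoeff A) Du φ X
      = ∫ X in I ×ˢ Ω, ∑ i, f i X * φ i X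

/-- The time interval `(t - r², t)` of the backward cylinder `Q⁻_r(t, x)`. -/
def backwardInterval (t r : ℝ) : Set ℝ := Ioo (t - r ^ 2) t

/-- The time interval `(t, t + r²)` of the forward cylinder `Q⁺_r(t, x)`. -/
def forwardInterval (t r : ℝ) : Set ℝ := Ioo t (t + r ^ 2)

/-- `Q⁻_r(X) = (t - r², t) × B_r(x)`. -/
def backwardCyl {n : ℕ} (X : SpaceTime n) (r : ℝ) : Set (SpaceTime n) :=
  backwardInterval X.1 r ×ˢ Metric.ball X.2 r

/-- `Q⁺_r(X) = (t, t + r²) × B_r(x)`. -/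
def forwardCyl {n : ℕ} (X : SpaceTime n) (r : ℝ) : Set (SpaceTime n) :=
  forwardInterval X.1 r ×ˢ Metric.ball X.2 r

/-- Property (PH) for `𝓛`, with the constants `μ₀`, `Rc ∈ (0, ∞]` and `C₀`. -/
def PropertyPH {n N : ℕ} (A : Coeff n N) (μ₀ : ℝ) (Rc : ℝ≥0∞) (C₀ : ℝ) : Prop :=
  ∀ (X₀ : SpaceTime n) (R : ℝ), 0 < R → ENNReal.ofReal R < Rc →
    ∀ (u : Fin N → SpaceTime n → ℝ) (Du : Fin N → SpaceTime n → Space n),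
      IsWeakSolution A (backwardInterval X₀.1 R) (Metric.ball X₀.2 R) 0 u Du →
      ∀ ρ r : ℝ, 0 < ρ → ρ < r → r ≤ R →
        ∫ X in backwardCyl X₀ ρ, ∑ i, ‖Du i X‖ ^ 2
          ≤ C₀ * (ρ / r) ^ ((n : ℝ) + 2 * μ₀) * ∫ X in backwardCyl X₀ r, ∑ i, ‖Du i X‖ ^ 2

/-- Property (PH) for the transpose `ᵗ𝓛` of the operator with coefficients `A`, with the
constants `μ₀`, `Rc ∈ (0, ∞]` and `C₀`. -/
def AdjointPropertyPH {n N : ℕ} (A : Coeff n N) (μ₀ : ℝ) (Rc : ℝ≥0∞) (C₀ : ℝ) : Prop :=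
  ∀ (X₀ : SpaceTime n) (R : ℝ), 0 < R → ENNReal.ofReal R < Rc →
    ∀ (u : Fin N → SpaceTime n → ℝ) (Du : Fin N → SpaceTime n → Space n),
      IsAdjointWeakSolution A (forwardInterval X₀.1 R) (Metric.ball X₀.2 R) 0 u Du →
      ∀ ρ r : ℝ, 0 < ρ → ρ < r → r ≤ R →
        ∫ X in forwardCyl X₀ ρ, ∑ i, ‖Du i X‖ ^ 2
          ≤ C₀ * (ρ / r) ^ ((n : ℝ) + 2 * μ₀) * ∫ X in forwardCyl X₀ r, ∑ i, ‖Du i X‖ ^ 2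

/-- The function `u(X) = ∫ Γ(X, Y) f(Y) dY`. -/
def potential {n N : ℕ} (Γ : SpaceTime n → SpaceTime n → Matrix (Fin N) (Fin N) ℝ)
    (f : Fin N → SpaceTime n → ℝ) (i : Fin N) (X : SpaceTime n) : ℝ :=
  ∫ Y, ∑ k, Γ X Y i k * f k Y

/-- `Γ` is the fundamental matrix of `𝓛` in `ℝⁿ⁺¹`. These properties determine `Γ(X, Y)` for
`X ≠ Y`; the values on the diagonal are irrelevant. -/
structure IsFundamentalMatrix {n N : ℕ} (A : Coeff n N)
    (Γ : SpaceTime n → SpaceTime n → Matrix (Fin N) (Fin N) ℝ) : Prop where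
  continuousOn : ContinuousOn (fun p : SpaceTime n × SpaceTime n => Γ p.1 p.2) {p | p.1 ≠ p.2}
  causal : ∀ X Y : SpaceTime n, X.1 < Y.1 → Γ X Y = 0
  locallyIntegrable : ∀ (X : SpaceTime n) (i k : Fin N),
    LocallyIntegrable (fun Y => Γ X Y i k) volume
  solves : ∀ f : Fin N → SpaceTime n → ℝ, (∀ i, IsTestFunction univ (f i)) →
    ∃ Du : Fin N → SpaceTime n → Space n,
      (∀ i, MemV10 (potential Γ f i) (Du i)) ∧
      IsWeakSolution A univ univ f (potential Γ f) Du

/-- The operator norm of a matrix, acting on `ℝ^N` with its Euclidean norm. -/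
def opNorm {N : ℕ} (M : Matrix (Fin N) (Fin N) ℝ) : ℝ :=
  ‖Matrix.toEuclideanCLM (n := Fin N) (𝕜 := ℝ) M‖

end ParabolicSystem

end

open MeasureTheory Set Filter Topology
open scoped ContDiff ENNReal NNReal

/-! Two estimates carry the proof; neither uses a maximum principle, so both work for systems.

Weighted energy (`weighted_energy`). Let `w` vanish before time `a` and solve `w_t - div(A Dw) = F -
div H`. Test the equation with `τ(t) W(x) w`, where `|DW| ≤ 2ϱW` and `τ` decays like `exp(-2(νϱ² +
1/T)(t - a))`. The decay of `τ` pays for the cross terms produced by `DW`, and the weighted energy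
of `w` is bounded by that of `F` and `H`. With `W` close to `1` near `x₀` and at most `exp(-ϱd)`
beyond distance `d`, remote sources have little effect near `x₀`.

Local boundedness (`exists_local_bound`). Differentiating a parabolic average of a solution in its
radius `ρ` and integrating by parts leaves only `Du` and the flux. Property (PH) bounds this
derivative by a multiple of `ρ^(μ₀ - 1)`, which is integrable at `0`. So the value at the vertex of
a cylinder is controlled by the energy in the cylinder.

Together they give `exists_pointwise_decay`: the square of a solution at `X₀` carries the factor
`exp(2νϱ²T + 4ϱr - ϱd)` when its sources stay at spatial distance `d`.

The Gaussian bound follows by duality (`exists_kernel_bound`). A potential evaluated at `X₀` is a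
bounded functional of `L²` sources, and of divergences of `L²` fields, in a forward cylinder at
`Y₀`. By Riesz the row `Γ(X₀, ·)` and its gradient lie in `L²` there, with bounds. The same estimate
shows that the row solves the transposed equation, whose local boundedness bounds `Γ(X₀, Y₀)`. In
`exists_gaussian_bound` the rate `ϱ = |x - y| / (4νT)` and a radius of order `√T / (1 + T / Rc²)`
are inserted.

The two identities use the estimate as a quantitative uniqueness theorem. For the mass identity, a
cut-off constant function solves the equation up to a flux at distance `m + 1`, whose effect `(m +
1)^n exp(-(m + 1))` vanishes as `m → ∞`. For Chapman–Kolmogorov, a potential multiplied by a smooth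
time step `θ` is the solution with source `θ'` times the potential. Letting the step sharpen, and
the source of the potential tend to a Dirac mass, gives the identity. -/

namespace ParabolicSystem

/-! ### Test functions, derivatives, and weak limits of products in `L²`. -/

section
namespace IsTestFunction

variable {n : ℕ} {U V : Set (SpaceTime n)} {φ ψ : SpaceTime n → ℝ}

theorem mono (h : IsTestFunction U φ) (hUV : U ⊆ V) : IsTestFunction V φ :=
  ⟨h.smooth, h.compact, h.support.trans hUV⟩

theorem to_univ (h : IsTestFunction U φ) : IsTestFunction univ φ := h.mono (subset_univ _)

theorem zero : IsTestFunction U (0 : SpaceTime n → ℝ) :=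
  ⟨contDiff_const, HasCompactSupport.zero, by simp [tsupport]⟩

theorem add (h : IsTestFunction U φ) (h' : IsTestFunction U ψ) :
    IsTestFunction U (fun X => φ X + ψ X) :=
  ⟨h.smooth.add h'.smooth, h.compact.add h'.compact,
    (tsupport_add φ ψ).trans (union_subset h.support h'.support)⟩

theorem mul_left {g : SpaceTime n → ℝ} (hg : ContDiff ℝ ∞ g) (h : IsTestFunction U φ) :
    IsTestFunction U (fun X => g X * φ X) :=
  ⟨hg.mul h.smooth, h.compact.mul_left, (tsupport_mul_subset_right).trans h.support⟩

theorem const_mul (c : ℝ) (h : IsTestFunction U φ) : IsTestFunction U (fun X => c * φ X) :=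
  mul_left contDiff_const h

theorem neg (h : IsTestFunction U φ) : IsTestFunction U (fun X => -φ X) := by
  simpa using h.const_mul (-1)

theorem sub (h : IsTestFunction U φ) (h' : IsTestFunction U ψ) :
    IsTestFunction U (fun X => φ X - ψ X) := by
  simpa [sub_eq_add_neg] using h.add h'.neg

theorem fderiv_apply (h : IsTestFunction U φ) (e : SpaceTime n) :
    IsTestFunction U (fun X => fderiv ℝ φ X e) :=
  ⟨(h.smooth.fderiv_right (m := ∞) (by simp)).clm_apply contDiff_const,
    h.compact.fderiv_apply (𝕜 := ℝ) e,
    (tsupport_fderiv_apply_subset ℝ e).trans h.support⟩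

theorem timeDeriv (h : IsTestFunction U φ) : IsTestFunction U (timeDeriv φ) :=
  h.fderiv_apply _

theorem spaceDeriv (h : IsTestFunction U φ) (α : Fin n) : IsTestFunction U (spaceDeriv α φ) :=
  h.fderiv_apply _

theorem continuous (h : IsTestFunction U φ) : Continuous φ := h.smooth.continuous

theorem differentiable (h : IsTestFunction U φ) : Differentiable ℝ φ :=
  h.smooth.differentiable (by simp)

theorem integrable (h : IsTestFunction U φ) : Integrable φ :=
  h.continuous.integrable_of_hasCompactSupport h.compact

theorem memLp (h : IsTestFunction U φ) (p : ℝ≥0∞) : MemLp φ p :=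
  h.continuous.memLp_of_hasCompactSupport h.compact

theorem eq_zero (h : IsTestFunction U φ) {X : SpaceTime n} (hX : X ∉ U) : φ X = 0 :=
  image_eq_zero_of_notMem_tsupport fun h' => hX (h.support h')

theorem exists_bound (h : IsTestFunction U φ) : ∃ C, 0 ≤ C ∧ ∀ X, |φ X| ≤ C := by
  obtain ⟨C, hC⟩ := h.compact.exists_bound_of_continuous h.continuous
  exact ⟨C, (norm_nonneg _).trans (hC 0), hC⟩

theorem setIntegral_mul (h : IsTestFunction U φ) (g : SpaceTime n → ℝ) :
    ∫ X in U, g X * φ X = ∫ X, g X * φ X :=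
  setIntegral_eq_integral_of_forall_compl_eq_zero fun X hX => by simp [h.eq_zero hX]

end IsTestFunction

section Deriv

variable {n : ℕ} {φ ψ : SpaceTime n → ℝ}

theorem timeDeriv_mul {X : SpaceTime n} (hφ : DifferentiableAt ℝ φ X)
    (hψ : DifferentiableAt ℝ ψ X) :
    timeDeriv (fun Y => φ Y * ψ Y) X = φ X * timeDeriv ψ X + timeDeriv φ X * ψ X := by
  simp only [timeDeriv, fderiv_fun_mul hφ hψ]
  simp [mul_comm]

theorem spaceDeriv_mul {X : SpaceTime n} (α : Fin n) (hφ : DifferentiableAt ℝ φ X)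
    (hψ : DifferentiableAt ℝ ψ X) :
    spaceDeriv α (fun Y => φ Y * ψ Y) X = φ X * spaceDeriv α ψ X + spaceDeriv α φ X * ψ X := by
  simp only [spaceDeriv, fderiv_fun_mul hφ hψ]
  simp [mul_comm]

theorem timeDeriv_fst (τ : ℝ → ℝ) (hτ : Differentiable ℝ τ) (X : SpaceTime n) :
    timeDeriv (fun Y : SpaceTime n => τ Y.1) X = deriv τ X.1 := by
  have h : HasFDerivAt (fun Y : SpaceTime n => τ Y.1)
      ((fderiv ℝ τ X.1).comp (ContinuousLinearMap.fst ℝ ℝ (Space n))) X :=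
    (hτ X.1).hasFDerivAt.comp X hasFDerivAt_fst
  simp [timeDeriv, h.fderiv]

theorem spaceDeriv_fst (τ : ℝ → ℝ) (hτ : Differentiable ℝ τ) (α : Fin n) (X : SpaceTime n) :
    spaceDeriv α (fun Y : SpaceTime n => τ Y.1) X = 0 := by
  have h : HasFDerivAt (fun Y : SpaceTime n => τ Y.1)
      ((fderiv ℝ τ X.1).comp (ContinuousLinearMap.fst ℝ ℝ (Space n))) X :=
    (hτ X.1).hasFDerivAt.comp X hasFDerivAt_fst
  simp [spaceDeriv, h.fderiv]

theorem timeDeriv_snd (W : Space n → ℝ) (hW : Differentiable ℝ W) (X : SpaceTime n) :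
    timeDeriv (fun Y : SpaceTime n => W Y.2) X = 0 := by
  have h : HasFDerivAt (fun Y : SpaceTime n => W Y.2)
      ((fderiv ℝ W X.2).comp (ContinuousLinearMap.snd ℝ ℝ (Space n))) X :=
    (hW X.2).hasFDerivAt.comp X hasFDerivAt_snd
  simp [timeDeriv, h.fderiv]

theorem spaceDeriv_snd (W : Space n → ℝ) (hW : Differentiable ℝ W) (α : Fin n)
    (X : SpaceTime n) :
    spaceDeriv α (fun Y : SpaceTime n => W Y.2) X
      = fderiv ℝ W X.2 (EuclideanSpace.single α 1) := by
  have h : HasFDerivAt (fun Y : SpaceTime n => W Y.2)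
      ((fderiv ℝ W X.2).comp (ContinuousLinearMap.snd ℝ ℝ (Space n))) X :=
    (hW X.2).hasFDerivAt.comp X hasFDerivAt_snd
  simp [spaceDeriv, h.fderiv]

end Deriv

section LocL2

variable {E F : Type*} [NormedAddCommGroup E] [MeasurableSpace E] [NormedAddCommGroup F]

/-- `f` is square integrable on every compact set. -/
def LocL2 (μ : Measure E) (f : E → F) : Prop :=
  ∀ K : Set E, IsCompact K → MemLp f 2 (μ.restrict K)

theorem LocL2.indicator [BorelSpace E] {μ : Measure E} {f : E → F} (hf : LocL2 μ f)
    {K : Set E} (hK : IsCompact K) : MemLp (K.indicator f) 2 μ :=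
  (memLp_indicator_iff_restrict hK.measurableSet).2 (hf K hK)

theorem LocL2.locallyIntegrable [BorelSpace E] [ProperSpace E] {μ : Measure E}
    [IsFiniteMeasureOnCompacts μ] {f : E → F} (hf : LocL2 μ f) : LocallyIntegrable f μ := by
  refine (locallyIntegrable_iff).2 fun K hK => ?_
  have : IsFiniteMeasure (μ.restrict K) := ⟨by simpa using hK.measure_lt_top⟩
  exact (hf K hK).integrable one_le_two

theorem LocL2.aestronglyMeasurable [BorelSpace E] [ProperSpace E] {μ : Measure E}
    [IsFiniteMeasureOnCompacts μ] {f : E → F} (hf : LocL2 μ f) : AEStronglyMeasurable f μ :=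
  hf.locallyIntegrable.aestronglyMeasurable

theorem MemLp.locL2 {μ : Measure E} {f : E → F} (hf : MemLp f 2 μ) : LocL2 μ f :=
  fun _ _ => hf.restrict _

theorem LocL2.integrable_mul [BorelSpace E] [ProperSpace E] {μ : Measure E}
    [IsFiniteMeasureOnCompacts μ] {f χ : E → ℝ} (hf : LocL2 μ f) (hχ : Continuous χ)
    (hc : HasCompactSupport χ) : Integrable (fun x => f x * χ x) μ := by
  simpa [mul_comm] using hf.locallyIntegrable.integrable_smul_left_of_hasCompactSupport hχ hc

end LocL2

section L2Limits

variable {E : Type*} [MeasurableSpace E] {μ : Measure E}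

/-- Products of `L²`-convergent sequences converge weakly against bounded functions. -/
theorem tendsto_integral_mul_mul {ι : Type*} {l : Filter ι} {f g : ι → E → ℝ} {f₀ g₀ χ : E → ℝ}
    (hf : ∀ᶠ j in l, MemLp (f j) 2 μ) (hg : ∀ᶠ j in l, MemLp (g j) 2 μ)
    (hf₀ : MemLp f₀ 2 μ) (hg₀ : MemLp g₀ 2 μ)
    (hfl : Tendsto (fun j => eLpNorm (f j - f₀) 2 μ) l (𝓝 0))
    (hgl : Tendsto (fun j => eLpNorm (g j - g₀) 2 μ) l (𝓝 0))
    (hχ : AEStronglyMeasurable χ μ) {C : ℝ} (hC : ∀ x, |χ x| ≤ C) :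
    Tendsto (fun j => ∫ x, f j x * g j x * χ x ∂μ) l (𝓝 (∫ x, f₀ x * g₀ x * χ x ∂μ)) := by
  have hmul : ∀ {h : E → ℝ}, MemLp h 2 μ → MemLp (fun x => h x * χ x) 2 μ := fun {h} hh =>
    MemLp.of_le_mul (c := C) hh (hh.aestronglyMeasurable.mul hχ)
      (Eventually.of_forall fun x => by
        rw [norm_mul, mul_comm]; exact mul_le_mul_of_nonneg_right (hC x) (norm_nonneg _))
  classical
  -- Membership in `L²` holds only eventually, hence the default `0`. The bounded factor `χ` is
  -- absorbed into `g`, so that the integral becomes an `L²` inner product.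
  let a : ι → Lp ℝ 2 μ := fun j => if h : MemLp (f j) 2 μ then h.toLp else 0
  let b : ι → Lp ℝ 2 μ := fun j => if h : MemLp (g j) 2 μ then (hmul h).toLp else 0
  have ha : Tendsto a l (𝓝 (hf₀.toLp)) := by
    rw [tendsto_iff_edist_tendsto_0]
    refine hfl.congr' ?_
    filter_upwards [hf] with j hj
    simp only [a, dif_pos hj, Lp.edist_toLp_toLp]
  have hb : Tendsto b l (𝓝 ((hmul hg₀).toLp)) := by
    rw [tendsto_iff_edist_tendsto_0]
    have h0 : Tendsto (fun j => ENNReal.ofReal C * eLpNorm (g j - g₀) 2 μ) l (𝓝 0) := by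
      simpa using ENNReal.Tendsto.const_mul hgl (Or.inr ENNReal.ofReal_ne_top)
    refine tendsto_of_tendsto_of_tendsto_of_le_of_le' tendsto_const_nhds h0
      (Eventually.of_forall fun _ => zero_le) ?_
    filter_upwards [hg] with j hj
    simp only [b, dif_pos hj, Lp.edist_toLp_toLp]
    refine eLpNorm_le_mul_eLpNorm_of_ae_le_mul (Eventually.of_forall fun x => ?_) 2
    simp only [Pi.sub_apply, ← sub_mul, norm_mul, mul_comm C]
    exact mul_le_mul_of_nonneg_left (hC x) (norm_nonneg _)
  have hlim := (ha.inner (𝕜 := ℝ) hb)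
  have key : ∀ {u v : E → ℝ} (hu : MemLp u 2 μ) (hv : MemLp v 2 μ),
      inner ℝ hu.toLp (hmul hv).toLp = ∫ x, u x * v x * χ x ∂μ := by
    intro u v hu hv
    rw [L2.inner_def]
    refine integral_congr_ae ?_
    filter_upwards [hu.coeFn_toLp, (hmul hv).coeFn_toLp] with x h1 h2
    rw [h1, h2]; simp [mul_comm, mul_left_comm]
  rw [key hf₀ hg₀] at hlim
  refine hlim.congr' ?_
  filter_upwards [hf, hg] with j hj hj'
  simp only [a, b, dif_pos hj, dif_pos hj']
  exact key hj hj'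

theorem tendsto_integral_mul_const {ι : Type*} {l : Filter ι} {f : ι → E → ℝ} {f₀ g : E → ℝ}
    (hf : ∀ᶠ j in l, MemLp (f j) 2 μ) (hf₀ : MemLp f₀ 2 μ) (hg : MemLp g 2 μ)
    (hfl : Tendsto (fun j => eLpNorm (f j - f₀) 2 μ) l (𝓝 0)) :
    Tendsto (fun j => ∫ x, f j x * g x ∂μ) l (𝓝 (∫ x, f₀ x * g x ∂μ)) := by
  simpa using tendsto_integral_mul_mul (g := fun _ => g) (χ := fun _ => 1) (C := 1) hf
    (Eventually.of_forall fun _ => hg) hf₀ hg hfl (by simpa using tendsto_const_nhds)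
      aestronglyMeasurable_const (by simp)

end L2Limits

end

/-! ### Mollification in `L²`. -/

section
section Mollify

variable {E : Type*} [NormedAddCommGroup E] [NormedSpace ℝ E] [FiniteDimensional ℝ E]
  [MeasurableSpace E] [BorelSpace E] (μ : Measure E) [μ.IsAddHaarMeasure]

/-- The mollification `x ↦ ∫ f(y) ρ(x - y) dy`. -/
noncomputable def mollify (ρ f : E → ℝ) : E → ℝ :=
  convolution f ρ (ContinuousLinearMap.mul ℝ ℝ) μ

variable {μ}

/-- Translations preserve the measure and depend continuously on `z` in the compact-open topology,
and composition with such maps is continuous in `L²`. -/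
theorem tendsto_eLpNorm_translate {f : E → ℝ} (hf : MemLp f 2 μ) :
    Tendsto (fun z => eLpNorm (fun x => f (x - z) - f x) 2 μ) (𝓝 0) (𝓝 0) := by
  let G : C(E, C(E, E)) := (ContinuousMap.mk (fun p : E × E => p.2 - p.1) (by fun_prop)).curry
  have hG : ∀ z, MeasurePreserving (G z) μ μ := fun z => measurePreserving_sub_right μ z
  have h := Filter.Tendsto.compMeasurePreservingLp (μ := μ) (ν := μ) (p := 2)
    (tendsto_const_nhds (x := hf.toLp) (f := 𝓝 (0 : E))) (G.continuous.tendsto 0) hG (hG 0)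
    (by simp)
  rw [tendsto_iff_edist_tendsto_0] at h
  refine h.congr fun z => ?_
  rw [Lp.toLp_compMeasurePreserving, Lp.toLp_compMeasurePreserving, Lp.edist_toLp_toLp]
  refine eLpNorm_congr_ae (Eventually.of_forall fun x => ?_)
  simp [G]

/-- Jensen's inequality for the probability density `r`: the Cauchy–Schwarz inequality applied to
`(F √r) · √r`. -/
theorem lintegral_mul_sq_le {α : Type*} [MeasurableSpace α] {ν : Measure α} {F r : α → ℝ≥0∞}
    (hF : AEMeasurable F ν) (hr : AEMeasurable r ν) (hr1 : ∫⁻ x, r x ∂ν = 1) :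
    (∫⁻ x, F x * r x ∂ν) ^ 2 ≤ ∫⁻ x, F x ^ 2 * r x ∂ν := by
  have hsq : ∀ a : ℝ≥0∞, a ^ (1 / 2 : ℝ) * a ^ (1 / 2 : ℝ) = a := fun a => by
    rw [← ENNReal.rpow_add_of_nonneg _ _ (by norm_num) (by norm_num)]; norm_num
  have h := ENNReal.lintegral_mul_le_Lp_mul_Lq ν Real.HolderConjugate.two_two
    (hF.mul (hr.pow_const (1 / 2 : ℝ))) (hr.pow_const (1 / 2 : ℝ))
  have h1 : ∀ x, ((F * fun y => r y ^ (1 / 2 : ℝ)) * fun y => r y ^ (1 / 2 : ℝ)) x = F x * r x :=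
    fun x => by simp only [Pi.mul_apply]; rw [mul_assoc, hsq]
  have h2 : ∀ x, (F * fun y => r y ^ (1 / 2 : ℝ)) x ^ (2 : ℝ) = F x ^ 2 * r x := fun x => by
    simp only [Pi.mul_apply]
    rw [ENNReal.rpow_two, mul_pow, sq (r x ^ _), hsq]
  have h3 : ∀ x, (r x ^ (1 / 2 : ℝ)) ^ (2 : ℝ) = r x := fun x => by
    rw [ENNReal.rpow_two, sq, hsq]
  simp only [Pi.mul_apply] at h h1 h2
  simp_rw [h1, h2, h3, hr1, ENNReal.one_rpow, mul_one] at h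
  calc (∫⁻ x, F x * r x ∂ν) ^ 2 ≤ ((∫⁻ x, F x ^ 2 * r x ∂ν) ^ (1 / 2 : ℝ)) ^ 2 := by gcongr
    _ = _ := by rw [sq, hsq]

theorem eLpNorm_two_sq {α G : Type*} [MeasurableSpace α] [NormedAddCommGroup G] {ν : Measure α}
    (f : α → G) : eLpNorm f 2 ν ^ 2 = ∫⁻ x, ‖f x‖ₑ ^ 2 ∂ν := by
  simpa using eLpNorm_nnreal_pow_eq_lintegral (μ := ν) (f := f) (p := 2) (by norm_num)

/-- Since `ρ` has mass one, `mollify f - f` is the `ρ`-average of the differences `f(· - z) - f`.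
Jensen's inequality and Tonelli's theorem bring the average outside the `L²` norm. -/
theorem eLpNorm_mollify_sub_le {f ρ : E → ℝ} (hf : MemLp f 2 μ) (hρ : Continuous ρ)
    (hc : HasCompactSupport ρ) (h0 : ∀ x, 0 ≤ ρ x) (h1 : ∫ x, ρ x ∂μ = 1) {ε : ℝ≥0∞}
    (hε : ∀ z, ρ z ≠ 0 → eLpNorm (fun x => f (x - z) - f x) 2 μ ≤ ε) :
    eLpNorm (mollify μ ρ f - f) 2 μ ≤ ε := by
  have hρi : Integrable ρ μ := hρ.integrable_of_hasCompactSupport hc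
  set r : E → ℝ≥0∞ := fun z => ENNReal.ofReal (ρ z) with hr
  have hrm : Measurable r := hρ.measurable.ennreal_ofReal
  have hr1 : ∫⁻ z, r z ∂μ = 1 := by
    rw [← ofReal_integral_eq_lintegral_ofReal hρi (Eventually.of_forall h0), h1,
      ENNReal.ofReal_one]
  have hmeas : AEStronglyMeasurable (fun p : E × E => f (p.1 - p.2) - f p.1) (μ.prod μ) :=
    (hf.aestronglyMeasurable.comp_quasiMeasurePreserving (quasiMeasurePreserving_sub μ μ)).sub
      hf.aestronglyMeasurable.comp_fst
  have hlf : LocallyIntegrable f μ := (MemLp.locL2 hf).locallyIntegrable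
  have hpt : ∀ x, AEStronglyMeasurable (fun z => f (x - z) - f x) μ := fun x =>
    (hf.aestronglyMeasurable.comp_quasiMeasurePreserving
      (quasiMeasurePreserving_sub_left μ x)).sub aestronglyMeasurable_const
  have hbound : ∀ x, ‖(mollify μ ρ f - f) x‖ₑ ^ 2
      ≤ ∫⁻ z, ‖f (x - z) - f x‖ₑ ^ 2 * r z ∂μ := by
    intro x
    have hint : Integrable (fun z => f (x - z) * ρ z) μ := by
      have := (hc.convolutionExists_right (ContinuousLinearMap.mul ℝ ℝ) hlf hρ x).integrable_swap
      simpa using this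
    have heq : (mollify μ ρ f - f) x = ∫ z, (f (x - z) - f x) * ρ z ∂μ := by
      simp only [Pi.sub_apply, mollify, convolution_mul_swap, sub_mul]
      rw [integral_sub hint (hρi.const_mul _), integral_const_mul, h1, mul_one]
    rw [heq]
    calc ‖∫ z, (f (x - z) - f x) * ρ z ∂μ‖ₑ ^ 2
        ≤ (∫⁻ z, ‖f (x - z) - f x‖ₑ * r z ∂μ) ^ 2 := by
          gcongr
          refine (enorm_integral_le_lintegral_enorm _).trans_eq (lintegral_congr fun z => ?_)
          rw [enorm_mul, Real.enorm_of_nonneg (h0 z)]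
      _ ≤ _ := lintegral_mul_sq_le (hpt x).enorm hrm.aemeasurable hr1
  have hfin : eLpNorm (mollify μ ρ f - f) 2 μ ^ 2 ≤ ε ^ 2 := by
    rw [eLpNorm_two_sq]
    calc ∫⁻ x, ‖(mollify μ ρ f - f) x‖ₑ ^ 2 ∂μ
        ≤ ∫⁻ x, ∫⁻ z, ‖f (x - z) - f x‖ₑ ^ 2 * r z ∂μ ∂μ := lintegral_mono hbound
      _ = ∫⁻ z, ∫⁻ x, ‖f (x - z) - f x‖ₑ ^ 2 * r z ∂μ ∂μ := by
          refine lintegral_lintegral_swap ?_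
          exact (hmeas.enorm.pow_const 2).mul (hrm.comp measurable_snd).aemeasurable
      _ = ∫⁻ z, eLpNorm (fun x => f (x - z) - f x) 2 μ ^ 2 * r z ∂μ := by
          refine lintegral_congr fun z => ?_
          rw [lintegral_mul_const' _ _ ENNReal.ofReal_ne_top, eLpNorm_two_sq]
      _ ≤ ∫⁻ z, ε ^ 2 * r z ∂μ := by
          refine lintegral_mono fun z => ?_
          by_cases hz : ρ z = 0
          · simp [hr, hz]
          · dsimp only
            gcongr
            exact hε z hz
      _ = ε ^ 2 := by rw [lintegral_const_mul _ hrm, hr1, mul_one]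
  exact (ENNReal.pow_le_pow_left_iff two_ne_zero).1 hfin

variable (E) in
/-- A sequence of bump functions at the origin with radii tending to zero. -/
noncomputable def bumpSeq (j : ℕ) : ContDiffBump (0 : E) where
  rIn := 1 / (2 * (j + 1))
  rOut := 1 / (j + 1)
  rIn_pos := by positivity
  rIn_lt_rOut := by
    apply one_div_lt_one_div_of_lt <;> [positivity; linarith [(by positivity : (0:ℝ) < j + 1)]]

variable (μ) in
/-- A sequence of standard mollifiers. -/
noncomputable def mollifier (j : ℕ) : E → ℝ := (bumpSeq E j).normed μ

theorem mollifier_contDiff (j : ℕ) : ContDiff ℝ ∞ (mollifier μ j) :=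
  (bumpSeq E j).contDiff_normed

theorem mollifier_hasCompactSupport (j : ℕ) : HasCompactSupport (mollifier μ j) :=
  (bumpSeq E j).hasCompactSupport_normed

theorem mollifier_nonneg (j : ℕ) (x : E) : 0 ≤ mollifier μ j x :=
  (bumpSeq E j).nonneg_normed x

theorem mollifier_eq_zero (j : ℕ) {x : E} (hx : (1 : ℝ) / (j + 1) ≤ ‖x‖) :
    mollifier μ j x = 0 := by
  by_contra h
  have : x ∈ Function.support ((bumpSeq E j).normed μ) := h
  rw [ContDiffBump.support_normed_eq] at this
  simp [bumpSeq] at this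
  simp at hx
  linarith

theorem tendsto_eLpNorm_mollify_sub {f : E → ℝ} (hf : MemLp f 2 μ) :
    Tendsto (fun j : ℕ => eLpNorm (mollify μ (mollifier μ j) f - f) 2 μ) atTop (𝓝 0) := by
  rw [ENNReal.tendsto_nhds_zero]
  intro ε hε
  have h := (ENNReal.tendsto_nhds_zero.1 (tendsto_eLpNorm_translate hf)) ε hε
  obtain ⟨δ, hδ, hball⟩ := Metric.eventually_nhds_iff.1 h
  have hlim : ∀ᶠ j : ℕ in atTop, (1 : ℝ) / (j + 1) < δ :=
    tendsto_one_div_add_atTop_nhds_zero_nat.eventually (gt_mem_nhds hδ)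
  filter_upwards [hlim] with j hj
  refine eLpNorm_mollify_sub_le hf (mollifier_contDiff j).continuous
    (mollifier_hasCompactSupport j) (mollifier_nonneg j) ((bumpSeq E j).integral_normed)
    fun z hz => hball ?_
  rw [dist_zero_right]
  by_contra hcon
  exact hz (mollifier_eq_zero j (hj.le.trans (not_lt.1 hcon)))

theorem mollify_contDiff {ρ f : E → ℝ} (hf : LocallyIntegrable f μ) (hρ : ContDiff ℝ ∞ ρ)
    (hc : HasCompactSupport ρ) : ContDiff ℝ ∞ (mollify μ ρ f) :=
  hc.contDiff_convolution_right _ hf hρ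

theorem fderiv_mollify {ρ f : E → ℝ} (hf : LocallyIntegrable f μ) (hρ : ContDiff ℝ ∞ ρ)
    (hc : HasCompactSupport ρ) (x e : E) :
    fderiv ℝ (mollify μ ρ f) x e = ∫ y, f y * fderiv ℝ ρ (x - y) e ∂μ := by
  rw [mollify, (hc.hasFDerivAt_convolution_right _ hf (hρ.of_le (by simp)) x).fderiv,
    convolution_precompR_apply _ hf (hc.fderiv (𝕜 := ℝ)) (hρ.continuous_fderiv (by simp))]
  simp [convolution_def]

theorem MemLp.mollify_memLp {f : E → ℝ} (hf : MemLp f 2 μ) :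
    ∀ᶠ j : ℕ in atTop, MemLp (mollify μ (mollifier μ j) f) 2 μ := by
  have h := (ENNReal.tendsto_nhds_zero.1 (tendsto_eLpNorm_mollify_sub hf)) 1 one_pos
  filter_upwards [h] with j hj
  have hm : AEStronglyMeasurable (mollify μ (mollifier μ j) f) μ :=
    (mollify_contDiff (MemLp.locL2 hf).locallyIntegrable (mollifier_contDiff j)
      (mollifier_hasCompactSupport j)).continuous.aestronglyMeasurable
  have h2 : MemLp (mollify μ (mollifier μ j) f - f) 2 μ :=
    ⟨hm.sub hf.aestronglyMeasurable, hj.trans_lt ENNReal.one_lt_top⟩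
  simpa using h2.add hf

/-- All mollifiers have radius at most `1`, so on the support of `χ` only values in its closed
`1`-neighbourhood `K` matter. Replacing `f` and `g` by their restrictions to `K` reduces the claim
to global `L²` convergence. -/
theorem tendsto_integral_mollify_mul {f g χ : E → ℝ} (hf : LocL2 μ f) (hg : LocL2 μ g)
    (hχ : Continuous χ) (hc : HasCompactSupport χ) :
    Tendsto (fun j : ℕ => ∫ x, mollify μ (mollifier μ j) f x * mollify μ (mollifier μ j) g x
      * χ x ∂μ) atTop (𝓝 (∫ x, f x * g x * χ x ∂μ)) := by
  set K := Metric.cthickening 1 (tsupport χ) with hK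
  have hKc : IsCompact K := hc.isCompact.cthickening
  have hloc : ∀ (j : ℕ) (u : E → ℝ), ∀ x ∈ tsupport χ,
      mollify μ (mollifier μ j) u x = mollify μ (mollifier μ j) (K.indicator u) x := by
    intro j u x hx
    simp only [mollify, convolution_mul]
    refine integral_congr_ae (Eventually.of_forall fun y => ?_)
    by_cases hy : y ∈ K
    · simp [indicator_of_mem hy]
    · dsimp only
      rw [mollifier_eq_zero j, mul_zero, mul_zero]
      have h1 : ¬ dist y x ≤ 1 := fun h => hy (Metric.mem_cthickening_of_dist_le y x 1 _ hx h)
      rw [← dist_eq_norm, dist_comm]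
      refine le_trans ?_ (not_le.1 h1).le
      rw [div_le_one (by positivity)]; linarith [(by positivity : (0:ℝ) ≤ j)]
  have hloc' : ∀ u : E → ℝ, ∀ x ∈ tsupport χ, u x = K.indicator u x := fun u x hx =>
    (indicator_of_mem (Metric.self_subset_cthickening _ hx) u).symm
  obtain ⟨C, hC⟩ := hc.exists_bound_of_continuous hχ
  have hcongr : ∀ F G F' G' : E → ℝ, (∀ x ∈ tsupport χ, F x = F' x) →
      (∀ x ∈ tsupport χ, G x = G' x) →
      ∫ x, F x * G x * χ x ∂μ = ∫ x, F' x * G' x * χ x ∂μ := by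
    intro F G F' G' h1 h2
    refine integral_congr_ae (Eventually.of_forall fun x => ?_)
    by_cases hx : x ∈ tsupport χ
    · simp only [h1 x hx, h2 x hx]
    · simp [image_eq_zero_of_notMem_tsupport hx]
  rw [hcongr _ _ _ _ (hloc' f) (hloc' g)]
  simp_rw [fun j => hcongr _ _ _ _ (hloc j f) (hloc j g)]
  have hf' := hf.indicator hKc
  have hg' := hg.indicator hKc
  exact tendsto_integral_mul_mul (MemLp.mollify_memLp hf') (MemLp.mollify_memLp hg') hf' hg'
    (tendsto_eLpNorm_mollify_sub hf') (tendsto_eLpNorm_mollify_sub hg')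
    hχ.aestronglyMeasurable hC

theorem mollifier_comp_sub_contDiff (j : ℕ) (x : E) :
    ContDiff ℝ ∞ (fun y => mollifier μ j (x - y)) :=
  (mollifier_contDiff j).comp (contDiff_const.sub contDiff_id)

theorem mollifier_comp_sub_hasCompactSupport (j : ℕ) (x : E) :
    HasCompactSupport (fun y => mollifier μ j (x - y)) :=
  (mollifier_hasCompactSupport j).comp_homeomorph (Homeomorph.subLeft x)

theorem fderiv_mollifier_comp_sub (j : ℕ) (x y e : E) :
    fderiv ℝ (fun y => mollifier μ j (x - y)) y e = -fderiv ℝ (mollifier μ j) (x - y) e := by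
  have h : HasFDerivAt (fun y => mollifier μ j (x - y))
      ((fderiv ℝ (mollifier μ j) (x - y)).comp (-(ContinuousLinearMap.id ℝ E))) y := by
    refine (((mollifier_contDiff j).differentiable (by simp)) (x - y)).hasFDerivAt.comp y ?_
    simpa using (hasFDerivAt_id y).const_sub x
  rw [h.fderiv]; simp

/-- Integration by parts against a smooth function of compact support. -/
theorem integral_mul_fderiv_of_hasCompactSupport {f g : E → ℝ} (hf : ContDiff ℝ ∞ f)
    (hg : ContDiff ℝ ∞ g) (hc : HasCompactSupport g) (e : E) :
    ∫ x, f x * fderiv ℝ g x e ∂μ = -∫ x, fderiv ℝ f x e * g x ∂μ := by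
  have hg' : Continuous fun x => fderiv ℝ g x e :=
    (hg.continuous_fderiv (by simp)).clm_apply continuous_const
  have hf' : Continuous fun x => fderiv ℝ f x e :=
    (hf.continuous_fderiv (by simp)).clm_apply continuous_const
  refine integral_mul_fderiv_eq_neg_fderiv_mul_of_integrable ?_ ?_ ?_ ?_ ?_
  · exact (hf'.mul hg.continuous).integrable_of_hasCompactSupport hc.mul_left
  · exact (hf.continuous.mul hg').integrable_of_hasCompactSupport
      (hc.fderiv_apply (𝕜 := ℝ) e).mul_left
  · exact (hf.continuous.mul hg.continuous).integrable_of_hasCompactSupport hc.mul_left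
  · exact fun x _ => hf.differentiable (by simp) x
  · exact fun x _ => hg.differentiable (by simp) x

end Mollify

end

/-! ### Energy identities for weak solutions of a scalar equation in divergence form. -/

section
section Energy

variable {n : ℕ}

instance : (volume : Measure (SpaceTime n)).IsAddHaarMeasure :=
  Measure.prod.instIsAddHaarMeasure volume volume

/-- The partial derivative `∂_α W` of a function on `ℝⁿ`. -/
noncomputable def partialDeriv (α : Fin n) (W : Space n → ℝ) (x : Space n) : ℝ :=
  fderiv ℝ W x (EuclideanSpace.single α 1)

/-- The reflected mollifier `Y ↦ ρ(X - Y)` is a test function; the sign from differentiating it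
cancels the sign in the definition of the weak gradient. -/
theorem spaceDeriv_mollify {u : SpaceTime n → ℝ} {g : SpaceTime n → Space n}
    (hu : LocL2 volume u) (hgrad : IsWeakGrad univ u g) (j : ℕ) (α : Fin n) (X : SpaceTime n) :
    spaceDeriv α (mollify volume (mollifier volume j) u) X
      = mollify volume (mollifier volume j) (fun Y => g Y α) X := by
  have htest : IsTestFunction univ (fun Y => mollifier (volume : Measure (SpaceTime n)) j (X - Y)) :=
    ⟨mollifier_comp_sub_contDiff j X, mollifier_comp_sub_hasCompactSupport j X, subset_univ _⟩
  have h := hgrad _ htest α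
  simp only [Measure.restrict_univ, spaceDeriv, fderiv_mollifier_comp_sub, mul_neg,
    integral_neg, neg_inj] at h
  rw [spaceDeriv, fderiv_mollify hu.locallyIntegrable (mollifier_contDiff j)
    (mollifier_hasCompactSupport j), h]
  simp [mollify, convolution_mul]

/-- Mollifying in all of space-time turns the weak equation into a classical one, with the fluxes
and the source mollified. -/
theorem timeDeriv_mollify {u F : SpaceTime n → ℝ} {J : SpaceTime n → Space n}
    (hu : LocL2 volume u) (hJ : ∀ α, LocL2 volume (fun X => J X α))
    (heq : ∀ φ : SpaceTime n → ℝ, IsTestFunction univ φ →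
      -(∫ X, u X * timeDeriv φ X) + ∑ α, ∫ X, J X α * spaceDeriv α φ X = ∫ X, F X * φ X)
    (j : ℕ) (X : SpaceTime n) :
    timeDeriv (mollify volume (mollifier volume j) u) X
      = mollify volume (mollifier volume j) F X
        + ∑ α, spaceDeriv α (mollify volume (mollifier volume j) (fun Y => J Y α)) X := by
  have htest : IsTestFunction univ (fun Y => mollifier (volume : Measure (SpaceTime n)) j (X - Y)) :=
    ⟨mollifier_comp_sub_contDiff j X, mollifier_comp_sub_hasCompactSupport j X, subset_univ _⟩
  have h := heq _ htest
  simp only [timeDeriv, spaceDeriv, fderiv_mollifier_comp_sub, mul_neg, integral_neg,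
    neg_neg, Finset.sum_neg_distrib] at h
  rw [timeDeriv, fderiv_mollify hu.locallyIntegrable (mollifier_contDiff j)
    (mollifier_hasCompactSupport j)]
  have h2 : ∀ α, spaceDeriv α (mollify volume (mollifier volume j) (fun Y => J Y α)) X
      = ∫ Y, J Y α * fderiv ℝ (mollifier volume j) (X - Y) (0, EuclideanSpace.single α 1) :=
    fun α => by
      rw [spaceDeriv, fderiv_mollify (hJ α).locallyIntegrable (mollifier_contDiff j)
        (mollifier_hasCompactSupport j)]
  simp only [h2]
  have h3 : mollify volume (mollifier volume j) F X
      = ∫ Y, F Y * mollifier volume j (X - Y) := by simp [mollify, convolution_mul]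
  rw [h3]; linarith

/-- The energy identity for smooth functions. -/
theorem energy_identity_smooth {v f : SpaceTime n → ℝ} {G : Fin n → SpaceTime n → ℝ}
    {χ : SpaceTime n → ℝ} (hv : ContDiff ℝ ∞ v) (hf : ContDiff ℝ ∞ f)
    (hG : ∀ α, ContDiff ℝ ∞ (G α)) (hχ : IsTestFunction univ χ)
    (heq : ∀ X, timeDeriv v X = f X + ∑ α, spaceDeriv α (G α) X) :
    -(1 / 2) * (∫ X, v X * v X * timeDeriv χ X)
      + (∑ α, ∫ X, G α X * spaceDeriv α v X * χ X)
      + (∑ α, ∫ X, G α X * v X * spaceDeriv α χ X) = ∫ X, f X * v X * χ X := by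
  have hint : ∀ w : SpaceTime n → ℝ, Continuous w → Integrable (fun X => w X * χ X) :=
    fun w hw => (hw.mul hχ.continuous).integrable_of_hasCompactSupport hχ.compact.mul_left
  have hd : ∀ {w : SpaceTime n → ℝ} (e : SpaceTime n), ContDiff ℝ ∞ w →
      Continuous fun X => fderiv ℝ w X e := fun e hw =>
    (hw.continuous_fderiv (by simp)).clm_apply continuous_const
  have h1 : ∫ X, v X * v X * timeDeriv χ X = -∫ X, 2 * v X * timeDeriv v X * χ X := by
    have := integral_mul_fderiv_of_hasCompactSupport (μ := volume) (hv.mul hv) hχ.smooth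
      hχ.compact ((1, 0) : SpaceTime n)
    simp only [timeDeriv]
    rw [this]
    congr 1
    refine integral_congr_ae (Eventually.of_forall fun X => ?_)
    have := timeDeriv_mul (hv.differentiable (by simp) X) (hv.differentiable (by simp) X)
    simp only [timeDeriv] at this
    simp only [this]; ring
  have h2 : ∀ α, (∫ X, G α X * spaceDeriv α v X * χ X) + ∫ X, G α X * v X * spaceDeriv α χ X
      = -∫ X, spaceDeriv α (G α) X * v X * χ X := by
    intro α
    have h := integral_mul_fderiv_of_hasCompactSupport (μ := volume) (hG α)
      (hv.mul hχ.smooth) hχ.compact.mul_left ((0, EuclideanSpace.single α 1) : SpaceTime n)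
    rw [← integral_add]
    · simp only [spaceDeriv]
      simp only [← mul_assoc] at h
      rw [← h]
      refine integral_congr_ae (Eventually.of_forall fun X => ?_)
      have := spaceDeriv_mul α (hv.differentiable (by simp) X) (hχ.differentiable X)
      simp only [spaceDeriv] at this
      simp only [this]; ring
    · exact hint _ ((hG α).continuous.mul (hd _ hv))
    · exact (((hG α).continuous.mul hv.continuous).mul
        (hχ.spaceDeriv α).continuous).integrable_of_hasCompactSupport
        (hχ.spaceDeriv α).compact.mul_left
  have h3 : ∫ X, 2 * v X * timeDeriv v X * χ X
      = 2 * (∫ X, f X * v X * χ X) + 2 * ∑ α, ∫ X, spaceDeriv α (G α) X * v X * χ X := by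
    rw [← integral_const_mul, ← integral_finsetSum, ← integral_const_mul, ← integral_add]
    · refine integral_congr_ae (Eventually.of_forall fun X => ?_)
      simp only [heq, ← Finset.sum_mul]; ring
    · exact (hint _ (hf.continuous.mul hv.continuous)).const_mul 2
    · exact (integrable_finsetSum _ fun α _ =>
        hint _ ((hd _ (hG α)).mul hv.continuous)).const_mul 2
    · exact fun α _ => hint _ ((hd _ (hG α)).mul hv.continuous)
  rw [add_assoc, ← Finset.sum_add_distrib, Finset.sum_congr rfl fun α _ => h2 α, h1, h3]
  simp only [Finset.sum_neg_distrib]; ring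

/-- The energy identity for weak solutions of `u_t = div J + F`. -/
theorem energy_identity {u F : SpaceTime n → ℝ} {g J : SpaceTime n → Space n}
    (hu : LocL2 volume u) (hF : LocL2 volume F) (hg : ∀ α, LocL2 volume (fun X => g X α))
    (hJ : ∀ α, LocL2 volume (fun X => J X α)) (hgrad : IsWeakGrad univ u g)
    (heq : ∀ φ : SpaceTime n → ℝ, IsTestFunction univ φ →
      -(∫ X, u X * timeDeriv φ X) + ∑ α, ∫ X, J X α * spaceDeriv α φ X = ∫ X, F X * φ X)
    {χ : SpaceTime n → ℝ} (hχ : IsTestFunction univ χ) :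
    -(1 / 2) * (∫ X, u X * u X * timeDeriv χ X) + (∑ α, ∫ X, J X α * g X α * χ X)
      + (∑ α, ∫ X, J X α * u X * spaceDeriv α χ X) = ∫ X, F X * u X * χ X := by
  have hsm : ∀ {f : SpaceTime n → ℝ}, LocL2 volume f → ∀ j,
      ContDiff ℝ ∞ (mollify volume (mollifier volume j) f) := fun hf j =>
    mollify_contDiff hf.locallyIntegrable (mollifier_contDiff j) (mollifier_hasCompactSupport j)
  -- Each term of the smooth identity pairs two mollified `L²_loc` functions with a fixed test
  -- function, so the limit can be taken without any regularity of `u` in time.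
  have hj := fun j : ℕ => energy_identity_smooth (hsm hu j) (hsm hF j) (fun α => hsm (hJ α) j) hχ
    (timeDeriv_mollify hu hJ heq j)
  simp only [spaceDeriv_mollify hu hgrad] at hj
  have hL := (((tendsto_integral_mollify_mul hu hu hχ.timeDeriv.continuous
    hχ.timeDeriv.compact).const_mul (-(1 / 2))).add
    (tendsto_finsetSum Finset.univ fun α _ =>
      tendsto_integral_mollify_mul (hJ α) (hg α) hχ.continuous hχ.compact)).add
    (tendsto_finsetSum Finset.univ fun α _ =>
      tendsto_integral_mollify_mul (hJ α) hu (hχ.spaceDeriv α).continuous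
        (hχ.spaceDeriv α).compact)
  exact tendsto_nhds_unique hL
    ((tendsto_integral_mollify_mul hF hu hχ.continuous hχ.compact).congr fun j => (hj j).symm)

/-- `f` is square integrable on every slab `(-T, T) × ℝⁿ`. -/
def SlabL2 {G : Type*} [NormedAddCommGroup G] (f : SpaceTime n → G) : Prop :=
  ∀ T : ℝ, MemLp f 2 (volume.restrict (Ioo (-T) T ×ˢ (univ : Set (Space n))))

theorem SlabL2.locL2 {G : Type*} [NormedAddCommGroup G] {f : SpaceTime n → G}
    (hf : SlabL2 f) : LocL2 volume f := by
  intro K hK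
  obtain ⟨r, hr⟩ := hK.isBounded.subset_ball 0
  refine (hf r).mono_measure (Measure.restrict_mono (fun X hX => ?_) le_rfl)
  have := hr hX
  rw [mem_ball_zero_iff] at this
  have h1 := (norm_fst_le X).trans_lt this
  rw [Real.norm_eq_abs, abs_lt] at h1
  exact ⟨h1, mem_univ _⟩

theorem SlabL2.sub {G : Type*} [NormedAddCommGroup G] {f g : SpaceTime n → G}
    (hf : SlabL2 f) (hg : SlabL2 g) : SlabL2 (fun X => f X - g X) := fun T => (hf T).sub (hg T)

theorem MemLp.slabL2 {G : Type*} [NormedAddCommGroup G] {f : SpaceTime n → G}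
    (hf : MemLp f 2 volume) : SlabL2 f := fun _ => hf.restrict _

theorem SlabL2.apply {g : SpaceTime n → Space n} (hg : SlabL2 g) (α : Fin n) :
    SlabL2 (fun X => g X α) := fun T =>
  (hg T).of_le ((EuclideanSpace.proj α : Space n →L[ℝ] ℝ).continuous.comp_aestronglyMeasurable
    (hg T).aestronglyMeasurable) (Eventually.of_forall fun X => PiLp.norm_apply_le (g X) α)

theorem slab_bound {T : ℝ} {h : SpaceTime n → ℝ} {C : ℝ}
    (hC : ∀ X, |h X| ≤ C) (h0 : ∀ X, X.1 ∉ Ioo (-T) T → h X = 0) (p : ℝ) (X : SpaceTime n) :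
    ‖p * h X‖ ≤ (Ioo (-T) T ×ˢ (univ : Set (Space n))).indicator (fun _ => C * |p|) X := by
  by_cases hX : X ∈ Ioo (-T) T ×ˢ (univ : Set (Space n))
  · rw [indicator_of_mem hX, norm_mul, mul_comm, Real.norm_eq_abs, Real.norm_eq_abs]
    gcongr
    exact hC X
  · rw [indicator_of_notMem hX, h0 X fun h => hX ⟨h, mem_univ _⟩]; simp

theorem SlabL2.integrable_mul_mul {p q h : SpaceTime n → ℝ} (hp : SlabL2 p) (hq : SlabL2 q)
    {T C : ℝ} (hm : AEStronglyMeasurable h) (hC : ∀ X, |h X| ≤ C)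
    (h0 : ∀ X, X.1 ∉ Ioo (-T) T → h X = 0) : Integrable (fun X => p X * q X * h X) := by
  have hS : MeasurableSet (Ioo (-T) T ×ˢ (univ : Set (Space n))) :=
    measurableSet_Ioo.prod MeasurableSet.univ
  have hi : Integrable ((Ioo (-T) T ×ˢ (univ : Set (Space n))).indicator
      fun X => C * |p X * q X|) :=
    (integrable_indicator_iff hS).2 (((hp T).integrable_mul (hq T)).abs.const_mul C)
  refine hi.mono' ((hp.locL2.aestronglyMeasurable.mul hq.locL2.aestronglyMeasurable).mul hm)
    (Eventually.of_forall fun X => ?_)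
  exact slab_bound hC h0 _ X

/-- Dominated convergence with majorant `C |p q|`, which is integrable on a slab though `p` and `q`
need not be globally square integrable. This removes spatial cutoffs while the time cutoff stays. -/
theorem tendsto_integral_slab {p q : SpaceTime n → ℝ} (hp : SlabL2 p) (hq : SlabL2 q)
    {h : ℕ → SpaceTime n → ℝ} {h' : SpaceTime n → ℝ} {T C : ℝ}
    (hm : ∀ k, AEStronglyMeasurable (h k)) (hC : ∀ k X, |h k X| ≤ C)
    (h0 : ∀ k X, X.1 ∉ Ioo (-T) T → h k X = 0)
    (hlim : ∀ X, Tendsto (fun k => h k X) atTop (𝓝 (h' X))) :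
    Tendsto (fun k => ∫ X, p X * q X * h k X) atTop (𝓝 (∫ X, p X * q X * h' X)) := by
  have hS : MeasurableSet (Ioo (-T) T ×ˢ (univ : Set (Space n))) :=
    measurableSet_Ioo.prod MeasurableSet.univ
  have hi : Integrable ((Ioo (-T) T ×ˢ (univ : Set (Space n))).indicator
      fun X => C * |p X * q X|) :=
    (integrable_indicator_iff hS).2 (((hp T).integrable_mul (hq T)).abs.const_mul C)
  refine tendsto_integral_of_dominated_convergence _
    (fun k => (hp.locL2.aestronglyMeasurable.mul hq.locL2.aestronglyMeasurable).mul (hm k)) hi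
    (fun k => Eventually.of_forall fun X => slab_bound (hC k) (h0 k) _ X)
    (Eventually.of_forall fun X => (hlim X).const_mul _)

/-- A smooth cutoff function on `ℝⁿ` that is `1` on the unit ball. -/
noncomputable def baseCutoff (n : ℕ) : ContDiffBump (0 : Space n) where
  rIn := 1
  rOut := 2
  rIn_pos := one_pos
  rIn_lt_rOut := one_lt_two

/-- Smooth cutoff functions of radius `k + 1`. -/
noncomputable def cutoff (n k : ℕ) (x : Space n) : ℝ := baseCutoff n ((1 / (k + 1 : ℝ)) • x)

theorem cutoff_contDiff (k : ℕ) : ContDiff ℝ ∞ (cutoff n k) :=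
  (baseCutoff n).contDiff.comp (contDiff_const_smul _)

theorem cutoff_nonneg (k : ℕ) (x : Space n) : 0 ≤ cutoff n k x := (baseCutoff n).nonneg

theorem cutoff_le_one (k : ℕ) (x : Space n) : cutoff n k x ≤ 1 := (baseCutoff n).le_one

theorem abs_cutoff_le (k : ℕ) (x : Space n) : |cutoff n k x| ≤ 1 := by
  rw [abs_of_nonneg (cutoff_nonneg k x)]; exact cutoff_le_one k x

theorem cutoff_eq_one {k : ℕ} {x : Space n} (hx : ‖x‖ ≤ k + 1) : cutoff n k x = 1 := by
  refine (baseCutoff n).one_of_mem_closedBall ?_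
  rw [mem_closedBall_zero_iff, norm_smul, Real.norm_of_nonneg (by positivity), one_div,
    inv_mul_le_iff₀ (by positivity)]
  simpa [baseCutoff] using hx

theorem cutoff_hasCompactSupport (k : ℕ) : HasCompactSupport (cutoff n k) := by
  have hk : (1 / (k + 1 : ℝ)) ≠ 0 := by positivity
  exact (baseCutoff n).hasCompactSupport.comp_homeomorph
    (Homeomorph.smulOfNeZero _ hk)

theorem exists_partialDeriv_cutoff_le (n : ℕ) : ∃ C, 0 ≤ C ∧ ∀ (k : ℕ) (α : Fin n) (x : Space n),
    |partialDeriv α (cutoff n k) x| ≤ C / (k + 1) := by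
  have hb : Continuous (fderiv ℝ (baseCutoff n : Space n → ℝ)) :=
    (baseCutoff n).contDiff.continuous_fderiv (n := 1) (by simp)
  obtain ⟨C, hC⟩ := ((baseCutoff n).hasCompactSupport.fderiv (𝕜 := ℝ)).exists_bound_of_continuous hb
  refine ⟨C, (norm_nonneg _).trans (hC 0), fun k α x => ?_⟩
  have hd : HasFDerivAt (cutoff n k) ((fderiv ℝ (baseCutoff n) ((1 / (k + 1 : ℝ)) • x)).comp
      ((1 / (k + 1 : ℝ)) • ContinuousLinearMap.id ℝ (Space n))) x :=
    (((baseCutoff n).contDiff (n := 1)).differentiable (by simp) _).hasFDerivAt.comp x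
      ((hasFDerivAt_id (𝕜 := ℝ) x).const_smul (1 / (k + 1 : ℝ)) :)
  rw [partialDeriv, hd.fderiv]
  simp only [ContinuousLinearMap.comp_smul, ContinuousLinearMap.comp_id,
    smul_apply, smul_eq_mul, abs_mul]
  rw [abs_of_nonneg (by positivity : (0:ℝ) ≤ 1 / (k + 1)), div_eq_mul_inv C, mul_comm C,
    ← one_div]
  gcongr
  refine ((fderiv ℝ (baseCutoff n) _).le_opNorm _).trans ?_
  simpa using hC _

theorem tendsto_cutoff (x : Space n) : Tendsto (fun k => cutoff n k x) atTop (𝓝 1) := by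
  refine tendsto_const_nhds.congr' ?_
  obtain ⟨m, hm⟩ := exists_nat_ge ‖x‖
  filter_upwards [eventually_ge_atTop m] with k hk
  refine (cutoff_eq_one ?_).symm
  have : (m : ℝ) ≤ k := by exact_mod_cast hk
  linarith

theorem IsTestFunction.prod {τ : ℝ → ℝ} {W : Space n → ℝ} (hτ : ContDiff ℝ ∞ τ)
    (hτc : HasCompactSupport τ) (hW : ContDiff ℝ ∞ W) (hWc : HasCompactSupport W) :
    IsTestFunction univ (fun X : SpaceTime n => τ X.1 * W X.2) where
  smooth := (hτ.comp contDiff_fst).mul (hW.comp contDiff_snd)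
  compact := by
    refine HasCompactSupport.intro (hτc.isCompact.prod hWc.isCompact) fun X hX => ?_
    by_cases h : X.1 ∈ tsupport τ
    · have : X.2 ∉ tsupport W := fun h' => hX ⟨h, h'⟩
      simp [image_eq_zero_of_notMem_tsupport this]
    · simp [image_eq_zero_of_notMem_tsupport h]
  support := subset_univ _

theorem timeDeriv_prod {τ : ℝ → ℝ} {W : Space n → ℝ} (hτ : Differentiable ℝ τ)
    (hW : Differentiable ℝ W) (X : SpaceTime n) :
    timeDeriv (fun X : SpaceTime n => τ X.1 * W X.2) X = deriv τ X.1 * W X.2 := by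
  rw [timeDeriv_mul (φ := fun X : SpaceTime n => τ X.1) (ψ := fun X : SpaceTime n => W X.2)
    ((hτ X.1).comp X differentiableAt_fst) ((hW X.2).comp X differentiableAt_snd), timeDeriv_snd W hW, timeDeriv_fst τ hτ]
  simp

theorem spaceDeriv_prod {τ : ℝ → ℝ} {W : Space n → ℝ} (hτ : Differentiable ℝ τ)
    (hW : Differentiable ℝ W) (α : Fin n) (X : SpaceTime n) :
    spaceDeriv α (fun X : SpaceTime n => τ X.1 * W X.2) X = τ X.1 * partialDeriv α W X.2 := by
  rw [spaceDeriv_mul α (φ := fun X : SpaceTime n => τ X.1) (ψ := fun X : SpaceTime n => W X.2)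
    ((hτ X.1).comp X differentiableAt_fst) ((hW X.2).comp X differentiableAt_snd), spaceDeriv_snd W hW, spaceDeriv_fst τ hτ]
  simp [partialDeriv]

theorem continuous_partialDeriv {W : Space n → ℝ} (hW : ContDiff ℝ ∞ W) (α : Fin n) :
    Continuous (partialDeriv α W) :=
  (hW.continuous_fderiv (by simp)).clm_apply continuous_const

/-- The energy identity with a weight `τ(t) W(x)`. -/
theorem energy_identity_weight {u F : SpaceTime n → ℝ} {g J : SpaceTime n → Space n}
    (hu : SlabL2 u) (hF : SlabL2 F) (hg : ∀ α, SlabL2 (fun X => g X α))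
    (hJ : ∀ α, SlabL2 (fun X => J X α)) (hgrad : IsWeakGrad univ u g)
    (heq : ∀ φ : SpaceTime n → ℝ, IsTestFunction univ φ →
      -(∫ X, u X * timeDeriv φ X) + ∑ α, ∫ X, J X α * spaceDeriv α φ X = ∫ X, F X * φ X)
    {τ : ℝ → ℝ} (hτ : ContDiff ℝ ∞ τ) (hτc : HasCompactSupport τ)
    {W : Space n → ℝ} (hW : ContDiff ℝ ∞ W) {C : ℝ} (hWC : ∀ x, |W x| ≤ C)
    (hDWC : ∀ α x, |partialDeriv α W x| ≤ C) :
    -(1 / 2) * (∫ X, u X * u X * (deriv τ X.1 * W X.2))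
      + (∑ α, ∫ X, J X α * g X α * (τ X.1 * W X.2))
      + (∑ α, ∫ X, J X α * u X * (τ X.1 * partialDeriv α W X.2))
      = ∫ X, F X * u X * (τ X.1 * W X.2) := by
  obtain ⟨D, hD0, hD⟩ := exists_partialDeriv_cutoff_le n
  obtain ⟨T, hT⟩ := hτc.isCompact.isBounded.subset_ball 0
  have hTI : ∀ t, t ∉ Ioo (-T) T → t ∉ tsupport τ := fun t ht h => ht (by
    have := hT h
    rwa [mem_ball_zero_iff, Real.norm_eq_abs, abs_lt] at this)
  have hτ0 : ∀ t, t ∉ Ioo (-T) T → τ t = 0 := fun t ht =>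
    image_eq_zero_of_notMem_tsupport (hTI t ht)
  have hτ'0 : ∀ t, t ∉ Ioo (-T) T → deriv τ t = 0 := fun t ht => by
    by_contra h
    exact hTI t ht (support_deriv_subset (f := τ) h)
  have hC0 : 0 ≤ C := (abs_nonneg _).trans (hWC 0)
  obtain ⟨M, hM⟩ := hτc.exists_bound_of_continuous hτ.continuous
  have hM0 : 0 ≤ M := (norm_nonneg _).trans (hM 0)
  have hτ'c : Continuous (deriv τ) := hτ.continuous_deriv (by simp)
  obtain ⟨M', hM'⟩ := hτc.deriv.exists_bound_of_continuous hτ'c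
  have hM'0 : 0 ≤ M' := (norm_nonneg _).trans (hM' 0)
  simp only [Real.norm_eq_abs] at hM hM'
  have hdτ : Differentiable ℝ τ := hτ.differentiable (by simp)
  have hdW : Differentiable ℝ W := hW.differentiable (by simp)
  -- The weight need not have compact support. It is truncated at radius `k + 1`; the truncations
  -- and their gradients stay bounded and converge pointwise.
  let Wk : ℕ → Space n → ℝ := fun k x => W x * cutoff n k x
  have hWk : ∀ k, ContDiff ℝ ∞ (Wk k) := fun k => hW.mul (cutoff_contDiff k)
  have hWkc : ∀ k, HasCompactSupport (Wk k) := fun k => (cutoff_hasCompactSupport k).mul_left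
  have hdWk : ∀ k, Differentiable ℝ (Wk k) := fun k => (hWk k).differentiable (by simp)
  have hpd : ∀ k α x, partialDeriv α (Wk k) x
      = W x * partialDeriv α (cutoff n k) x + partialDeriv α W x * cutoff n k x := fun k α x => by
    simp only [partialDeriv, Wk]
    rw [fderiv_fun_mul (hdW x) ((cutoff_contDiff k).differentiable (by simp) x)]
    simp [mul_comm]
  have key := fun k => energy_identity hu.locL2 hF.locL2 (fun α => (hg α).locL2)
    (fun α => (hJ α).locL2) hgrad heq (IsTestFunction.prod hτ hτc (hWk k) (hWkc k))
  simp only [timeDeriv_prod hdτ (hdWk _), spaceDeriv_prod hdτ (hdWk _)] at key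
  have hWb : ∀ k x, |Wk k x| ≤ C := fun k x => by
    simp only [Wk, abs_mul]
    calc |W x| * |cutoff n k x| ≤ C * 1 := by gcongr <;> [exact hWC x; exact abs_cutoff_le k x]
      _ = C := mul_one C
  have hWl : ∀ x, Tendsto (fun k => Wk k x) atTop (𝓝 (W x)) := fun x => by
    simpa [Wk] using (tendsto_cutoff x).const_mul (W x)
  have hDWb : ∀ k α x, |partialDeriv α (Wk k) x| ≤ C * D + C := fun k α x => by
    rw [hpd]
    refine (abs_add_le _ _).trans ?_
    simp only [abs_mul]
    have h1 : |partialDeriv α (cutoff n k) x| ≤ D :=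
      (hD k α x).trans (div_le_self hD0 (by linarith [(by positivity : (0:ℝ) ≤ k)]))
    calc |W x| * |partialDeriv α (cutoff n k) x| + |partialDeriv α W x| * |cutoff n k x|
        ≤ C * D + C * 1 := by
          gcongr <;> [exact hWC x; exact hDWC α x; exact abs_cutoff_le k x]
      _ = C * D + C := by ring
  have hDWl : ∀ α x, Tendsto (fun k => partialDeriv α (Wk k) x) atTop
      (𝓝 (partialDeriv α W x)) := fun α x => by
    simp only [hpd]
    have h1 : Tendsto (fun k => partialDeriv α (cutoff n k) x) atTop (𝓝 0) := by
      refine squeeze_zero_norm (fun k => hD k α x) ?_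
      simpa [div_eq_mul_inv] using (tendsto_one_div_add_atTop_nhds_zero_nat (𝕜 := ℝ)).const_mul D
    simpa using (h1.const_mul (W x)).add ((tendsto_cutoff x).const_mul (partialDeriv α W x))
  have cτ : Continuous fun X : SpaceTime n => τ X.1 := hτ.continuous.comp continuous_fst
  have cτ' : Continuous fun X : SpaceTime n => deriv τ X.1 := hτ'c.comp continuous_fst
  have l1 := tendsto_integral_slab hu hu (h := fun k X => deriv τ X.1 * Wk k X.2)
    (h' := fun X => deriv τ X.1 * W X.2) (T := T) (C := M' * C)
    (fun k => (cτ'.mul ((hWk k).continuous.comp continuous_snd)).aestronglyMeasurable)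
    (fun k X => by rw [abs_mul]; exact mul_le_mul (hM' _) (hWb k _) (abs_nonneg _) hM'0)
    (fun k X hX => by simp [hτ'0 _ hX]) (fun X => (hWl X.2).const_mul _)
  have l2 : ∀ {p q : SpaceTime n → ℝ}, SlabL2 p → SlabL2 q →
      Tendsto (fun k => ∫ X, p X * q X * (τ X.1 * Wk k X.2)) atTop
        (𝓝 (∫ X, p X * q X * (τ X.1 * W X.2))) := fun hp hq =>
    tendsto_integral_slab hp hq (h := fun k X => τ X.1 * Wk k X.2)
      (h' := fun X => τ X.1 * W X.2) (T := T) (C := M * C)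
      (fun k => (cτ.mul ((hWk k).continuous.comp continuous_snd)).aestronglyMeasurable)
      (fun k X => by rw [abs_mul]; exact mul_le_mul (hM _) (hWb k _) (abs_nonneg _) hM0)
      (fun k X hX => by simp [hτ0 _ hX]) (fun X => (hWl X.2).const_mul _)
  have l3 : ∀ α, Tendsto (fun k => ∫ X, J X α * u X * (τ X.1 * partialDeriv α (Wk k) X.2)) atTop
        (𝓝 (∫ X, J X α * u X * (τ X.1 * partialDeriv α W X.2))) := fun α =>
    tendsto_integral_slab (hJ α) hu (h := fun k X => τ X.1 * partialDeriv α (Wk k) X.2)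
      (h' := fun X => τ X.1 * partialDeriv α W X.2) (T := T) (C := M * (C * D + C))
      (fun k => (cτ.mul ((continuous_partialDeriv (hWk k) α).comp
        continuous_snd)).aestronglyMeasurable)
      (fun k X => by rw [abs_mul]; exact mul_le_mul (hM _) (hDWb k α _) (abs_nonneg _) hM0)
      (fun k X hX => by simp [hτ0 _ hX]) (fun X => (hDWl α X.2).const_mul _)
  have hL := ((l1.const_mul (-(1 / 2))).add
    (tendsto_finsetSum Finset.univ fun α _ => l2 (hJ α) (hg α))).add
    (tendsto_finsetSum Finset.univ fun α _ => l3 α)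
  exact tendsto_nhds_unique hL ((l2 hF hu).congr fun k => (key k).symm)

end Energy

end

/-! ### The system and its weighted energy estimate. -/

section
section System

variable {n N : ℕ}

/-- The flux `A^{αβ}_{ij} D_β u^j`, as a vector indexed by `α`. -/
noncomputable def flux (A : Coeff n N) (Du : Fin N → SpaceTime n → Space n) (i : Fin N)
    (X : SpaceTime n) : Space n :=
  WithLp.toLp 2 fun α => ∑ j, ∑ β, A X α β i j * Du j X β

theorem flux_apply (A : Coeff n N) (Du : Fin N → SpaceTime n → Space n) (i : Fin N)
    (X : SpaceTime n) (α : Fin n) : flux A Du i X α = ∑ j, ∑ β, A X α β i j * Du j X β := rfl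

theorem ellipticForm_eq (A : Coeff n N) (Du : Fin N → SpaceTime n → Space n)
    (φ : Fin N → SpaceTime n → ℝ) (X : SpaceTime n) :
    ellipticForm A Du φ X = ∑ i, ∑ α, flux A Du i X α * spaceDeriv α (φ i) X := by
  simp only [ellipticForm, flux_apply, Finset.sum_mul]
  exact Finset.sum_congr rfl fun i _ => Finset.sum_comm

theorem IsParabolic.abs_le {lam Lam : ℝ} {A : Coeff n N} (hA : IsParabolic lam Lam A)
    (hLam : 0 < Lam) (X : SpaceTime n) (α β : Fin n) (i j : Fin N) : |A X α β i j| ≤ Lam := by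
  refine abs_le_of_sq_le_sq (le_trans ?_ (hA.bounded X)) hLam.le
  calc A X α β i j ^ 2 ≤ ∑ β, A X α β i j ^ 2 :=
        Finset.single_le_sum (f := fun β => A X α β i j ^ 2) (fun _ _ => sq_nonneg _)
          (Finset.mem_univ β)
    _ ≤ ∑ α, ∑ β, A X α β i j ^ 2 :=
        Finset.single_le_sum (f := fun α => ∑ β, A X α β i j ^ 2)
          (fun _ _ => Finset.sum_nonneg fun _ _ => sq_nonneg _) (Finset.mem_univ α)
    _ ≤ ∑ j, ∑ α, ∑ β, A X α β i j ^ 2 :=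
        Finset.single_le_sum (f := fun j => ∑ α, ∑ β, A X α β i j ^ 2)
          (fun _ _ => Finset.sum_nonneg fun _ _ => Finset.sum_nonneg fun _ _ => sq_nonneg _)
          (Finset.mem_univ j)
    _ ≤ _ :=
        Finset.single_le_sum (f := fun i => ∑ j, ∑ α, ∑ β, A X α β i j ^ 2)
          (fun _ _ => Finset.sum_nonneg fun _ _ => Finset.sum_nonneg fun _ _ =>
            Finset.sum_nonneg fun _ _ => sq_nonneg _) (Finset.mem_univ i)

theorem flux_sq_le {lam Lam : ℝ} {A : Coeff n N} (hA : IsParabolic lam Lam A)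
    (Du : Fin N → SpaceTime n → Space n) (X : SpaceTime n) :
    ∑ i, ‖flux A Du i X‖ ^ 2 ≤ Lam ^ 2 * ∑ j, ‖Du j X‖ ^ 2 := by
  have hsq : ∀ (v : Space n), ‖v‖ ^ 2 = ∑ α, v α ^ 2 := EuclideanSpace.real_norm_sq_eq
  simp only [hsq]
  have h1 : ∀ i α, flux A Du i X α ^ 2
      ≤ (∑ j, ∑ β, A X α β i j ^ 2) * ∑ j, ∑ β, Du j X β ^ 2 := by
    intro i α
    rw [flux_apply, ← Fintype.sum_prod_type', ← Fintype.sum_prod_type', ← Fintype.sum_prod_type']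
    exact Finset.sum_mul_sq_le_sq_mul_sq _ _ _
  calc ∑ i, ∑ α, flux A Du i X α ^ 2
      ≤ ∑ i, ∑ α, (∑ j, ∑ β, A X α β i j ^ 2) * ∑ j, ∑ β, Du j X β ^ 2 :=
        Finset.sum_le_sum fun i _ => Finset.sum_le_sum fun α _ => h1 i α
    _ = (∑ i, ∑ α, ∑ j, ∑ β, A X α β i j ^ 2) * ∑ j, ∑ β, Du j X β ^ 2 := by
        simp only [Finset.sum_mul]
    _ = (∑ i, ∑ j, ∑ α, ∑ β, A X α β i j ^ 2) * ∑ j, ∑ β, Du j X β ^ 2 := by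
        congr 1; exact Finset.sum_congr rfl fun i _ => Finset.sum_comm
    _ ≤ _ := mul_le_mul_of_nonneg_right (hA.bounded X)
        (Finset.sum_nonneg fun _ _ => Finset.sum_nonneg fun _ _ => sq_nonneg _)

theorem inner_flux_ge {lam Lam : ℝ} {A : Coeff n N} (hA : IsParabolic lam Lam A)
    (Du : Fin N → SpaceTime n → Space n) (X : SpaceTime n) :
    lam * ∑ i, ‖Du i X‖ ^ 2 ≤ ∑ i, ∑ α, flux A Du i X α * Du i X α := by
  have hsq : ∀ (v : Space n), ‖v‖ ^ 2 = ∑ α, v α ^ 2 := EuclideanSpace.real_norm_sq_eq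
  simp only [hsq]
  refine (hA.parabolic X fun i α => Du i X α).trans_eq (Finset.sum_congr rfl fun i _ => ?_)
  rw [Finset.sum_comm]
  simp only [flux_apply, Finset.sum_mul]

theorem MemLp.flux_apply {lam Lam : ℝ} {A : Coeff n N} (hA : IsParabolic lam Lam A)
    (hLam : 0 < Lam) {Du : Fin N → SpaceTime n → Space n} {S : Set (SpaceTime n)}
    (hDu : ∀ i, MemLp (Du i) 2 (volume.restrict S)) (i : Fin N) (α : Fin n) :
    MemLp (fun X => flux A Du i X α) 2 (volume.restrict S) := by
  simp only [ParabolicSystem.flux_apply]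
  refine memLp_finsetSum _ fun j _ => memLp_finsetSum _ fun β _ => ?_
  refine MemLp.of_le_mul (c := Lam) (hDu j)
    ((hA.measurable α β i j).aestronglyMeasurable.restrict.mul
      ((EuclideanSpace.proj β : Space n →L[ℝ] ℝ).continuous.comp_aestronglyMeasurable
        (hDu j).aestronglyMeasurable)) (Eventually.of_forall fun X => ?_)
  rw [norm_mul]
  exact mul_le_mul (hA.abs_le hLam X α β i j) (PiLp.norm_apply_le _ β) (norm_nonneg _) hLam.le

theorem memLp_of_apply {S : Set (SpaceTime n)} {J : SpaceTime n → Space n}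
    (hJ : ∀ α, MemLp (fun X => J X α) 2 (volume.restrict S)) :
    MemLp J 2 (volume.restrict S) := by
  have h : J = fun X => ∑ α, J X α • (EuclideanSpace.single α (1 : ℝ) : Space n) := by
    funext X; ext β; simp [Finset.sum_apply, Pi.single_apply]
  rw [h]
  refine memLp_finsetSum _ fun α _ => ?_
  exact MemLp.of_le_mul (c := 1) (hJ α) ((hJ α).aestronglyMeasurable.smul_const _)
    (Eventually.of_forall fun X => by simp [norm_smul])

theorem SlabL2.flux {lam Lam : ℝ} {A : Coeff n N} (hA : IsParabolic lam Lam A)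
    (hLam : 0 < Lam) {Du : Fin N → SpaceTime n → Space n}
    (hDu : ∀ i, SlabL2 (Du i)) (i : Fin N) : SlabL2 (flux A Du i) := fun T =>
  memLp_of_apply fun α => MemLp.flux_apply hA hLam (fun i => hDu i T) i α

/-- `w`, with weak gradients `Dw`, solves `w_t - D_α(A^{αβ} D_β w) = F - div H` in `ℝⁿ⁺¹`; all
functions are square integrable on slabs. -/
structure GlobalSol (A : Coeff n N) (F : Fin N → SpaceTime n → ℝ)
    (H : Fin N → SpaceTime n → Space n) (w : Fin N → SpaceTime n → ℝ)
    (Dw : Fin N → SpaceTime n → Space n) : Prop where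
  source : ∀ i, SlabL2 (F i)
  source_flux : ∀ i, SlabL2 (H i)
  memL2 : ∀ i, SlabL2 (w i)
  memL2_grad : ∀ i, SlabL2 (Dw i)
  weakGrad : ∀ i, IsWeakGrad univ (w i) (Dw i)
  eqn : ∀ (i : Fin N) (φ : SpaceTime n → ℝ), IsTestFunction univ φ →
    -(∫ X, w i X * timeDeriv φ X) + ∑ α, ∫ X, flux A Dw i X α * spaceDeriv α φ X
      = (∫ X, F i X * φ X) + ∑ α, ∫ X, H i X α * spaceDeriv α φ X

/-- The gradient of `W` as a vector. -/
noncomputable def gradVec (W : Space n → ℝ) (x : Space n) : Space n :=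
  WithLp.toLp 2 fun α => partialDeriv α W x

/-- The exponential rate in the weighted energy estimate. -/
noncomputable def energyRate (lam Lam : ℝ) : ℝ := 4 * Lam ^ 2 / lam + lam

theorem energyRate_pos {lam Lam : ℝ} (hlam : 0 < lam) : 0 < energyRate lam Lam := by
  unfold energyRate; positivity

/-- The pointwise part of the energy estimate: `p` is the gradient, `q` the flux, `h` the divergence
source and `D` the gradient of the weight. The term in `‖q‖²` is kept because the flux is dominated
by the gradient only after summation over the components. Its coefficient `lam / (4 Lam²)` then
costs `lam / 4` of the ellipticity and the product of `p` and `h` costs another `lam / 4`, so `lam /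
2` survives. The two cross terms with `D` add up to `energyRate`. -/
theorem weighted_young {lam Lam ϱ T : ℝ} (hlam : 0 < lam) (hLam : 0 < Lam) (hT : 0 < T)
    (p q h D : Space n) (u f W : ℝ) (hW : 0 ≤ W) (hD : ‖D‖ ≤ 2 * ϱ * W) :
    (∑ α, q α * p α) * W - W * (lam / 4 * ‖p‖ ^ 2 + lam / (4 * Lam ^ 2) * ‖q‖ ^ 2
        + (energyRate lam Lam * ϱ ^ 2 + 1 / (2 * T)) * u ^ 2 + T / 2 * f ^ 2
        + 2 / lam * ‖h‖ ^ 2)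
      ≤ (∑ α, (q α - h α) * p α) * W + (∑ α, (q α - h α) * (u * D α)) - f * u * W := by
  have e1 : ∑ α, (q α - h α) * p α = (∑ α, q α * p α) - inner ℝ p h := by
    simp only [PiLp.inner_apply, sub_mul, Finset.sum_sub_distrib, RCLike.inner_apply, conj_trivial]
  have e2 : ∑ α, (q α - h α) * (u * D α) = u * inner ℝ D q - u * inner ℝ D h := by
    simp only [PiLp.inner_apply, sub_mul, Finset.sum_sub_distrib, Finset.mul_sum,
      RCLike.inner_apply, conj_trivial]
    congr 1 <;> exact Finset.sum_congr rfl fun _ _ => by ring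
  rw [e1, e2]
  have i1 : inner ℝ p h ≤ lam / 4 * ‖p‖ ^ 2 + 1 / lam * ‖h‖ ^ 2 := by
    refine (real_inner_le_norm p h).trans ?_
    have : lam / 4 * ‖p‖ ^ 2 + 1 / lam * ‖h‖ ^ 2 - ‖p‖ * ‖h‖
        = 1 / lam * (lam / 2 * ‖p‖ - ‖h‖) ^ 2 := by field_simp; ring
    have h2 : 0 ≤ 1 / lam * (lam / 2 * ‖p‖ - ‖h‖) ^ 2 := by positivity
    linarith
  have hcs : ∀ v : Space n, |u * inner ℝ D v| ≤ W * (2 * ϱ * |u| * ‖v‖) := fun v => by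
    rw [abs_mul]
    calc |u| * |inner ℝ D v| ≤ |u| * (‖D‖ * ‖v‖) := by gcongr; exact abs_real_inner_le_norm D v
      _ ≤ |u| * (2 * ϱ * W * ‖v‖) := by gcongr
      _ = _ := by ring
  have i2 : -(W * (lam / (4 * Lam ^ 2) * ‖q‖ ^ 2 + 4 * Lam ^ 2 / lam * ϱ ^ 2 * u ^ 2))
      ≤ u * inner ℝ D q := by
    refine le_trans (neg_le_neg ?_) (neg_le_of_abs_le (hcs q))
    gcongr
    have : lam / (4 * Lam ^ 2) * ‖q‖ ^ 2 + 4 * Lam ^ 2 / lam * ϱ ^ 2 * u ^ 2 - 2 * ϱ * |u| * ‖q‖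
        = lam / (4 * Lam ^ 2) * (‖q‖ - 4 * Lam ^ 2 / lam * ϱ * |u|) ^ 2 := by
      rw [← sq_abs u]; field_simp; ring
    have h2 : 0 ≤ lam / (4 * Lam ^ 2) * (‖q‖ - 4 * Lam ^ 2 / lam * ϱ * |u|) ^ 2 := by positivity
    linarith
  have i3 : u * inner ℝ D h ≤ W * (lam * ϱ ^ 2 * u ^ 2 + 1 / lam * ‖h‖ ^ 2) := by
    refine (le_abs_self _).trans ((hcs h).trans ?_)
    gcongr
    have : lam * ϱ ^ 2 * u ^ 2 + 1 / lam * ‖h‖ ^ 2 - 2 * ϱ * |u| * ‖h‖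
        = 1 / lam * (lam * ϱ * |u| - ‖h‖) ^ 2 := by
      rw [← sq_abs u]; field_simp; ring
    have h2 : 0 ≤ 1 / lam * (lam * ϱ * |u| - ‖h‖) ^ 2 := by positivity
    linarith
  have i4 : f * u ≤ 1 / (2 * T) * u ^ 2 + T / 2 * f ^ 2 := by
    have : 1 / (2 * T) * u ^ 2 + T / 2 * f ^ 2 - f * u = 1 / (2 * T) * (u - T * f) ^ 2 := by
      field_simp; ring
    have h2 : 0 ≤ 1 / (2 * T) * (u - T * f) ^ 2 := by positivity
    linarith
  have j1 := mul_le_mul_of_nonneg_left i1 hW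
  have j4 := mul_le_mul_of_nonneg_left i4 hW
  have e3 : W * (lam / 4 * ‖p‖ ^ 2 + lam / (4 * Lam ^ 2) * ‖q‖ ^ 2
        + (energyRate lam Lam * ϱ ^ 2 + 1 / (2 * T)) * u ^ 2 + T / 2 * f ^ 2
        + 2 / lam * ‖h‖ ^ 2) = W * (lam / 4 * ‖p‖ ^ 2 + 1 / lam * ‖h‖ ^ 2)
      + W * (lam / (4 * Lam ^ 2) * ‖q‖ ^ 2 + 4 * Lam ^ 2 / lam * ϱ ^ 2 * u ^ 2)
      + W * (lam * ϱ ^ 2 * u ^ 2 + 1 / lam * ‖h‖ ^ 2)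
      + W * (1 / (2 * T) * u ^ 2 + T / 2 * f ^ 2) := by
    unfold energyRate; ring
  rw [e3]
  linarith

/-- The energy estimate with weight `τ(t) W(x)`. -/
theorem weighted_energy {lam Lam : ℝ} (hlam : 0 < lam) (hLam : 0 < Lam) {A : Coeff n N}
    (hA : IsParabolic lam Lam A) {F : Fin N → SpaceTime n → ℝ} {H : Fin N → SpaceTime n → Space n}
    {w : Fin N → SpaceTime n → ℝ} {Dw : Fin N → SpaceTime n → Space n}
    (hw : GlobalSol A F H w Dw) {a : ℝ} (hwa : ∀ i X, X.1 < a → w i X = 0) {ϱ T : ℝ}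
    (hT : 0 < T) {τ : ℝ → ℝ} (hτ : ContDiff ℝ ∞ τ) (hτc : HasCompactSupport τ)
    (hτ0 : ∀ t, 0 ≤ τ t)
    (hτ' : ∀ t, a ≤ t → (energyRate lam Lam * ϱ ^ 2 + 1 / T) * τ t ≤ -(1 / 2) * deriv τ t)
    {W : Space n → ℝ} (hW : ContDiff ℝ ∞ W) {C : ℝ} (hW0 : ∀ x, 0 ≤ W x) (hWC : ∀ x, W x ≤ C)
    (hDW : ∀ x, ‖gradVec W x‖ ≤ 2 * ϱ * W x) (hϱ : 0 ≤ ϱ) :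
    ∫ X, (lam / 2 * ∑ i, ‖Dw i X‖ ^ 2 + 1 / (2 * T) * ∑ i, w i X ^ 2) * (τ X.1 * W X.2)
      ≤ ∫ X, (T / 2 * ∑ i, F i X ^ 2 + 2 / lam * ∑ i, ‖H i X‖ ^ 2) * (τ X.1 * W X.2) := by
  have hC0 : 0 ≤ C := (hW0 0).trans (hWC 0)
  obtain ⟨S, hS⟩ := hτc.isCompact.isBounded.subset_ball 0
  have hSI : ∀ t, t ∉ Ioo (-S) S → t ∉ tsupport τ := fun t ht h => ht (by
    have := hS h
    rwa [mem_ball_zero_iff, Real.norm_eq_abs, abs_lt] at this)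
  have hτ0' : ∀ t, t ∉ Ioo (-S) S → τ t = 0 := fun t ht =>
    image_eq_zero_of_notMem_tsupport (hSI t ht)
  have hτ'0 : ∀ t, t ∉ Ioo (-S) S → deriv τ t = 0 := fun t ht => by
    by_contra h
    exact hSI t ht (support_deriv_subset (f := τ) h)
  obtain ⟨M, hM⟩ := hτc.exists_bound_of_continuous hτ.continuous
  have hM0 : 0 ≤ M := (norm_nonneg _).trans (hM 0)
  have hτ'c : Continuous (deriv τ) := hτ.continuous_deriv (by simp)
  obtain ⟨M', hM'⟩ := hτc.deriv.exists_bound_of_continuous hτ'c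
  have hM'0 : 0 ≤ M' := (norm_nonneg _).trans (hM' 0)
  simp only [Real.norm_eq_abs] at hM hM'
  have hWabs : ∀ x, |W x| ≤ C := fun x => by rw [abs_of_nonneg (hW0 x)]; exact hWC x
  have hpd : ∀ α x, |partialDeriv α W x| ≤ 2 * ϱ * C := fun α x => by
    have h1 : |partialDeriv α W x| ≤ ‖gradVec W x‖ := PiLp.norm_apply_le (gradVec W x) α
    refine h1.trans ((hDW x).trans ?_)
    gcongr; exact hWC x
  set C' := max C (2 * ϱ * C) with hC'
  have hJ : ∀ i, SlabL2 (fun X => flux A Dw i X - H i X) := fun i =>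
    (SlabL2.flux hA hLam hw.memL2_grad i).sub (hw.source_flux i)
  have key := fun i => energy_identity_weight (hw.memL2 i) (hw.source i)
    (fun α => (hw.memL2_grad i).apply α) (fun α => (hJ i).apply α) (hw.weakGrad i)
    (fun φ hφ => by
      have h := hw.eqn i φ hφ
      have h2 : ∀ α, ∫ X, (flux A Dw i X - H i X) α * spaceDeriv α φ X
          = (∫ X, flux A Dw i X α * spaceDeriv α φ X) - ∫ X, H i X α * spaceDeriv α φ X := by
        intro α
        rw [← integral_sub]
        · exact integral_congr_ae (Eventually.of_forall fun X => by simp [sub_mul])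
        · exact (((SlabL2.flux hA hLam hw.memL2_grad i).apply α).locL2).integrable_mul
            (hφ.spaceDeriv α).continuous (hφ.spaceDeriv α).compact
        · exact (((hw.source_flux i).apply α).locL2).integrable_mul
            (hφ.spaceDeriv α).continuous (hφ.spaceDeriv α).compact
      simp only [h2, Finset.sum_sub_distrib]
      linarith) hτ hτc hW (C := C')
    (fun x => (hWabs x).trans (le_max_left _ _)) (fun α x => (hpd α x).trans (le_max_right _ _))
  have cτ : Continuous fun X : SpaceTime n => τ X.1 := hτ.continuous.comp continuous_fst
  have cτ' : Continuous fun X : SpaceTime n => deriv τ X.1 := hτ'c.comp continuous_fst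
  have cW : Continuous fun X : SpaceTime n => W X.2 := hW.continuous.comp continuous_snd
  have int1 : ∀ {p q : SpaceTime n → ℝ}, SlabL2 p → SlabL2 q →
      Integrable (fun X => p X * q X * (τ X.1 * W X.2)) := fun hp hq =>
    hp.integrable_mul_mul hq (T := S) (C := M * C) (cτ.mul cW).aestronglyMeasurable
      (fun X => by rw [abs_mul]; exact mul_le_mul (hM _) (hWabs _) (abs_nonneg _) hM0)
      (fun X hX => by simp [hτ0' _ hX])
  have int2 : ∀ {p q : SpaceTime n → ℝ}, SlabL2 p → SlabL2 q →
      Integrable (fun X => p X * q X * (deriv τ X.1 * W X.2)) := fun hp hq =>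
    hp.integrable_mul_mul hq (T := S) (C := M' * C) (cτ'.mul cW).aestronglyMeasurable
      (fun X => by rw [abs_mul]; exact mul_le_mul (hM' _) (hWabs _) (abs_nonneg _) hM'0)
      (fun X hX => by simp [hτ'0 _ hX])
  have int3 : ∀ (α : Fin n) {p q : SpaceTime n → ℝ}, SlabL2 p → SlabL2 q →
      Integrable (fun X => p X * q X * (τ X.1 * partialDeriv α W X.2)) := fun α {p q} hp hq =>
    hp.integrable_mul_mul hq (T := S) (C := M * (2 * ϱ * C))
      (cτ.mul ((continuous_partialDeriv hW α).comp continuous_snd)).aestronglyMeasurable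
      (fun X => by rw [abs_mul]; exact mul_le_mul (hM _) (hpd _ _) (abs_nonneg _) hM0)
      (fun X hX => by simp [hτ0' _ hX])
  -- The integrand of the energy identity of one component: its integral is zero, and the estimate
  -- follows from a pointwise lower bound for the sum over the components.
  let Ψ : Fin N → SpaceTime n → ℝ := fun i X =>
    -(1 / 2) * (w i X * w i X * (deriv τ X.1 * W X.2))
      + (∑ α, (flux A Dw i X - H i X) α * Dw i X α * (τ X.1 * W X.2))
      + (∑ α, (flux A Dw i X - H i X) α * w i X * (τ X.1 * partialDeriv α W X.2))
      - F i X * w i X * (τ X.1 * W X.2)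
  have a1 : ∀ i, Integrable fun X => -(1 / 2) * (w i X * w i X * (deriv τ X.1 * W X.2)) :=
    fun i => (int2 (hw.memL2 i) (hw.memL2 i)).const_mul _
  have a2 : ∀ i, Integrable fun X => ∑ α, (flux A Dw i X - H i X) α * Dw i X α
      * (τ X.1 * W X.2) := fun i => integrable_finsetSum _ fun α _ =>
    int1 ((hJ i).apply α) ((hw.memL2_grad i).apply α)
  have a3 : ∀ i, Integrable fun X => ∑ α, (flux A Dw i X - H i X) α * w i X
      * (τ X.1 * partialDeriv α W X.2) := fun i => integrable_finsetSum _ fun α _ =>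
    int3 α ((hJ i).apply α) (hw.memL2 i)
  have a4 : ∀ i, Integrable fun X => F i X * w i X * (τ X.1 * W X.2) :=
    fun i => int1 (hw.source i) (hw.memL2 i)
  have hΨi : ∀ i, Integrable (Ψ i) := fun i => (((a1 i).add (a2 i)).add (a3 i)).sub (a4 i)
  have hΨ : ∀ i, ∫ X, Ψ i X = 0 := by
    intro i
    have h1 : ∫ X, Ψ i X = _ := integral_sub (((a1 i).add (a2 i)).add (a3 i)) (a4 i)
    have h2 := integral_add ((a1 i).add (a2 i)) (a3 i)
    have h3 := integral_add (a1 i) (a2 i)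
    simp only [Pi.add_apply] at h1 h2 h3
    rw [h1, h2, h3, integral_const_mul, integral_finsetSum, integral_finsetSum]
    · linarith [key i]
    · exact fun α _ => int3 α ((hJ i).apply α) (hw.memL2 i)
    · exact fun α _ => int1 ((hJ i).apply α) ((hw.memL2_grad i).apply α)
  have hnorm : ∀ {V : SpaceTime n → Space n}, SlabL2 V → SlabL2 fun X => ‖V X‖ :=
    fun hV T => (hV T).norm
  have isq : ∀ {p : SpaceTime n → ℝ}, SlabL2 p → Integrable fun X => p X ^ 2 * (τ X.1 * W X.2) :=
    fun hp => by simpa only [sq] using int1 hp hp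
  have hL : Integrable fun X => (lam / 2 * ∑ i, ‖Dw i X‖ ^ 2 + 1 / (2 * T) * ∑ i, w i X ^ 2)
      * (τ X.1 * W X.2) := by
    simp only [add_mul, mul_assoc, Finset.sum_mul]
    exact ((integrable_finsetSum _ fun i _ => isq (hnorm (hw.memL2_grad i))).const_mul _).add
      ((integrable_finsetSum _ fun i _ => isq (hw.memL2 i)).const_mul _)
  have hR : Integrable fun X => (T / 2 * ∑ i, F i X ^ 2 + 2 / lam * ∑ i, ‖H i X‖ ^ 2)
      * (τ X.1 * W X.2) := by
    simp only [add_mul, mul_assoc, Finset.sum_mul]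
    exact ((integrable_finsetSum _ fun i _ => isq (hw.source i)).const_mul _).add
      ((integrable_finsetSum _ fun i _ => isq (hnorm (hw.source_flux i))).const_mul _)
  have hsum : ∫ X, ∑ i, Ψ i X = 0 := by
    rw [integral_finsetSum _ fun i _ => hΨi i]; simp [hΨ]
  have hpt : ∀ X, (lam / 2 * ∑ i, ‖Dw i X‖ ^ 2 + 1 / (2 * T) * ∑ i, w i X ^ 2)
      * (τ X.1 * W X.2) - (T / 2 * ∑ i, F i X ^ 2 + 2 / lam * ∑ i, ‖H i X‖ ^ 2)
      * (τ X.1 * W X.2) ≤ ∑ i, Ψ i X := by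
    intro X
    set ν := energyRate lam Lam with hν
    have hi : ∀ i, (energyRate lam Lam * ϱ ^ 2 + 1 / T) * w i X ^ 2 * (τ X.1 * W X.2)
        + ((∑ α, flux A Dw i X α * Dw i X α) - (lam / 4 * ‖Dw i X‖ ^ 2
          + lam / (4 * Lam ^ 2) * ‖flux A Dw i X‖ ^ 2
          + (ν * ϱ ^ 2 + 1 / (2 * T)) * w i X ^ 2 + T / 2 * F i X ^ 2
          + 2 / lam * ‖H i X‖ ^ 2)) * (τ X.1 * W X.2) ≤ Ψ i X := by
      intro i
      have hy := mul_le_mul_of_nonneg_left (weighted_young hlam hLam hT (Dw i X) (flux A Dw i X)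
        (H i X) (gradVec W X.2) (w i X) (F i X) (W X.2) (hW0 _) (hDW _)) (hτ0 X.1)
      -- The decay of `τ` is assumed only for `t ≥ a`; before `a` both sides vanish with `w`.
      have ht : (energyRate lam Lam * ϱ ^ 2 + 1 / T) * w i X ^ 2 * (τ X.1 * W X.2)
          ≤ -(1 / 2) * (w i X * w i X * (deriv τ X.1 * W X.2)) := by
        rcases lt_or_ge X.1 a with hX | hX
        · simp [hwa i X hX]
        · have := mul_le_mul_of_nonneg_left (hτ' X.1 hX)
            (mul_nonneg (sq_nonneg (w i X)) (hW0 X.2))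
          linarith
      have e1 : ∑ α, (flux A Dw i X - H i X) α * Dw i X α * (τ X.1 * W X.2)
          = τ X.1 * ((∑ α, (flux A Dw i X α - H i X α) * Dw i X α) * W X.2) := by
        simp only [Finset.mul_sum, Finset.sum_mul]
        exact Finset.sum_congr rfl fun α _ => by simp; ring
      have e2 : ∑ α, (flux A Dw i X - H i X) α * w i X * (τ X.1 * partialDeriv α W X.2)
          = τ X.1 * ∑ α, (flux A Dw i X α - H i X α) * (w i X * gradVec W X.2 α) := by
        simp only [Finset.mul_sum]
        exact Finset.sum_congr rfl fun α _ => by simp [gradVec]; ring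
      simp only [Ψ, e1, e2]
      linarith
    refine le_trans ?_ (Finset.sum_le_sum fun i _ => hi i)
    have hfl := flux_sq_le hA Dw X
    have hin := inner_flux_ge hA Dw X
    rw [Finset.sum_add_distrib, ← Finset.sum_mul, ← Finset.sum_mul, Finset.sum_sub_distrib]
    simp only [Finset.sum_add_distrib, ← Finset.mul_sum]
    rw [← sub_mul, ← add_mul]
    refine mul_le_mul_of_nonneg_right ?_ (mul_nonneg (hτ0 _) (hW0 _))
    have h3 : lam / (4 * Lam ^ 2) * ∑ i, ‖flux A Dw i X‖ ^ 2 ≤ lam / 4 * ∑ i, ‖Dw i X‖ ^ 2 := by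
      calc lam / (4 * Lam ^ 2) * ∑ i, ‖flux A Dw i X‖ ^ 2
          ≤ lam / (4 * Lam ^ 2) * (Lam ^ 2 * ∑ i, ‖Dw i X‖ ^ 2) := by gcongr
        _ = _ := by field_simp
    -- One half of the `1 / T` term absorbs the source `F`; the other half stays on the left and
    -- controls `w` itself.
    have h4 : 1 / T * (∑ i, w i X ^ 2) = 1 / (2 * T) * (∑ i, w i X ^ 2)
        + 1 / (2 * T) * ∑ i, w i X ^ 2 := by field_simp; ring
    have h5 : (ν * ϱ ^ 2 + 1 / T) * ∑ i, w i X ^ 2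
        = ν * ϱ ^ 2 * (∑ i, w i X ^ 2) + 1 / T * ∑ i, w i X ^ 2 := by ring
    have h6 : (ν * ϱ ^ 2 + 1 / (2 * T)) * ∑ i, w i X ^ 2
        = ν * ϱ ^ 2 * (∑ i, w i X ^ 2) + 1 / (2 * T) * ∑ i, w i X ^ 2 := by ring
    rw [h5, h6]
    linarith
  have hfin := integral_mono (hL.sub hR) (integrable_finsetSum _ fun i _ => hΨi i) hpt
  rw [hsum] at hfin
  have := integral_sub hL hR
  simp only [Pi.sub_apply] at hfin
  linarith

end System

end

/-! ### Parabolic cylinders and the scaling of averaging kernels. -/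

section
section LocalBound

variable {n : ℕ}

theorem space_eq_sum (v : Space n) :
    v = ∑ α, v α • (EuclideanSpace.single α (1 : ℝ) : Space n) := by
  ext β; simp [Finset.sum_apply, Pi.single_apply]

theorem sum_mul_partialDeriv (W : Space n → ℝ) (x v : Space n) :
    ∑ α, v α * partialDeriv α W x = fderiv ℝ W x v := by
  conv_rhs => rw [space_eq_sum v, map_sum]
  simp [partialDeriv]

/-- The parabolic cylinder `X₀ + {(t, x) : t / ρ² ∈ J, |x| < ρ}`. -/
def scaledCyl (J : Set ℝ) (X₀ : SpaceTime n) (ρ : ℝ) : Set (SpaceTime n) :=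
  {X | (X.1 - X₀.1) / ρ ^ 2 ∈ J ∧ ‖X.2 - X₀.2‖ < ρ}

theorem measurableSet_scaledCyl {J : Set ℝ} (hJ : IsOpen J) (X₀ : SpaceTime n) (ρ : ℝ) :
    MeasurableSet (scaledCyl J X₀ ρ) := by
  refine MeasurableSet.inter ?_ ?_
  · exact (hJ.preimage (f := fun X : SpaceTime n => (X.1 - X₀.1) / ρ ^ 2)
      (by fun_prop)).measurableSet
  · exact (isOpen_lt (f := fun X : SpaceTime n => ‖X.2 - X₀.2‖) (by fun_prop)
      continuous_const).measurableSet

/-- A general time window `J` treats backward and forward cylinders at once. That `J` is star-shaped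
about `0` is what makes the cylinders nested. -/
theorem scaledCyl_mono {J : Set ℝ} (hstar : ∀ s ∈ J, ∀ c : ℝ, 0 < c → c ≤ 1 → c * s ∈ J)
    (X₀ : SpaceTime n) {ρ R : ℝ} (hρ : 0 < ρ) (hR : ρ ≤ R) :
    scaledCyl J X₀ ρ ⊆ scaledCyl J X₀ R := by
  rintro X ⟨h1, h2⟩
  have hR0 : 0 < R := hρ.trans_le hR
  refine ⟨?_, h2.trans_le hR⟩
  have := hstar _ h1 (ρ ^ 2 / R ^ 2) (by positivity)
    ((div_le_one (by positivity)).2 (by gcongr))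
  convert this using 1
  field_simp

theorem scaledCyl_subset_prod {J : Set ℝ} (hJ : J ⊆ Ioo (-1) 1) (X₀ : SpaceTime n) {ρ : ℝ}
    (hρ : 0 < ρ) : scaledCyl J X₀ ρ
      ⊆ Ioo (X₀.1 - ρ ^ 2) (X₀.1 + ρ ^ 2) ×ˢ Metric.ball X₀.2 ρ := by
  rintro X ⟨h1, h2⟩
  have h3 := hJ h1
  rw [mem_Ioo, lt_div_iff₀ (by positivity), div_lt_iff₀ (by positivity)] at h3
  refine ⟨⟨by linarith [h3.1], by linarith [h3.2]⟩, ?_⟩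
  rwa [mem_ball_iff_norm]

/-- The volume of the parabolic cylinder of radius one. -/
noncomputable def cylVolume (n : ℕ) : ℝ := 2 * (volume (Metric.ball (0 : Space n) 1)).toReal

theorem cylVolume_nonneg (n : ℕ) : 0 ≤ cylVolume n := by unfold cylVolume; positivity

theorem volume_scaledCyl_le {J : Set ℝ} (hJ : J ⊆ Ioo (-1) 1) (X₀ : SpaceTime n) {ρ : ℝ}
    (hρ : 0 < ρ) : volume (scaledCyl J X₀ ρ) ≤ ENNReal.ofReal (cylVolume n * ρ ^ (n + 2)) := by
  refine (measure_mono (scaledCyl_subset_prod hJ X₀ hρ)).trans_eq ?_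
  have hfin : volume (Metric.ball (0 : Space n) 1) ≠ ⊤ := measure_ball_lt_top.ne
  rw [Measure.volume_eq_prod, Measure.prod_prod, Real.volume_Ioo,
    Measure.addHaar_ball_of_pos _ _ hρ, finrank_euclideanSpace_fin, cylVolume]
  rw [← ENNReal.ofReal_toReal hfin, ← ENNReal.ofReal_mul (by positivity),
    ← ENNReal.ofReal_mul (by nlinarith [sq_nonneg ρ])]
  simp only [ENNReal.toReal_ofReal ENNReal.toReal_nonneg]
  congr 1; ring

/-- The Cauchy-Schwarz inequality on a parabolic cylinder. -/
theorem setIntegral_scaledCyl_le {J : Set ℝ} (hJ : J ⊆ Ioo (-1) 1) (X₀ : SpaceTime n)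
    {ρ : ℝ} (hρ : 0 < ρ) {f : SpaceTime n → ℝ}
    (hf : MemLp f 2 (volume.restrict (scaledCyl J X₀ ρ))) (hf0 : ∀ X, 0 ≤ f X) :
    (∫ X in scaledCyl J X₀ ρ, f X) ^ 2
      ≤ cylVolume n * ρ ^ (n + 2) * ∫ X in scaledCyl J X₀ ρ, f X ^ 2 := by
  have hv := volume_scaledCyl_le hJ X₀ hρ
  have hfin : IsFiniteMeasure (volume.restrict (scaledCyl J X₀ ρ)) :=
    ⟨by simpa using hv.trans_lt ENNReal.ofReal_lt_top⟩
  have h := integral_mul_le_Lp_mul_Lq_of_nonneg (μ := volume.restrict (scaledCyl J X₀ ρ))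
    Real.HolderConjugate.two_two (f := f) (g := fun _ => (1 : ℝ))
    (Eventually.of_forall hf0) (Eventually.of_forall fun _ => zero_le_one) (by simpa using hf)
    (by simpa using memLp_const (1 : ℝ))
  simp only [mul_one, integral_const, smul_eq_mul, Real.rpow_two, one_pow] at h
  have hv' : (volume.restrict (scaledCyl J X₀ ρ)).real univ ≤ cylVolume n * ρ ^ (n + 2) := by
    rw [Measure.real, Measure.restrict_apply_univ]
    exact ENNReal.toReal_le_of_le_ofReal
      (mul_nonneg (cylVolume_nonneg n) (by positivity)) hv
  have hI : 0 ≤ ∫ X in scaledCyl J X₀ ρ, f X ^ 2 := integral_nonneg fun X => sq_nonneg _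
  have hsq : ∀ a : ℝ, 0 ≤ a → (a ^ (1 / 2 : ℝ)) ^ 2 = a := fun a ha => by
    rw [← Real.sqrt_eq_rpow, Real.sq_sqrt ha]
  calc (∫ X in scaledCyl J X₀ ρ, f X) ^ 2
      ≤ ((∫ X in scaledCyl J X₀ ρ, f X ^ 2) ^ (1 / 2 : ℝ)
        * (volume.restrict (scaledCyl J X₀ ρ)).real univ ^ (1 / 2 : ℝ)) ^ 2 :=
        pow_le_pow_left₀ (integral_nonneg hf0) h 2
    _ = (volume.restrict (scaledCyl J X₀ ρ)).real univ * ∫ X in scaledCyl J X₀ ρ, f X ^ 2 := by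
        rw [mul_pow, hsq _ hI, hsq _ measureReal_nonneg, mul_comm]
    _ ≤ _ := by gcongr

/-- A smooth probability density `h(t) p(x)` supported in `J × B₁`. -/
structure KernelData (J : Set ℝ) (h : ℝ → ℝ) (p : Space n → ℝ) : Prop where
  smooth_time : ContDiff ℝ ∞ h
  smooth_space : ContDiff ℝ ∞ p
  compact_time : HasCompactSupport h
  compact_space : HasCompactSupport p
  support_time : tsupport h ⊆ J
  support_space : tsupport p ⊆ Metric.ball 0 1
  nonneg_time : ∀ t, 0 ≤ h t
  nonneg_space : ∀ x, 0 ≤ p x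
  integral_time : ∫ t, h t = 1
  integral_space : ∫ x, p x = 1

theorem exists_kernelData (n : ℕ) {J : Set ℝ} {c : ℝ} (hc : Metric.closedBall c (1 / 4) ⊆ J) :
    ∃ (h : ℝ → ℝ) (p : Space n → ℝ), KernelData J h p := by
  let b : ContDiffBump c := ⟨1 / 8, 1 / 4, by norm_num, by norm_num⟩
  let d : ContDiffBump (0 : Space n) := ⟨1 / 4, 1 / 2, by norm_num, by norm_num⟩
  exact ⟨b.normed volume, d.normed volume, b.contDiff_normed, d.contDiff_normed,
    b.hasCompactSupport_normed, d.hasCompactSupport_normed,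
    by rw [b.tsupport_normed_eq]; exact hc,
    by rw [d.tsupport_normed_eq]; exact Metric.closedBall_subset_ball (by norm_num [d]),
    b.nonneg_normed, d.nonneg_normed, b.integral_normed, d.integral_normed⟩

/-- The rescaled kernel `ρ^{-n-2} h((t - t₀) / ρ²) p((x - x₀) / ρ)`. -/
noncomputable def scaledKernel (h : ℝ → ℝ) (p : Space n → ℝ) (X₀ : SpaceTime n) (ρ : ℝ)
    (X : SpaceTime n) : ℝ :=
  (ρ ^ (n + 2))⁻¹ * h ((X.1 - X₀.1) / ρ ^ 2) * p (ρ⁻¹ • (X.2 - X₀.2))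

/-- The derivative of the rescaled kernel in `ρ`. -/
noncomputable def scaledKernelDeriv (h : ℝ → ℝ) (p : Space n → ℝ) (X₀ : SpaceTime n) (ρ : ℝ)
    (X : SpaceTime n) : ℝ :=
  -(ρ⁻¹ * (ρ ^ (n + 2))⁻¹) * ((n + 2) * h ((X.1 - X₀.1) / ρ ^ 2) * p (ρ⁻¹ • (X.2 - X₀.2))
    + 2 * ((X.1 - X₀.1) / ρ ^ 2 * deriv h ((X.1 - X₀.1) / ρ ^ 2)) * p (ρ⁻¹ • (X.2 - X₀.2))
    + h ((X.1 - X₀.1) / ρ ^ 2)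
      * fderiv ℝ p (ρ⁻¹ • (X.2 - X₀.2)) (ρ⁻¹ • (X.2 - X₀.2)))

namespace KernelData

variable {J : Set ℝ} {h : ℝ → ℝ} {p : Space n → ℝ} (hK : KernelData J h p)
include hK

theorem hasDerivAt (X₀ X : SpaceTime n) {ρ : ℝ} (hρ : 0 < ρ) :
    HasDerivAt (fun ρ => scaledKernel h p X₀ ρ X) (scaledKernelDeriv h p X₀ ρ X) ρ := by
  have hρ0 : ρ ≠ 0 := hρ.ne'
  have h1 : HasDerivAt (fun ρ : ℝ => (ρ ^ (n + 2))⁻¹)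
      (-((n + 2 : ℕ) * ρ ^ (n + 1)) / (ρ ^ (n + 2)) ^ 2) ρ :=
    (hasDerivAt_pow (n + 2) ρ).fun_inv (by positivity)
  have h2 : HasDerivAt (fun ρ : ℝ => h ((X.1 - X₀.1) / ρ ^ 2))
      (deriv h ((X.1 - X₀.1) / ρ ^ 2) * ((X.1 - X₀.1) * (-(2 * ρ) / (ρ ^ 2) ^ 2))) ρ := by
    have hi : HasDerivAt (fun ρ : ℝ => (X.1 - X₀.1) / ρ ^ 2)
        ((X.1 - X₀.1) * (-(2 * ρ) / (ρ ^ 2) ^ 2)) ρ := by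
      simp only [div_eq_mul_inv]
      have := ((hasDerivAt_pow 2 ρ).fun_inv (by positivity : ρ ^ 2 ≠ 0)).const_mul (X.1 - X₀.1)
      simpa [div_eq_mul_inv] using this
    exact ((hK.smooth_time.differentiable (by simp) _).hasDerivAt).comp ρ hi
  have h3 : HasDerivAt (fun ρ : ℝ => p (ρ⁻¹ • (X.2 - X₀.2)))
      (fderiv ℝ p (ρ⁻¹ • (X.2 - X₀.2)) ((-(ρ ^ 2)⁻¹) • (X.2 - X₀.2))) ρ := by
    have hi : HasDerivAt (fun ρ : ℝ => ρ⁻¹ • (X.2 - X₀.2)) ((-(ρ ^ 2)⁻¹) • (X.2 - X₀.2)) ρ :=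
      (hasDerivAt_inv hρ0).smul_const _
    exact ((hK.smooth_space.differentiable (by simp) _).hasFDerivAt).comp_hasDerivAt ρ hi
  have h4 := (h1.mul h2).mul h3
  refine h4.congr_deriv ?_
  simp only [scaledKernelDeriv, map_smul, smul_eq_mul, Pi.mul_apply]
  push_cast
  field_simp
  ring

theorem isTestFunction (X₀ : SpaceTime n) {ρ : ℝ} (hρ : 0 < ρ) :
    IsTestFunction (scaledCyl J X₀ ρ) (scaledKernel h p X₀ ρ) := by
  have hsub : Function.support (scaledKernel h p X₀ ρ)
      ⊆ {X | (X.1 - X₀.1) / ρ ^ 2 ∈ tsupport h ∧ ρ⁻¹ • (X.2 - X₀.2) ∈ tsupport p} := by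
    intro X hX
    refine ⟨?_, ?_⟩ <;> by_contra hc <;> apply hX <;>
      simp [scaledKernel, image_eq_zero_of_notMem_tsupport hc]
  have hcl : IsClosed {X : SpaceTime n | (X.1 - X₀.1) / ρ ^ 2 ∈ tsupport h
      ∧ ρ⁻¹ • (X.2 - X₀.2) ∈ tsupport p} := by
    refine IsClosed.inter ?_ ?_
    · exact (isClosed_tsupport h).preimage
        (f := fun X : SpaceTime n => (X.1 - X₀.1) / ρ ^ 2) (by fun_prop)
    · exact (isClosed_tsupport p).preimage
        (f := fun X : SpaceTime n => ρ⁻¹ • (X.2 - X₀.2)) (by fun_prop)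
  have hts := closure_minimal hsub hcl
  refine ⟨?_, ?_, hts.trans ?_⟩
  · refine (contDiff_const.mul (hK.smooth_time.comp (by fun_prop))).mul
      (hK.smooth_space.comp (by fun_prop))
  · have h1 : IsCompact ((fun t : ℝ => t * ρ ^ 2 + X₀.1) '' tsupport h) :=
      hK.compact_time.isCompact.image (by fun_prop)
    have h2 : IsCompact ((fun x : Space n => ρ • x + X₀.2) '' tsupport p) :=
      hK.compact_space.isCompact.image (by fun_prop)
    refine HasCompactSupport.intro (h1.prod h2) fun X hX => ?_
    by_contra hne
    have := hsub hne
    refine hX ⟨⟨_, this.1, ?_⟩, ⟨_, this.2, ?_⟩⟩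
    · field_simp; ring
    · simp [smul_smul, hρ.ne']
  · rintro X ⟨h1, h2⟩
    refine ⟨hK.support_time h1, ?_⟩
    have := hK.support_space h2
    rw [mem_ball_zero_iff, norm_smul, Real.norm_of_nonneg (by positivity),
      inv_mul_lt_iff₀ hρ, mul_one] at this
    exact this

theorem timeDeriv_eq (X₀ X : SpaceTime n) (ρ : ℝ) :
    timeDeriv (scaledKernel h p X₀ ρ) X = (ρ ^ (n + 2))⁻¹
      * (deriv h ((X.1 - X₀.1) / ρ ^ 2) / ρ ^ 2) * p (ρ⁻¹ • (X.2 - X₀.2)) := by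
  have hd : ∀ t, HasDerivAt (fun t : ℝ => (ρ ^ (n + 2))⁻¹ * h ((t - X₀.1) / ρ ^ 2))
      ((ρ ^ (n + 2))⁻¹ * (deriv h ((t - X₀.1) / ρ ^ 2) / ρ ^ 2)) t := by
    intro t
    have h1 := ((hK.smooth_time.differentiable (by simp) ((t - X₀.1) / ρ ^ 2)).hasDerivAt).comp t
      (((hasDerivAt_id t).sub_const X₀.1).div_const (ρ ^ 2))
    simpa [div_eq_mul_inv] using h1.const_mul (ρ ^ (n + 2))⁻¹
  have := timeDeriv_prod (τ := fun t : ℝ => (ρ ^ (n + 2))⁻¹ * h ((t - X₀.1) / ρ ^ 2))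
    (W := fun x : Space n => p (ρ⁻¹ • (x - X₀.2))) (fun t => (hd t).differentiableAt)
    ((hK.smooth_space.comp (by fun_prop)).differentiable (by simp : (∞ : WithTop ℕ∞) ≠ 0)) X
  rw [(hd X.1).deriv] at this
  exact this

theorem spaceDeriv_eq (X₀ X : SpaceTime n) (ρ : ℝ) (α : Fin n) :
    spaceDeriv α (scaledKernel h p X₀ ρ) X = (ρ ^ (n + 2))⁻¹
      * h ((X.1 - X₀.1) / ρ ^ 2) * (ρ⁻¹ * partialDeriv α p (ρ⁻¹ • (X.2 - X₀.2))) := by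
  have hd : ∀ x, HasFDerivAt (fun x : Space n => p (ρ⁻¹ • (x - X₀.2)))
      ((fderiv ℝ p (ρ⁻¹ • (x - X₀.2))).comp (ρ⁻¹ • ContinuousLinearMap.id ℝ (Space n))) x := by
    intro x
    exact ((hK.smooth_space.differentiable (by simp)) _).hasFDerivAt.comp x
      (((hasFDerivAt_id (𝕜 := ℝ) x).sub_const X₀.2).const_smul (ρ⁻¹) :)
  have := spaceDeriv_prod (τ := fun t : ℝ => (ρ ^ (n + 2))⁻¹ * h ((t - X₀.1) / ρ ^ 2))
    (W := fun x : Space n => p (ρ⁻¹ • (x - X₀.2)))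
    ((contDiff_const.mul (hK.smooth_time.comp (by fun_prop))).differentiable
      (by simp : (∞ : WithTop ℕ∞) ≠ 0)) (fun x => (hd x).differentiableAt) α X
  refine this.trans ?_
  congr 1
  rw [partialDeriv, (hd X.2).fderiv]
  simp [partialDeriv]

/-- The kernels are transported by the parabolic dilations about `X₀`, and each has mass one. Hence
the derivative in the scale is a space-time divergence of the kernel times the dilation field `(2(t
- t₀), x - x₀) / ρ`, which can be integrated by parts against a solution. -/
theorem scaledKernelDeriv_eq (X₀ X : SpaceTime n) {ρ : ℝ} (hρ : 0 < ρ) :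
    scaledKernelDeriv h p X₀ ρ X = -ρ⁻¹ *
      ((∑ α, spaceDeriv α (fun Y => (Y.2 - X₀.2) α * scaledKernel h p X₀ ρ Y) X)
        + 2 * timeDeriv (fun Y => (Y.1 - X₀.1) * scaledKernel h p X₀ ρ Y) X) := by
  have hkd := (hK.isTestFunction X₀ hρ).differentiable X
  have h1 : ∀ α, spaceDeriv α (fun Y => (Y.2 - X₀.2) α * scaledKernel h p X₀ ρ Y) X
      = (X.2 - X₀.2) α * spaceDeriv α (scaledKernel h p X₀ ρ) X + scaledKernel h p X₀ ρ X := by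
    intro α
    have hl : HasFDerivAt (fun Y : SpaceTime n => (Y.2 - X₀.2) α)
        ((EuclideanSpace.proj α : Space n →L[ℝ] ℝ).comp
          (ContinuousLinearMap.snd ℝ ℝ (Space n))) X :=
      (EuclideanSpace.proj α : Space n →L[ℝ] ℝ).hasFDerivAt.comp X
        ((hasFDerivAt_snd).sub_const X₀.2)
    rw [spaceDeriv_mul α hl.differentiableAt hkd]
    congr 1
    rw [spaceDeriv, hl.fderiv]
    simp
  have h2 : timeDeriv (fun Y => (Y.1 - X₀.1) * scaledKernel h p X₀ ρ Y) X
      = (X.1 - X₀.1) * timeDeriv (scaledKernel h p X₀ ρ) X + scaledKernel h p X₀ ρ X := by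
    have hl : HasFDerivAt (fun Y : SpaceTime n => Y.1 - X₀.1)
        (ContinuousLinearMap.fst ℝ ℝ (Space n)) X := hasFDerivAt_fst.sub_const X₀.1
    rw [timeDeriv_mul hl.differentiableAt hkd]
    congr 1
    rw [timeDeriv, hl.fderiv]
    simp
  have h3 : ∑ α, (X.2 - X₀.2) α * spaceDeriv α (scaledKernel h p X₀ ρ) X
      = (ρ ^ (n + 2))⁻¹ * h ((X.1 - X₀.1) / ρ ^ 2)
        * fderiv ℝ p (ρ⁻¹ • (X.2 - X₀.2)) (ρ⁻¹ • (X.2 - X₀.2)) := by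
    rw [← sum_mul_partialDeriv, Finset.mul_sum]
    refine Finset.sum_congr rfl fun α _ => ?_
    rw [hK.spaceDeriv_eq]
    simp; ring
  simp only [h1, h2, Finset.sum_add_distrib, h3, hK.timeDeriv_eq, scaledKernelDeriv]
  simp only [Finset.sum_const, Finset.card_univ, Fintype.card_fin, nsmul_eq_mul, scaledKernel]
  ring

theorem nonneg (X₀ X : SpaceTime n) {ρ : ℝ} (hρ : 0 < ρ) : 0 ≤ scaledKernel h p X₀ ρ X :=
  mul_nonneg (mul_nonneg (by positivity) (hK.nonneg_time _)) (hK.nonneg_space _)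

theorem integral_eq_one (X₀ : SpaceTime n) {ρ : ℝ} (hρ : 0 < ρ) :
    ∫ X, scaledKernel h p X₀ ρ X = 1 := by
  have h1 : ∫ t : ℝ, h ((t - X₀.1) / ρ ^ 2) = ρ ^ 2 := by
    rw [integral_sub_right_eq_self (fun t => h (t / ρ ^ 2)), Measure.integral_comp_div,
      hK.integral_time]
    simp
  have h2 : ∫ x : Space n, p (ρ⁻¹ • (x - X₀.2)) = ρ ^ n := by
    rw [integral_sub_right_eq_self (fun x : Space n => p (ρ⁻¹ • x)),
      Measure.integral_comp_inv_smul, hK.integral_space]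
    simp [abs_of_pos hρ]
  have h3 := integral_prod_mul (μ := (volume : Measure ℝ)) (ν := (volume : Measure (Space n)))
    (fun t => (ρ ^ (n + 2))⁻¹ * h ((t - X₀.1) / ρ ^ 2)) (fun x => p (ρ⁻¹ • (x - X₀.2)))
  rw [← Measure.volume_eq_prod] at h3
  refine h3.trans ?_
  rw [integral_const_mul, h1, h2]
  field_simp
  ring

theorem exists_bound : ∃ K, 0 ≤ K ∧ (∀ t, |h t| ≤ K) ∧ (∀ x, |p x| ≤ K)
    ∧ (∀ t, |t * deriv h t| ≤ K) ∧ (∀ x, |fderiv ℝ p x x| ≤ K)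
    ∧ ∀ α x, |partialDeriv α p x| ≤ K := by
  obtain ⟨K1, h1⟩ := hK.compact_time.exists_bound_of_continuous hK.smooth_time.continuous
  obtain ⟨K2, h2⟩ := hK.compact_space.exists_bound_of_continuous hK.smooth_space.continuous
  have hfc : Continuous (fderiv ℝ p) := hK.smooth_space.continuous_fderiv (by simp)
  obtain ⟨K3, h3⟩ := (hK.compact_time.deriv.mul_left (f := fun t => t)).exists_bound_of_continuous
    (continuous_id.mul (hK.smooth_time.continuous_deriv (by simp)))
  have hcs : HasCompactSupport fun x => fderiv ℝ p x x :=
    (hK.compact_space.fderiv (𝕜 := ℝ)).mono fun x hx => by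
      intro h0; apply hx; simp [h0]
  obtain ⟨K4, h4⟩ := hcs.exists_bound_of_continuous (hfc.clm_apply continuous_id)
  obtain ⟨K5, h5⟩ := (hK.compact_space.fderiv (𝕜 := ℝ)).exists_bound_of_continuous hfc
  simp only [Real.norm_eq_abs] at h1 h2 h3 h4
  have p1 := (abs_nonneg _).trans (h1 0)
  have p2 := (abs_nonneg _).trans (h2 0)
  have p3 := (abs_nonneg _).trans (h3 0)
  have p4 := (abs_nonneg _).trans (h4 0)
  have p5 := (norm_nonneg _).trans (h5 0)
  refine ⟨K1 + K2 + K3 + K4 + K5, by positivity, fun t => (h1 t).trans (by linarith),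
    fun x => (h2 x).trans (by linarith), fun t => (h3 t).trans (by linarith),
    fun x => (h4 x).trans (by linarith), fun α x => ?_⟩
  refine ((fderiv ℝ p x).le_opNorm _).trans ?_
  have : ‖fderiv ℝ p x‖ * ‖(EuclideanSpace.single α 1 : Space n)‖ ≤ K5 := by simpa using h5 x
  linarith

end KernelData

end LocalBound

end

/-! ### From decay of the gradient to pointwise bounds. -/

section
section LocalBound

variable {n : ℕ} {J : Set ℝ} {h : ℝ → ℝ} {p : Space n → ℝ}

/-- The average of `u` against the rescaled kernel. -/
noncomputable def kernelAverage (h : ℝ → ℝ) (p : Space n → ℝ) (J : Set ℝ) (X₀ : SpaceTime n)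
    (R : ℝ) (u : SpaceTime n → ℝ) (ρ : ℝ) : ℝ :=
  ∫ X in scaledCyl J X₀ R, u X * scaledKernel h p X₀ ρ X

theorem isFiniteMeasure_scaledCyl (hJ : J ⊆ Ioo (-1) 1) (X₀ : SpaceTime n) {R : ℝ}
    (hR : 0 < R) : IsFiniteMeasure (volume.restrict (scaledCyl J X₀ R)) :=
  ⟨by simpa using (volume_scaledCyl_le hJ X₀ hR).trans_lt ENNReal.ofReal_lt_top⟩

theorem hasDerivAt_kernelAverage (hK : KernelData J h p) (hJ : J ⊆ Ioo (-1) 1)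
    (X₀ : SpaceTime n) {R : ℝ} (hR : 0 < R) {u : SpaceTime n → ℝ}
    (hu : MemLp u 2 (volume.restrict (scaledCyl J X₀ R))) {ρ : ℝ} (hρ : 0 < ρ) :
    HasDerivAt (kernelAverage h p J X₀ R u)
      (∫ X in scaledCyl J X₀ R, u X * scaledKernelDeriv h p X₀ ρ X) ρ := by
  have := isFiniteMeasure_scaledCyl hJ X₀ hR
  have hui : Integrable u (volume.restrict (scaledCyl J X₀ R)) := hu.integrable one_le_two
  obtain ⟨K, hK0, k1, k2, k3, k4, k5⟩ := hK.exists_bound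
  have hcont : ∀ r, 0 < r → Continuous (scaledKernel h p X₀ r) := fun r hr =>
    (hK.isTestFunction X₀ hr).continuous
  have hcont' : Continuous (scaledKernelDeriv h p X₀ ρ) := by
    have hf : Continuous fun X : SpaceTime n =>
        fderiv ℝ p (ρ⁻¹ • (X.2 - X₀.2)) (ρ⁻¹ • (X.2 - X₀.2)) :=
      ((hK.smooth_space.continuous_fderiv (by simp)).comp (by fun_prop)).clm_apply (by fun_prop)
    have hd : Continuous fun X : SpaceTime n => deriv h ((X.1 - X₀.1) / ρ ^ 2) :=
      (hK.smooth_time.continuous_deriv (by simp)).comp (by fun_prop)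
    have hh : Continuous fun X : SpaceTime n => h ((X.1 - X₀.1) / ρ ^ 2) :=
      hK.smooth_time.continuous.comp (by fun_prop)
    have hp : Continuous fun X : SpaceTime n => p (ρ⁻¹ • (X.2 - X₀.2)) :=
      hK.smooth_space.continuous.comp (by fun_prop)
    have hs : Continuous fun X : SpaceTime n => (X.1 - X₀.1) / ρ ^ 2 := by fun_prop
    exact continuous_const.mul ((((continuous_const.mul hh).mul hp).add
      ((continuous_const.mul (hs.mul hd)).mul hp)).add (hh.mul hf))
  -- On scales above `ρ / 2` the three terms of the kernel derivative are bounded by `(n + 2) K²`,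
  -- `2 K²` and `K²`, whence the factor `n + 5`.
  refine (hasDerivAt_integral_of_dominated_loc_of_deriv_le (s := Ioi (ρ / 2))
    (bound := fun X => ‖u X‖ * ((ρ / 2)⁻¹ * ((ρ / 2) ^ (n + 2))⁻¹ * ((n + 5) * K ^ 2)))
    (F := fun r X => u X * scaledKernel h p X₀ r X)
    (F' := fun r X => u X * scaledKernelDeriv h p X₀ r X)
    (Ioi_mem_nhds (by linarith)) ?_ ?_ ?_ ?_ ?_ ?_).2
  · filter_upwards [Ioi_mem_nhds hρ] with r hr
    exact hui.aestronglyMeasurable.mul (hcont r hr).aestronglyMeasurable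
  · obtain ⟨C, hC⟩ := (hK.isTestFunction X₀ hρ).compact.exists_bound_of_continuous (hcont ρ hρ)
    exact hui.mul_bdd (hcont ρ hρ).aestronglyMeasurable (Eventually.of_forall hC)
  · exact hui.aestronglyMeasurable.mul hcont'.aestronglyMeasurable
  · refine Eventually.of_forall fun X r hr => ?_
    have hr' : ρ / 2 < r := hr
    have hr0 : 0 < r := by linarith
    rw [norm_mul]
    gcongr
    rw [scaledKernelDeriv, Real.norm_eq_abs, abs_mul, abs_neg,
      abs_of_pos (by positivity : 0 < r⁻¹ * (r ^ (n + 2))⁻¹)]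
    gcongr ?_ * ?_
    · gcongr
    · set s := (X.1 - X₀.1) / r ^ 2
      set z := r⁻¹ • (X.2 - X₀.2)
      calc |(n + 2) * h s * p z + 2 * (s * deriv h s) * p z + h s * fderiv ℝ p z z|
          ≤ |(n + 2) * h s * p z| + |2 * (s * deriv h s) * p z| + |h s * fderiv ℝ p z z| :=
            abs_add_three _ _ _
        _ = (n + 2) * |h s| * |p z| + 2 * |s * deriv h s| * |p z| + |h s| * |fderiv ℝ p z z| := by
            simp only [abs_mul, abs_two]
            rw [abs_of_nonneg (by positivity : (0:ℝ) ≤ n + 2)]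
        _ ≤ (n + 2) * K * K + 2 * K * K + K * K := by
            gcongr <;> first | exact k1 _ | exact k2 _ | exact k3 _ | exact k4 _
        _ = (n + 5) * K ^ 2 := by ring
  · exact hui.norm.mul_const _
  · refine Eventually.of_forall fun X r hr => ?_
    have hr' : ρ / 2 < r := hr
    exact (hK.hasDerivAt X₀ X (by linarith)).const_mul _

/-- By `scaledKernelDeriv_eq` the spatial part of the derivative is moved onto `u` as `Du`, and the
temporal part is converted by the equation into the flux `V`. No derivative of `u` in time is ever
needed, and no Poincaré inequality. The sign `σ` distinguishes the equation from its transpose. -/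
theorem abs_deriv_kernelAverage_le (hK : KernelData J h p) (hJo : IsOpen J) (hJ : J ⊆ Ioo (-1) 1)
    (hstar : ∀ s ∈ J, ∀ c : ℝ, 0 < c → c ≤ 1 → c * s ∈ J) {K : ℝ} (k1 : ∀ t, |h t| ≤ K)
    (k2 : ∀ x, |p x| ≤ K) (k5 : ∀ α x, |partialDeriv α p x| ≤ K)
    (X₀ : SpaceTime n) {R : ℝ} (hR : 0 < R) {u : SpaceTime n → ℝ} {Du V : SpaceTime n → Space n}
    (hu : MemLp u 2 (volume.restrict (scaledCyl J X₀ R)))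
    (hDu : MemLp Du 2 (volume.restrict (scaledCyl J X₀ R)))
    (hV : MemLp V 2 (volume.restrict (scaledCyl J X₀ R)))
    (hgrad : IsWeakGrad (scaledCyl J X₀ R) u Du) {σ : ℝ} (hσ : |σ| ≤ 1)
    (heq : ∀ φ, IsTestFunction (scaledCyl J X₀ R) φ →
      ∫ X in scaledCyl J X₀ R, u X * timeDeriv φ X
        = σ * ∑ α, ∫ X in scaledCyl J X₀ R, V X α * spaceDeriv α φ X) {ρ : ℝ} (hρ : 0 < ρ)
    (hρR : ρ ≤ R) :
    |∫ X in scaledCyl J X₀ R, u X * scaledKernelDeriv h p X₀ ρ X|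
      ≤ 3 * n * K ^ 2 * (ρ ^ (n + 2))⁻¹ * ∫ X in scaledCyl J X₀ ρ, (‖Du X‖ + ‖V X‖) := by
  have hK0 : 0 ≤ K := (abs_nonneg _).trans (k1 0)
  set Q := scaledCyl J X₀ R with hQ
  set q := scaledCyl J X₀ ρ with hq
  have hqQ : q ⊆ Q := scaledCyl_mono hstar X₀ hρ hρR
  have hqm : MeasurableSet q := measurableSet_scaledCyl hJo X₀ ρ
  have hk := hK.isTestFunction X₀ hρ
  let φ : Fin n → SpaceTime n → ℝ := fun α Y => (Y.2 - X₀.2) α * scaledKernel h p X₀ ρ Y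
  let φ₀ : SpaceTime n → ℝ := fun Y => (Y.1 - X₀.1) * scaledKernel h p X₀ ρ Y
  have hφ : ∀ α, IsTestFunction q (φ α) := fun α => hk.mul_left (by
    simp only [PiLp.sub_apply]; fun_prop)
  have hφ₀ : IsTestFunction q φ₀ := hk.mul_left (by fun_prop)
  have := isFiniteMeasure_scaledCyl hJ X₀ hR
  have hui : Integrable u (volume.restrict Q) := hu.integrable one_le_two
  have hib : ∀ {f : SpaceTime n → ℝ} {χ : SpaceTime n → ℝ},
      Integrable f (volume.restrict Q) → IsTestFunction q χ →
      Integrable (fun X => f X * χ X) (volume.restrict Q) := fun {f χ} hf hχ => by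
    obtain ⟨C, hC⟩ := hχ.compact.exists_bound_of_continuous hχ.continuous
    exact hf.mul_bdd hχ.continuous.aestronglyMeasurable (Eventually.of_forall hC)
  have e1 : ∫ X in Q, u X * scaledKernelDeriv h p X₀ ρ X
      = ρ⁻¹ * ((∑ α, ∫ X in Q, Du X α * φ α X)
        - 2 * (σ * ∑ α, ∫ X in Q, V X α * spaceDeriv α φ₀ X)) := by
    have h1 : ∀ X, u X * scaledKernelDeriv h p X₀ ρ X
        = -ρ⁻¹ * ((∑ α, u X * spaceDeriv α (φ α) X) + 2 * (u X * timeDeriv φ₀ X)) := fun X => by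
      rw [hK.scaledKernelDeriv_eq X₀ X hρ, ← Finset.mul_sum]; ring
    simp only [h1]
    rw [integral_const_mul, integral_add, integral_const_mul, integral_finsetSum,
      heq φ₀ (hφ₀.mono hqQ), Finset.sum_congr rfl fun α _ => hgrad (φ α) ((hφ α).mono hqQ) α]
    · simp only [Finset.sum_neg_distrib]; ring
    · exact fun α _ => hib hui ((hφ α).spaceDeriv α)
    · exact integrable_finsetSum _ fun α _ => hib hui ((hφ α).spaceDeriv α)
    · exact (hib hui hφ₀.timeDeriv).const_mul 2
  have hDi : Integrable (fun X => ‖Du X‖ + ‖V X‖) (volume.restrict q) := by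
    have h1 : Integrable Du (volume.restrict Q) := hDu.integrable one_le_two
    have h2 : Integrable V (volume.restrict Q) := hV.integrable one_le_two
    exact (h1.norm.add h2.norm).mono_measure (Measure.restrict_mono hqQ le_rfl)
  have hest : ∀ {f χ : SpaceTime n → ℝ}, IsTestFunction q χ →
      (∀ X, |f X| ≤ ‖Du X‖ + ‖V X‖) →
      (∀ X ∈ q, |χ X| ≤ ρ * (ρ ^ (n + 2))⁻¹ * K ^ 2) →
      |∫ X in Q, f X * χ X| ≤ ρ * (ρ ^ (n + 2))⁻¹ * K ^ 2 * ∫ X in q, (‖Du X‖ + ‖V X‖) := by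
    intro f χ hχ hf hb
    rw [(hχ.mono hqQ).setIntegral_mul f, ← hχ.setIntegral_mul f, ← integral_const_mul]
    refine (Real.norm_eq_abs _).symm.trans_le <| norm_integral_le_of_norm_le (hDi.const_mul _)
      ((ae_restrict_iff' hqm).2 (Eventually.of_forall fun X hX => ?_))
    rw [norm_mul, mul_comm, Real.norm_eq_abs, Real.norm_eq_abs]
    exact mul_le_mul (hb X hX) (hf X) (abs_nonneg _) (by positivity)
  have b1 : ∀ α, |∫ X in Q, Du X α * φ α X|
      ≤ ρ * (ρ ^ (n + 2))⁻¹ * K ^ 2 * ∫ X in q, (‖Du X‖ + ‖V X‖) := fun α => by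
    refine hest (hφ α) (fun X => ?_) fun X hX => ?_
    · have := PiLp.norm_apply_le (Du X) α
      rw [Real.norm_eq_abs] at this
      linarith [norm_nonneg (V X)]
    · simp only [φ, scaledKernel, abs_mul]
      rw [abs_of_pos (by positivity : 0 < (ρ ^ (n + 2))⁻¹)]
      have h1 : |(X.2 - X₀.2) α| ≤ ρ := (PiLp.norm_apply_le (X.2 - X₀.2) α).trans hX.2.le
      calc |(X.2 - X₀.2) α| * ((ρ ^ (n + 2))⁻¹ * |h ((X.1 - X₀.1) / ρ ^ 2)|
            * |p (ρ⁻¹ • (X.2 - X₀.2))|) ≤ ρ * ((ρ ^ (n + 2))⁻¹ * K * K) := by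
            gcongr <;> first | exact k1 _ | exact k2 _
        _ = _ := by ring
  have b2 : ∀ α, |∫ X in Q, V X α * spaceDeriv α φ₀ X|
      ≤ ρ * (ρ ^ (n + 2))⁻¹ * K ^ 2 * ∫ X in q, (‖Du X‖ + ‖V X‖) := fun α => by
    refine hest (hφ₀.spaceDeriv α) (fun X => ?_) fun X hX => ?_
    · have := PiLp.norm_apply_le (V X) α
      rw [Real.norm_eq_abs] at this
      linarith [norm_nonneg (Du X)]
    · have hl : HasFDerivAt (fun Y : SpaceTime n => Y.1 - X₀.1)
          (ContinuousLinearMap.fst ℝ ℝ (Space n)) X := hasFDerivAt_fst.sub_const X₀.1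
      have hsd : spaceDeriv α φ₀ X = (X.1 - X₀.1) * spaceDeriv α (scaledKernel h p X₀ ρ) X := by
        simp only [φ₀]
        rw [spaceDeriv_mul α hl.differentiableAt (hk.differentiable X)]
        have : spaceDeriv α (fun Y : SpaceTime n => Y.1 - X₀.1) X = 0 := by
          rw [spaceDeriv, hl.fderiv]; simp
        rw [this]; ring
      rw [hsd, hK.spaceDeriv_eq]
      simp only [abs_mul]
      rw [abs_of_pos (by positivity : 0 < (ρ ^ (n + 2))⁻¹), abs_of_pos (by positivity : 0 < ρ⁻¹)]
      have h1 : |X.1 - X₀.1| ≤ ρ ^ 2 := by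
        have h2 := hJ hX.1
        rw [mem_Ioo, lt_div_iff₀ (by positivity), div_lt_iff₀ (by positivity)] at h2
        exact abs_le.2 ⟨by linarith [h2.1], by linarith [h2.2]⟩
      -- The factor `|t - t₀| ≤ ρ²` compensates the `ρ⁻¹` from differentiating the kernel in space,
      -- so both kinds of terms have the same size; with multiplicities `n` and `2n` they give `3n`.
      calc |X.1 - X₀.1| * ((ρ ^ (n + 2))⁻¹ * |h ((X.1 - X₀.1) / ρ ^ 2)|
            * (ρ⁻¹ * |partialDeriv α p (ρ⁻¹ • (X.2 - X₀.2))|))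
          ≤ ρ ^ 2 * ((ρ ^ (n + 2))⁻¹ * K * (ρ⁻¹ * K)) := by
            gcongr <;> first | exact k1 _ | exact k5 _ _
        _ = ρ * (ρ ^ (n + 2))⁻¹ * K ^ 2 := by
            have : ρ ^ 2 * ρ⁻¹ = ρ := by field_simp
            linear_combination ((ρ ^ (n + 2))⁻¹ * K ^ 2) * this
  set I := ∫ X in q, (‖Du X‖ + ‖V X‖) with hI
  have s1 : |∑ α, ∫ X in Q, Du X α * φ α X| ≤ n * (ρ * (ρ ^ (n + 2))⁻¹ * K ^ 2 * I) := by
    refine (Finset.abs_sum_le_sum_abs _ _).trans ((Finset.sum_le_sum fun α _ => b1 α).trans_eq ?_)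
    simp
  have s2 : |∑ α, ∫ X in Q, V X α * spaceDeriv α φ₀ X|
      ≤ n * (ρ * (ρ ^ (n + 2))⁻¹ * K ^ 2 * I) := by
    refine (Finset.abs_sum_le_sum_abs _ _).trans ((Finset.sum_le_sum fun α _ => b2 α).trans_eq ?_)
    simp
  rw [e1, abs_mul, abs_of_pos (by positivity : 0 < ρ⁻¹)]
  calc ρ⁻¹ * |(∑ α, ∫ X in Q, Du X α * φ α X)
        - 2 * (σ * ∑ α, ∫ X in Q, V X α * spaceDeriv α φ₀ X)|
      ≤ ρ⁻¹ * (n * (ρ * (ρ ^ (n + 2))⁻¹ * K ^ 2 * I)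
        + 2 * (1 * (n * (ρ * (ρ ^ (n + 2))⁻¹ * K ^ 2 * I)))) := by
        gcongr
        refine (abs_sub _ _).trans (add_le_add s1 ?_)
        rw [abs_mul, abs_two, abs_mul]
        gcongr
    _ = 3 * n * K ^ 2 * (ρ ^ (n + 2))⁻¹ * I := by
        field_simp; ring

/-- The kernels are probability densities whose supports shrink to `X₀`. The vertex need not lie in
the cylinders, so continuity is required in a full neighbourhood of it. -/
theorem tendsto_kernelAverage (hK : KernelData J h p) (hJ : J ⊆ Ioo (-1) 1)
    (hstar : ∀ s ∈ J, ∀ c : ℝ, 0 < c → c ≤ 1 → c * s ∈ J)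
    (X₀ : SpaceTime n) {R : ℝ} (hR : 0 < R) {u : SpaceTime n → ℝ}
    (hu : MemLp u 2 (volume.restrict (scaledCyl J X₀ R))) (hc : ContinuousAt u X₀) :
    Tendsto (kernelAverage h p J X₀ R u) (𝓝[>] 0) (𝓝 (u X₀)) := by
  have := isFiniteMeasure_scaledCyl hJ X₀ hR
  have hui : Integrable u (volume.restrict (scaledCyl J X₀ R)) := hu.integrable one_le_two
  rw [Metric.tendsto_nhds]
  intro ε hε
  obtain ⟨δ, hδ, hball⟩ := Metric.continuousAt_iff.1 hc (ε / 2) (by linarith)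
  -- With `ρ < 1` and `ρ < δ` also the duration satisfies `ρ² < δ`.
  have hev : ∀ᶠ ρ in 𝓝[>] (0 : ℝ), ρ < min (min R 1) δ :=
    nhdsWithin_le_nhds (Iio_mem_nhds (by positivity))
  filter_upwards [hev, self_mem_nhdsWithin] with ρ hρ1 hρ
  have hρ0 : 0 < ρ := hρ
  simp only [lt_min_iff] at hρ1
  obtain ⟨⟨hρR, hρ1⟩, hρδ⟩ := hρ1
  have hk := hK.isTestFunction X₀ hρ0
  have hmono := scaledCyl_mono hstar X₀ hρ0 hρR.le
  have hkR := hk.mono hmono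
  have hint : Integrable (fun X => u X * scaledKernel h p X₀ ρ X)
      (volume.restrict (scaledCyl J X₀ R)) := by
    obtain ⟨C, hC⟩ := hk.compact.exists_bound_of_continuous hk.continuous
    exact hui.mul_bdd hk.continuous.aestronglyMeasurable (Eventually.of_forall hC)
  have e1 : ∫ X in scaledCyl J X₀ R, scaledKernel h p X₀ ρ X = 1 := by
    have := hkR.setIntegral_mul fun _ => 1
    simpa [hK.integral_eq_one X₀ hρ0] using this
  have e2 : kernelAverage h p J X₀ R u ρ - u X₀
      = ∫ X in scaledCyl J X₀ R, (u X - u X₀) * scaledKernel h p X₀ ρ X := by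
    simp only [sub_mul]
    rw [integral_sub hint (hk.integrable.restrict.const_mul _), integral_const_mul, e1, mul_one]
    rfl
  rw [Real.dist_eq, e2]
  have hle : ‖∫ X in scaledCyl J X₀ R, (u X - u X₀) * scaledKernel h p X₀ ρ X‖
      ≤ ∫ X in scaledCyl J X₀ R, ε / 2 * scaledKernel h p X₀ ρ X := by
    refine norm_integral_le_of_norm_le (hk.integrable.restrict.const_mul _)
      (Eventually.of_forall fun X => ?_)
    rw [norm_mul, Real.norm_eq_abs (scaledKernel h p X₀ ρ X), abs_of_nonneg (hK.nonneg X₀ X hρ0)]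
    by_cases hX : X ∈ scaledCyl J X₀ ρ
    · refine mul_le_mul_of_nonneg_right ?_ (hK.nonneg X₀ X hρ0)
      refine (hball (x := X) ?_).le
      have hp := scaledCyl_subset_prod hJ X₀ hρ0 hX
      rw [Prod.dist_eq, max_lt_iff]
      refine ⟨?_, (Metric.mem_ball.1 hp.2).trans hρδ⟩
      rw [Real.dist_eq, abs_lt]
      have h2 : ρ ^ 2 < δ := by nlinarith
      exact ⟨by linarith [hp.1.1], by linarith [hp.1.2]⟩
    · simp [hk.eq_zero hX]
  rw [integral_const_mul, e1, mul_one] at hle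
  exact hle.trans_lt (by linarith)

/-- Solutions whose gradient satisfies a Morrey type decay are bounded by mean values. -/
theorem exists_local_bound (n : ℕ) {J : Set ℝ} (hJo : IsOpen J) (hJ : J ⊆ Ioo (-1) 1)
    (hstar : ∀ s ∈ J, ∀ c : ℝ, 0 < c → c ≤ 1 → c * s ∈ J) {c : ℝ}
    (hc : Metric.closedBall c (1 / 4) ⊆ J) {μ : ℝ} (hμ : 0 < μ) :
    ∃ C : ℝ, 0 < C ∧ ∀ (X₀ : SpaceTime n) (R : ℝ), 0 < R →
      ∀ (u : SpaceTime n → ℝ) (Du V : SpaceTime n → Space n) (σ B : ℝ),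
      MemLp u 2 (volume.restrict (scaledCyl J X₀ R)) →
      MemLp Du 2 (volume.restrict (scaledCyl J X₀ R)) →
      MemLp V 2 (volume.restrict (scaledCyl J X₀ R)) →
      IsWeakGrad (scaledCyl J X₀ R) u Du → |σ| ≤ 1 →
      (∀ φ, IsTestFunction (scaledCyl J X₀ R) φ →
        ∫ X in scaledCyl J X₀ R, u X * timeDeriv φ X
          = σ * ∑ α, ∫ X in scaledCyl J X₀ R, V X α * spaceDeriv α φ X) →
      0 ≤ B →
      (∀ ρ, 0 < ρ → ρ < R → ∫ X in scaledCyl J X₀ ρ, (‖Du X‖ ^ 2 + ‖V X‖ ^ 2)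
        ≤ (ρ / R) ^ ((n : ℝ) + 2 * μ) * B) →
      ContinuousAt u X₀ →
      u X₀ ^ 2 ≤ C * ((R ^ (n + 2))⁻¹ * (∫ X in scaledCyl J X₀ R, u X ^ 2) + (R ^ n)⁻¹ * B) := by
  obtain ⟨h, p, hK⟩ := exists_kernelData n hc
  obtain ⟨K, hK0, k1, k2, k3, k4, k5⟩ := hK.exists_bound
  have hV0 := cylVolume_nonneg n
  -- The first summand comes from the average at scale `R / 2`, the second from the total variation
  -- of the averages below that scale; each carries a factor `2` from squaring a sum.
  refine ⟨2 * K ^ 4 * cylVolume n * 4 ^ (n + 2) + 36 * n ^ 2 * K ^ 4 * cylVolume n / μ ^ 2 + 1,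
    by positivity, ?_⟩
  intro X₀ R hR u Du V σ B hu hDu hV hgrad hσ heq hB hdec hcont
  have hfin := isFiniteMeasure_scaledCyl hJ X₀ hR
  have hui : Integrable u (volume.restrict (scaledCyl J X₀ R)) := hu.integrable one_le_two
  set a := kernelAverage h p J X₀ R u with ha
  -- By Cauchy–Schwarz on the cylinder of radius `ρ`, the decay hypothesis bounds the derivative of
  -- the average by `L ρ^(μ - 1)`: the volume contributes `ρ^(-(n + 2)/2)` and the decay `(ρ /
  -- R)^(n/2 + μ)`.
  set L := 3 * n * K ^ 2 * (√(2 * cylVolume n * B) * R ^ (-((n : ℝ) / 2 + μ))) with hL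
  have hL0 : 0 ≤ L := by positivity
  have hderiv : ∀ ρ, 0 < ρ → HasDerivAt a
      (∫ X in scaledCyl J X₀ R, u X * scaledKernelDeriv h p X₀ ρ X) ρ := fun ρ hρ =>
    hasDerivAt_kernelAverage hK hJ X₀ hR hu hρ
  have hbound : ∀ ρ, 0 < ρ → ρ < R →
      ‖∫ X in scaledCyl J X₀ R, u X * scaledKernelDeriv h p X₀ ρ X‖ ≤ L * ρ ^ (μ - 1) := by
    intro ρ hρ hρR
    have hsub := scaledCyl_mono hstar X₀ hρ hρR.le
    have h1 := abs_deriv_kernelAverage_le hK hJo hJ hstar k1 k2 k5 X₀ hR hu hDu hV hgrad hσ heq hρ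
      hρR.le
    have hDu' := hDu.mono_measure (Measure.restrict_mono hsub le_rfl)
    have hV' := hV.mono_measure (Measure.restrict_mono hsub le_rfl)
    have h2 := setIntegral_scaledCyl_le hJ X₀ hρ (f := fun X => ‖Du X‖ + ‖V X‖)
      (hDu'.norm.add hV'.norm) (fun X => by positivity)
    have h3 : ∫ X in scaledCyl J X₀ ρ, (‖Du X‖ + ‖V X‖) ^ 2
        ≤ 2 * ((ρ / R) ^ ((n : ℝ) + 2 * μ) * B) := by
      refine le_trans ?_ (mul_le_mul_of_nonneg_left (hdec ρ hρ hρR) zero_le_two)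
      rw [← integral_const_mul]
      refine integral_mono (hDu'.norm.add hV'.norm).integrable_sq
        ((hDu'.norm.integrable_sq.add hV'.norm.integrable_sq).const_mul 2) fun X => ?_
      simp only
      nlinarith [sq_nonneg (‖Du X‖ - ‖V X‖)]
    have h4 : ∫ X in scaledCyl J X₀ ρ, (‖Du X‖ + ‖V X‖)
        ≤ √(2 * cylVolume n * B) * (ρ ^ (n + 2) * (R ^ (-((n : ℝ) / 2 + μ)) * ρ ^ (μ - 1))) := by
      refine abs_le_of_sq_le_sq' ?_ (by positivity) |>.2
      refine h2.trans ?_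
      rw [mul_pow, Real.sq_sqrt (by positivity)]
      calc cylVolume n * ρ ^ (n + 2) * ∫ X in scaledCyl J X₀ ρ, (‖Du X‖ + ‖V X‖) ^ 2
          ≤ cylVolume n * ρ ^ (n + 2) * (2 * ((ρ / R) ^ ((n : ℝ) + 2 * μ) * B)) := by gcongr
        _ = 2 * cylVolume n * B * (ρ ^ (n + 2) * (ρ / R) ^ ((n : ℝ) + 2 * μ)) := by ring
        _ = _ := by
          congr 1
          rw [Real.div_rpow hρ.le hR.le, mul_pow, mul_pow, ← Real.rpow_natCast (R ^ _) 2,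
            ← Real.rpow_natCast (ρ ^ (μ - 1)) 2, ← Real.rpow_mul hR.le, ← Real.rpow_mul hρ.le,
            div_eq_mul_inv, ← Real.rpow_neg hR.le]
          have e1 : ρ ^ ((n : ℝ) + 2 * μ) = ρ ^ (n + 2) * ρ ^ ((μ - 1) * (2 : ℕ)) := by
            rw [← Real.rpow_natCast ρ (n + 2), ← Real.rpow_add hρ]
            congr 1; push_cast; ring
          have e2 : -((n : ℝ) + 2 * μ) = -((n : ℝ) / 2 + μ) * (2 : ℕ) := by push_cast; ring
          rw [e1, e2]; ring
    refine h1.trans ((mul_le_mul_of_nonneg_left h4 (by positivity)).trans_eq ?_)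
    rw [hL]; field_simp
  have hincr : ∀ r, 0 < r → r < R / 2 → |a (R / 2) - a r| ≤ L * R ^ μ / μ := by
    intro r hr hrR
    have hb : ∀ ρ, 0 < ρ → HasDerivAt (fun ρ => L * ρ ^ μ / μ - L * r ^ μ / μ)
        (L * ρ ^ (μ - 1)) ρ := by
      intro ρ hρ
      have := (((Real.hasDerivAt_rpow_const (p := μ) (Or.inl hρ.ne')).const_mul L).div_const
        μ).sub_const (L * r ^ μ / μ)
      refine this.congr_deriv ?_
      field_simp
    -- The comparison function `L ρ^μ / μ` stays bounded as `ρ → 0` because `μ > 0`; this is where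
    -- the exponent beyond `n` in (PH) enters.
    have := image_norm_le_of_norm_deriv_right_le_deriv_boundary' (a := r) (b := R / 2)
      (f := fun ρ => a ρ - a r)
      (f' := fun ρ => ∫ X in scaledCyl J X₀ R, u X * scaledKernelDeriv h p X₀ ρ X)
      (B := fun ρ => L * ρ ^ μ / μ - L * r ^ μ / μ) (B' := fun ρ => L * ρ ^ (μ - 1))
      (fun ρ hρ => ((hderiv ρ (hr.trans_le hρ.1)).continuousAt.sub
        continuousAt_const).continuousWithinAt)
      (fun ρ hρ => ((hderiv ρ (hr.trans_le hρ.1)).sub_const _).hasDerivWithinAt)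
      (by simp)
      (fun ρ hρ => (hb ρ (hr.trans_le hρ.1)).continuousAt.continuousWithinAt)
      (fun ρ hρ => (hb ρ (hr.trans_le hρ.1)).hasDerivWithinAt)
      (fun ρ hρ => hbound ρ (hr.trans_le hρ.1) (by linarith [hρ.2]))
      (right_mem_Icc.2 hrR.le)
    refine this.trans ?_
    have h1 : 0 ≤ L * r ^ μ / μ := by positivity
    have h2 : L * (R / 2) ^ μ / μ ≤ L * R ^ μ / μ := by gcongr; linarith
    linarith
  have hlim := tendsto_kernelAverage hK hJ hstar X₀ hR hu hcont
  have hdiff : |a (R / 2) - u X₀| ≤ L * R ^ μ / μ := by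
    refine le_of_tendsto ((tendsto_const_nhds.sub hlim).abs) ?_
    filter_upwards [nhdsWithin_le_nhds (Iio_mem_nhds (by positivity : 0 < R / 2)),
      self_mem_nhdsWithin] with r hr1 hr2 using hincr r hr2 hr1
  have haR : a (R / 2) ^ 2
      ≤ K ^ 4 * cylVolume n * 4 ^ (n + 2) * ((R ^ (n + 2))⁻¹ * ∫ X in scaledCyl J X₀ R, u X ^ 2) := by
    have h1 : |a (R / 2)| ≤ ((R / 2) ^ (n + 2))⁻¹ * K ^ 2 * ∫ X in scaledCyl J X₀ R, |u X| := by
      rw [← integral_const_mul]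
      refine (Real.norm_eq_abs _).symm.trans_le <|
        norm_integral_le_of_norm_le (hui.abs.const_mul _) (Eventually.of_forall fun X => ?_)
      rw [norm_mul, mul_comm, scaledKernel]
      simp only [Real.norm_eq_abs, abs_mul]
      rw [abs_of_pos (by positivity : 0 < ((R / 2) ^ (n + 2))⁻¹), sq K, ← mul_assoc _ K K]
      gcongr <;> first | exact k1 _ | exact k2 _
    have h2 := setIntegral_scaledCyl_le hJ X₀ hR (f := fun X => |u X|) hu.abs
      (fun X => abs_nonneg _)
    simp only [sq_abs] at h2
    rw [← sq_abs]
    calc |a (R / 2)| ^ 2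
        ≤ (((R / 2) ^ (n + 2))⁻¹ * K ^ 2 * ∫ X in scaledCyl J X₀ R, |u X|) ^ 2 := by gcongr
      _ = (((R / 2) ^ (n + 2))⁻¹ * K ^ 2) ^ 2 * (∫ X in scaledCyl J X₀ R, |u X|) ^ 2 := by ring
      _ ≤ (((R / 2) ^ (n + 2))⁻¹ * K ^ 2) ^ 2
          * (cylVolume n * R ^ (n + 2) * ∫ X in scaledCyl J X₀ R, u X ^ 2) := by gcongr
      _ = _ := by
        rw [div_pow, (by norm_num : (4 : ℝ) = 2 ^ 2), ← pow_mul, mul_comm 2 (n + 2), pow_mul]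
        field_simp
  have hLsq : (L * R ^ μ / μ) ^ 2 = 18 * n ^ 2 * K ^ 4 * cylVolume n / μ ^ 2 * ((R ^ n)⁻¹ * B) := by
    have e1 : R ^ (-((n : ℝ) / 2 + μ)) * R ^ μ = R ^ (-((n : ℝ) / 2)) := by
      rw [← Real.rpow_add hR]; congr 1; ring
    have e2 : (R ^ (-((n : ℝ) / 2))) ^ 2 = (R ^ n)⁻¹ := by
      rw [← Real.rpow_natCast (R ^ _) 2, ← Real.rpow_mul hR.le, ← Real.rpow_natCast R n,
        ← Real.rpow_neg hR.le]
      congr 1; push_cast; ring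
    have e3 : L * R ^ μ / μ
        = 3 * n * K ^ 2 * (√(2 * cylVolume n * B) * R ^ (-((n : ℝ) / 2))) / μ := by
      rw [hL, ← e1]; ring
    rw [e3, div_pow, mul_pow, mul_pow, mul_pow (√_), e2, Real.sq_sqrt (by positivity)]
    ring
  have hIu : 0 ≤ (R ^ (n + 2))⁻¹ * ∫ X in scaledCyl J X₀ R, u X ^ 2 :=
    mul_nonneg (by positivity) (integral_nonneg fun X => sq_nonneg _)
  have hB' : 0 ≤ (R ^ n)⁻¹ * B := by positivity
  have hsq2 : (a (R / 2) - u X₀) ^ 2 ≤ (L * R ^ μ / μ) ^ 2 :=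
    sq_le_sq' (neg_le_of_abs_le hdiff) (le_of_abs_le hdiff)
  rw [hLsq] at hsq2
  set P := (R ^ (n + 2))⁻¹ * ∫ X in scaledCyl J X₀ R, u X ^ 2
  set S := (R ^ n)⁻¹ * B
  have c1 : 0 ≤ 36 * n ^ 2 * K ^ 4 * cylVolume n / μ ^ 2 * P := by positivity
  have c2 : 0 ≤ 2 * K ^ 4 * cylVolume n * 4 ^ (n + 2) * S := by positivity
  have c3 : u X₀ ^ 2 ≤ 2 * a (R / 2) ^ 2 + 2 * (a (R / 2) - u X₀) ^ 2 := by
    nlinarith [sq_nonneg (2 * a (R / 2) - u X₀)]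
  have c4 : 18 * n ^ 2 * K ^ 4 * cylVolume n / μ ^ 2 * S * 2
      = 36 * n ^ 2 * K ^ 4 * cylVolume n / μ ^ 2 * S := by ring
  nlinarith

end LocalBound

end

/-! ### Pointwise bounds for the system and its transpose. -/

section
section SystemBound

variable {n N : ℕ}

theorem backwardCyl_eq (X₀ : SpaceTime n) {r : ℝ} (hr : 0 < r) :
    backwardCyl X₀ r = scaledCyl (Ioo (-1) 0) X₀ r := by
  ext X
  have h1 : (X.1 - X₀.1) / r ^ 2 ∈ Ioo (-1 : ℝ) 0 ↔ X.1 ∈ Ioo (X₀.1 - r ^ 2) X₀.1 := by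
    rw [mem_Ioo, mem_Ioo, lt_div_iff₀ (by positivity), div_lt_iff₀ (by positivity)]
    constructor <;> rintro ⟨h1, h2⟩ <;> constructor <;> linarith
  simp only [backwardCyl, backwardInterval, scaledCyl, mem_prod, mem_ofPred_eq, h1,
    mem_ball_iff_norm]

theorem forwardCyl_eq (X₀ : SpaceTime n) {r : ℝ} (hr : 0 < r) :
    forwardCyl X₀ r = scaledCyl (Ioo 0 1) X₀ r := by
  ext X
  have h1 : (X.1 - X₀.1) / r ^ 2 ∈ Ioo (0 : ℝ) 1 ↔ X.1 ∈ Ioo X₀.1 (X₀.1 + r ^ 2) := by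
    rw [mem_Ioo, mem_Ioo, lt_div_iff₀ (by positivity), div_lt_iff₀ (by positivity)]
    constructor <;> rintro ⟨h1, h2⟩ <;> constructor <;> linarith
  simp only [forwardCyl, forwardInterval, scaledCyl, mem_prod, mem_ofPred_eq, h1,
    mem_ball_iff_norm]

theorem IsTestFunction.integrable_mul {U : Set (SpaceTime n)} {φ f : SpaceTime n → ℝ}
    (hφ : IsTestFunction U φ) (hf : MemLp f 2 (volume.restrict U)) :
    Integrable (fun X => f X * φ X) (volume.restrict U) :=
  hf.integrable_mul ((hφ.memLp 2).restrict U)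

theorem timeDeriv_zero (X : SpaceTime n) : timeDeriv (0 : SpaceTime n → ℝ) X = 0 := by
  simp [timeDeriv]

theorem spaceDeriv_zero (α : Fin n) (X : SpaceTime n) :
    spaceDeriv α (0 : SpaceTime n → ℝ) X = 0 := by
  simp [spaceDeriv]

/-- Each component solves a scalar equation whose flux is the corresponding component of `A Dw`, so
the scalar bound applies. The flux is at most `Lam` times the whole gradient, so the decay of the
latter passes to `‖Dw i‖² + ‖flux i‖²` at the cost of `1 + Lam²`. -/
theorem exists_system_bound (n N : ℕ) {lam Lam : ℝ} (hLam : 0 < Lam) {J : Set ℝ}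
    (hJo : IsOpen J) (hJ : J ⊆ Ioo (-1) 1)
    (hstar : ∀ s ∈ J, ∀ c : ℝ, 0 < c → c ≤ 1 → c * s ∈ J) {c : ℝ}
    (hc : Metric.closedBall c (1 / 4) ⊆ J) {μ₀ C₀ : ℝ} (hμ : 0 < μ₀) (hC₀ : 0 < C₀) :
    ∃ C : ℝ, 0 < C ∧ ∀ (A : Coeff n N), IsParabolic lam Lam A → ∀ (X₀ : SpaceTime n) (R : ℝ),
      0 < R → ∀ (w : Fin N → SpaceTime n → ℝ) (Dw : Fin N → SpaceTime n → Space n) (σ : ℝ),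
      (∀ i, MemLp (w i) 2 (volume.restrict (scaledCyl J X₀ R))) →
      (∀ i, MemLp (Dw i) 2 (volume.restrict (scaledCyl J X₀ R))) →
      (∀ i, IsWeakGrad (scaledCyl J X₀ R) (w i) (Dw i)) → |σ| ≤ 1 →
      (∀ φ : Fin N → SpaceTime n → ℝ, (∀ i, IsTestFunction (scaledCyl J X₀ R) (φ i)) →
        ∫ X in scaledCyl J X₀ R, ∑ i, w i X * timeDeriv (φ i) X
          = σ * ∫ X in scaledCyl J X₀ R, ellipticForm A Dw φ X) →
      (∀ ρ, 0 < ρ → ρ < R → ∫ X in scaledCyl J X₀ ρ, ∑ i, ‖Dw i X‖ ^ 2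
        ≤ C₀ * (ρ / R) ^ ((n : ℝ) + 2 * μ₀) * ∫ X in scaledCyl J X₀ R, ∑ i, ‖Dw i X‖ ^ 2) →
      (∀ i, ContinuousAt (w i) X₀) →
      ∀ i, w i X₀ ^ 2 ≤ C * ((R ^ (n + 2))⁻¹ * (∫ X in scaledCyl J X₀ R, w i X ^ 2)
        + (R ^ n)⁻¹ * ∫ X in scaledCyl J X₀ R, ∑ i, ‖Dw i X‖ ^ 2) := by
  obtain ⟨C, hC, hbd⟩ := exists_local_bound n hJo hJ hstar hc hμ
  refine ⟨C * (1 + (1 + Lam ^ 2) * C₀), by positivity, ?_⟩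
  intro A hA X₀ R hR w Dw σ hw hDw hgrad hσ heq hdec hcont i
  set Q := scaledCyl J X₀ R
  set G := ∫ X in Q, ∑ i, ‖Dw i X‖ ^ 2 with hG
  have hG0 : 0 ≤ G := integral_nonneg fun X => Finset.sum_nonneg fun _ _ => sq_nonneg _
  have hfl : ∀ i α, MemLp (fun X => flux A Dw i X α) 2 (volume.restrict Q) :=
    fun i α => MemLp.flux_apply hA hLam hDw i α
  have hV : MemLp (flux A Dw i) 2 (volume.restrict Q) := memLp_of_apply (hfl i)
  have h := hbd X₀ R hR (w i) (Dw i) (flux A Dw i) σ ((1 + Lam ^ 2) * C₀ * G) (hw i) (hDw i) hV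
    (hgrad i) hσ ?_ (by positivity) ?_ (hcont i)
  · refine h.trans ?_
    have hP : 0 ≤ (R ^ (n + 2))⁻¹ * ∫ X in Q, w i X ^ 2 :=
      mul_nonneg (by positivity) (integral_nonneg fun X => sq_nonneg _)
    have hS : 0 ≤ (R ^ n)⁻¹ * G := by positivity
    rw [mul_assoc C]
    refine mul_le_mul_of_nonneg_left ?_ hC.le
    have h1 : 0 ≤ (1 + Lam ^ 2) * C₀ * ((R ^ (n + 2))⁻¹ * ∫ X in Q, w i X ^ 2) := by positivity
    have h2 : (R ^ n)⁻¹ * ((1 + Lam ^ 2) * C₀ * G) = (1 + Lam ^ 2) * C₀ * ((R ^ n)⁻¹ * G) := by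
      ring
    rw [h2]
    linarith
  · intro φ hφ
    have h1 := heq (Pi.single i φ) (fun j => by
      by_cases hj : j = i
      · subst hj; simpa using hφ
      · rw [Pi.single_eq_of_ne hj]; exact IsTestFunction.zero)
    have h2 : ∀ X, ∑ j, w j X * timeDeriv ((Pi.single i φ : Fin N → SpaceTime n → ℝ) j) X
        = w i X * timeDeriv φ X := fun X => by
      rw [Finset.sum_eq_single i]
      · simp
      · intro j _ hj; rw [Pi.single_eq_of_ne hj, timeDeriv_zero, mul_zero]
      · simp
    have h3 : ∀ X, ellipticForm A Dw (Pi.single i φ) X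
        = ∑ α, flux A Dw i X α * spaceDeriv α φ X := fun X => by
      rw [ellipticForm_eq, Finset.sum_eq_single i]
      · simp
      · intro j _ hj; simp [Pi.single_eq_of_ne hj, spaceDeriv_zero]
      · simp
    simp only [h2, h3] at h1
    rw [h1, integral_finsetSum]
    exact fun α _ => (hφ.spaceDeriv α).integrable_mul (hfl i α)
  · intro ρ hρ hρR
    have hsub := scaledCyl_mono hstar X₀ hρ hρR.le
    have hDw' : ∀ j, MemLp (Dw j) 2 (volume.restrict (scaledCyl J X₀ ρ)) := fun j =>
      (hDw j).mono_measure (Measure.restrict_mono hsub le_rfl)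
    have hV' := hV.mono_measure (Measure.restrict_mono hsub le_rfl)
    have hsumi : Integrable (fun X => ∑ j, ‖Dw j X‖ ^ 2)
        (volume.restrict (scaledCyl J X₀ ρ)) :=
      integrable_finsetSum _ fun j _ => (hDw' j).norm.integrable_sq
    calc ∫ X in scaledCyl J X₀ ρ, (‖Dw i X‖ ^ 2 + ‖flux A Dw i X‖ ^ 2)
        ≤ ∫ X in scaledCyl J X₀ ρ, (1 + Lam ^ 2) * ∑ j, ‖Dw j X‖ ^ 2 := by
          refine integral_mono ((hDw' i).norm.integrable_sq.add hV'.norm.integrable_sq)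
            (hsumi.const_mul _) fun X => ?_
          have h1 := Finset.single_le_sum (f := fun j => ‖Dw j X‖ ^ 2) (fun _ _ => sq_nonneg _)
            (Finset.mem_univ i)
          have h2 := (Finset.single_le_sum (f := fun j => ‖flux A Dw j X‖ ^ 2)
            (fun _ _ => sq_nonneg _) (Finset.mem_univ i)).trans (flux_sq_le hA Dw X)
          simp only at h1 h2 ⊢
          linarith
      _ = (1 + Lam ^ 2) * ∫ X in scaledCyl J X₀ ρ, ∑ j, ‖Dw j X‖ ^ 2 := integral_const_mul _ _
      _ ≤ (1 + Lam ^ 2) * (C₀ * (ρ / R) ^ ((n : ℝ) + 2 * μ₀) * G) := by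
          gcongr; exact hdec ρ hρ hρR
      _ = _ := by ring

theorem MemV2.memLp_of_bounded {I : Set ℝ} {Ω : Set (Space n)} {u : SpaceTime n → ℝ}
    {Du : SpaceTime n → Space n} (h : MemV2 I Ω u Du) {a b : ℝ} (hI : I ⊆ Ioo a b) :
    MemLp u 2 (volume.restrict (I ×ˢ Ω)) := by
  have hsub : I ⊆ Ioo (-(|a| + |b| + 1)) (|a| + |b| + 1) := fun t ht =>
    ⟨by linarith [(hI ht).1, neg_abs_le a, abs_nonneg b],
      by linarith [(hI ht).2, le_abs_self b, abs_nonneg a]⟩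
  have := h.memLp (|a| + |b| + 1) (by positivity)
  rwa [inter_eq_left.2 hsub] at this

/-- Pointwise bound for solutions of the system in backward cylinders. -/
theorem exists_forward_bound (n N : ℕ) {lam Lam : ℝ} (hLam : 0 < Lam) {μ₀ C₀ : ℝ}
    (hμ : 0 < μ₀) (hC₀ : 0 < C₀) :
    ∃ C : ℝ, 0 < C ∧ ∀ (Rc : ℝ≥0∞) (A : Coeff n N), IsParabolic lam Lam A →
      PropertyPH A μ₀ Rc C₀ → ∀ (X₀ : SpaceTime n) (R : ℝ), 0 < R → ENNReal.ofReal R < Rc →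
      ∀ (w : Fin N → SpaceTime n → ℝ) (Dw : Fin N → SpaceTime n → Space n),
      IsWeakSolution A (backwardInterval X₀.1 R) (Metric.ball X₀.2 R) 0 w Dw →
      (∀ i, ContinuousAt (w i) X₀) →
      ∀ i, w i X₀ ^ 2 ≤ C * ((R ^ (n + 2))⁻¹ * (∫ X in backwardCyl X₀ R, w i X ^ 2)
        + (R ^ n)⁻¹ * ∫ X in backwardCyl X₀ R, ∑ i, ‖Dw i X‖ ^ 2) := by
  obtain ⟨C, hC, hbd⟩ := exists_system_bound n N (lam := lam) hLam (J := Ioo (-1) 0) isOpen_Ioo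
    (Ioo_subset_Ioo_right zero_le_one)
    (fun s hs c hc0 hc1 => ⟨by nlinarith [hs.1, hs.2], by nlinarith [hs.1, hs.2]⟩)
    (c := -(1 / 2)) (fun t ht => by
      rw [Metric.mem_closedBall, Real.dist_eq, abs_le] at ht
      exact ⟨by linarith [ht.1], by linarith [ht.2]⟩) hμ hC₀
  refine ⟨C, hC, fun Rc A hA hPH X₀ R hR hRc w Dw hw hcont => ?_⟩
  have hQ := backwardCyl_eq X₀ hR
  have hQ' : backwardInterval X₀.1 R ×ˢ Metric.ball X₀.2 R = scaledCyl (Ioo (-1) 0) X₀ R := hQ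
  rw [hQ]
  refine hbd A hA X₀ R hR w Dw 1 (fun i => ?_) (fun i => ?_) (fun i => ?_) (by simp) ?_ ?_ hcont
  · rw [← hQ']; exact (hw.memV2 i).memLp_of_bounded subset_rfl
  · rw [← hQ']; exact (hw.memV2 i).memLp_grad
  · rw [← hQ']; exact (hw.memV2 i).weakGrad
  · intro φ hφ
    rw [← hQ'] at hφ ⊢
    have := hw.eqn φ hφ
    simp only [Pi.zero_apply, zero_mul, Finset.sum_const_zero, integral_zero] at this
    linarith
  · intro ρ hρ hρR
    have := hPH X₀ R hR hRc w Dw hw ρ R hρ hρR le_rfl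
    rwa [hQ, backwardCyl_eq X₀ hρ] at this

theorem IsParabolic.transpose {lam Lam : ℝ} {A : Coeff n N} (hA : IsParabolic lam Lam A) :
    IsParabolic lam Lam (transposeCoeff A) where
  measurable α β i j := hA.measurable β α j i
  parabolic X ξ := by
    refine (hA.parabolic X ξ).trans_eq ?_
    rw [Finset.sum_comm]
    refine Finset.sum_congr rfl fun i _ => Finset.sum_congr rfl fun j _ => ?_
    rw [Finset.sum_comm]
    exact Finset.sum_congr rfl fun α _ => Finset.sum_congr rfl fun β _ => by
      simp only [transposeCoeff]; ring
  bounded X := by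
    refine le_trans (le_of_eq ?_) (hA.bounded X)
    rw [Finset.sum_comm]
    exact Finset.sum_congr rfl fun i _ => Finset.sum_congr rfl fun j _ => Finset.sum_comm

/-- Pointwise bound for solutions of the transposed system in forward cylinders. -/
theorem exists_adjoint_bound (n N : ℕ) {lam Lam : ℝ} (hLam : 0 < Lam) {μ₀ C₀ : ℝ}
    (hμ : 0 < μ₀) (hC₀ : 0 < C₀) :
    ∃ C : ℝ, 0 < C ∧ ∀ (Rc : ℝ≥0∞) (A : Coeff n N), IsParabolic lam Lam A →
      AdjointPropertyPH A μ₀ Rc C₀ → ∀ (X₀ : SpaceTime n) (R : ℝ), 0 < R →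
      ENNReal.ofReal R < Rc →
      ∀ (w : Fin N → SpaceTime n → ℝ) (Dw : Fin N → SpaceTime n → Space n),
      IsAdjointWeakSolution A (forwardInterval X₀.1 R) (Metric.ball X₀.2 R) 0 w Dw →
      (∀ i, ContinuousAt (w i) X₀) →
      ∀ i, w i X₀ ^ 2 ≤ C * ((R ^ (n + 2))⁻¹ * (∫ X in forwardCyl X₀ R, w i X ^ 2)
        + (R ^ n)⁻¹ * ∫ X in forwardCyl X₀ R, ∑ i, ‖Dw i X‖ ^ 2) := by
  obtain ⟨C, hC, hbd⟩ := exists_system_bound n N (lam := lam) hLam (J := Ioo 0 1) isOpen_Ioo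
    (Ioo_subset_Ioo_left (by norm_num))
    (fun s hs c hc0 hc1 => ⟨by nlinarith [hs.1, hs.2], by nlinarith [hs.1, hs.2]⟩)
    (c := 1 / 2) (fun t ht => by
      rw [Metric.mem_closedBall, Real.dist_eq, abs_le] at ht
      exact ⟨by linarith [ht.1], by linarith [ht.2]⟩) hμ hC₀
  refine ⟨C, hC, fun Rc A hA hPH X₀ R hR hRc w Dw hw hcont => ?_⟩
  have hQ := forwardCyl_eq X₀ hR
  have hQ' : forwardInterval X₀.1 R ×ˢ Metric.ball X₀.2 R = scaledCyl (Ioo 0 1) X₀ R := hQ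
  rw [hQ]
  -- In the transposed equation the time derivative has the opposite sign, hence `σ = -1`.
  refine hbd _ hA.transpose X₀ R hR w Dw (-1) (fun i => ?_) (fun i => ?_) (fun i => ?_)
    (by simp) ?_ ?_ hcont
  · rw [← hQ']; exact (hw.memV2 i).memLp_of_bounded subset_rfl
  · rw [← hQ']; exact (hw.memV2 i).memLp_grad
  · rw [← hQ']; exact (hw.memV2 i).weakGrad
  · intro φ hφ
    rw [← hQ'] at hφ ⊢
    have := hw.eqn φ hφ
    simp only [Pi.zero_apply, zero_mul, Finset.sum_const_zero, integral_zero] at this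
    linarith
  · intro ρ hρ hρR
    have := hPH X₀ R hR hRc w Dw hw ρ R hρ hρR le_rfl
    rwa [hQ, forwardCyl_eq X₀ hρ] at this

end SystemBound

/-! ### Weights in time and space for the energy estimate. -/

section Weights

/-- The exponential `exp(-2m(t - a))` satisfies the differential inequality with equality. Compact
support is obtained with two smooth steps. The one that switches off after `b` is decreasing, so it
only helps; the one that switches on is complete before `a`, where nothing is required. -/
theorem exists_time_weight (a b : ℝ) {m : ℝ} (hm : 0 ≤ m) :
    ∃ τ : ℝ → ℝ, ContDiff ℝ ∞ τ ∧ HasCompactSupport τ ∧ (∀ t, 0 ≤ τ t) ∧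
      (∀ t, a ≤ t → m * τ t ≤ -(1 / 2) * deriv τ t) ∧ (∀ t, a ≤ t → τ t ≤ 1) ∧
      ∀ t, a ≤ t → t ≤ b → Real.exp (-2 * m * (t - a)) ≤ τ t := by
  let S := Real.smoothTransition
  have hS : ContDiff ℝ ∞ S := Real.smoothTransition.contDiff
  let E : ℝ → ℝ := fun t => Real.exp (-2 * m * (t - a))
  let τ : ℝ → ℝ := fun t => E t * S (b + 1 - t) * S (t - a + 2)
  have hS1 : ∀ t, a - 1 ≤ t → S (t - a + 2) = 1 := fun t ht =>
    Real.smoothTransition.one_of_one_le (by linarith)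
  have hE1 : ∀ t, a ≤ t → E t ≤ 1 := fun t ht => by
    simp only [E]; rw [Real.exp_le_one_iff]; nlinarith
  have hE0 : ∀ t, 0 < E t := fun t => Real.exp_pos _
  refine ⟨τ, ?_, ?_, ?_, ?_, ?_, ?_⟩
  · have h1 : ContDiff ℝ ∞ E := by fun_prop
    exact (h1.mul (hS.comp (by fun_prop))).mul (hS.comp (by fun_prop))
  · refine HasCompactSupport.intro (isCompact_Icc (a := a - 2) (b := b + 1)) fun t ht => ?_
    by_cases h1 : t < a - 2
    · have : S (t - a + 2) = 0 := Real.smoothTransition.zero_of_nonpos (by linarith)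
      simp [τ, this]
    · have : S (b + 1 - t) = 0 := Real.smoothTransition.zero_of_nonpos (by
        by_contra hcon
        exact ht ⟨by linarith, by linarith⟩)
      simp [τ, this]
  · exact fun t => mul_nonneg (mul_nonneg (hE0 t).le (Real.smoothTransition.nonneg _))
      (Real.smoothTransition.nonneg _)
  · intro t ht
    have heq : τ =ᶠ[𝓝 t] fun t => E t * S (b + 1 - t) := by
      filter_upwards [Ioi_mem_nhds (by linarith : a - 1 < t)] with s hs
      simp [τ, hS1 s (le_of_lt hs)]
    have hdS : HasDerivAt (fun t => S (b + 1 - t)) (-(deriv S (b + 1 - t))) t := by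
      have h1 := ((hS.differentiable (by simp) (b + 1 - t)).hasDerivAt).comp t
        ((hasDerivAt_id t).const_sub (b + 1))
      simpa [Function.comp_def] using h1
    have hdE : HasDerivAt E (E t * (-2 * m)) t := by
      have h1 := (((hasDerivAt_id t).sub_const a).const_mul (-2 * m)).exp
      simpa [E] using h1
    have hd := hdE.mul hdS
    rw [heq.deriv_eq, heq.self_of_nhds]
    have hd' : deriv (fun t => E t * S (b + 1 - t)) t = _ := hd.deriv
    rw [hd']
    have hmono : 0 ≤ deriv S (b + 1 - t) := Real.smoothTransition.monotone.deriv_nonneg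
    nlinarith [mul_nonneg (hE0 t).le hmono]
  · intro t ht
    simp only [τ]
    rw [hS1 t (by linarith), mul_one]
    exact mul_le_one₀ (hE1 t ht) (Real.smoothTransition.nonneg _) (Real.smoothTransition.le_one _)
  · intro t ht htb
    simp only [τ]
    have : S (b + 1 - t) = 1 := Real.smoothTransition.one_of_one_le (by linarith)
    rw [hS1 t (by linarith), this, mul_one, mul_one]

/-- The weight is `exp(-2ϱD)` with `D = d arctan(s / d)` and `s = √(r² + |x - x₀|²)`, a smooth
substitute for the distance. The gradient bound holds because `D` has slope at most one. On the ball
of radius `r` one has `D ≤ s ≤ 2r`, and beyond distance `d` one has `D ≥ dπ/4 ≥ d/2`. For `d = 0`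
the formula gives `D = 0` and the weight `1`. -/
theorem exists_space_weight {n : ℕ} (x₀ : Space n) {r d ϱ : ℝ} (hr : 0 < r) (hd : 0 ≤ d)
    (hϱ : 0 ≤ ϱ) :
    ∃ W : Space n → ℝ, ContDiff ℝ ∞ W ∧ (∀ x, 0 ≤ W x) ∧ (∀ x, W x ≤ 1) ∧
      (∀ x, ‖gradVec W x‖ ≤ 2 * ϱ * W x) ∧ (∀ x, ‖x - x₀‖ ≤ r → Real.exp (-(4 * ϱ * r)) ≤ W x) ∧
      ∀ x, d ≤ ‖x - x₀‖ → W x ≤ Real.exp (-(ϱ * d)) := by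
  let s : Space n → ℝ := fun x => √(r ^ 2 + ‖x - x₀‖ ^ 2)
  let D : Space n → ℝ := fun x => d * Real.arctan (s x / d)
  let W : Space n → ℝ := fun x => Real.exp (-(2 * ϱ) * D x)
  have hpos : ∀ x : Space n, 0 < r ^ 2 + ‖x - x₀‖ ^ 2 := fun x => by positivity
  have hs0 : ∀ x, 0 < s x := fun x => Real.sqrt_pos.2 (hpos x)
  have hns : ∀ x, ‖x - x₀‖ ≤ s x := fun x => Real.le_sqrt_of_sq_le (by nlinarith)
  have hsm : ContDiff ℝ ∞ s :=
    ContDiff.sqrt (contDiff_const.add ((contDiff_id.sub contDiff_const).norm_sq ℝ))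
      fun x => (hpos x).ne'
  have hDm : ContDiff ℝ ∞ D :=
    contDiff_const.mul (Real.contDiff_arctan.comp (hsm.div_const d))
  have hD0 : ∀ x, 0 ≤ D x := fun x =>
    mul_nonneg hd (Real.arctan_nonneg.2 (div_nonneg (hs0 x).le hd))
  refine ⟨W, Real.contDiff_exp.comp (contDiff_const.mul hDm), fun x => (Real.exp_pos _).le,
    fun x => ?_, fun x => ?_, fun x hx => ?_, fun x hx => ?_⟩
  · simp only [W]; rw [Real.exp_le_one_iff]; nlinarith [hD0 x, mul_nonneg hϱ (hD0 x)]
  · have h1 : HasFDerivAt (fun x : Space n => r ^ 2 + ‖x - x₀‖ ^ 2)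
        (2 • (innerSL ℝ (x - x₀))) x := by
      have := (((hasFDerivAt_id (𝕜 := ℝ) x).sub_const x₀).norm_sq).const_add (r ^ 2)
      simpa using this
    have h2 := h1.sqrt (hpos x).ne'
    have h3 : HasFDerivAt W _ x :=
      ((((h2.mul_const d⁻¹).arctan).const_mul d).const_mul (-(2 * ϱ))).exp
    set c := d * d⁻¹ * (1 / (1 + (s x * d⁻¹) ^ 2)) / s x with hc
    have hgrad : gradVec W x = (-(2 * ϱ) * W x * c) • (x - x₀) := by
      ext α
      simp only [gradVec, partialDeriv, h3.fderiv]
      simp only [smul_apply, smul_eq_mul, innerSL_apply_apply, nsmul_eq_mul, PiLp.smul_apply,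
        EuclideanSpace.inner_single_right, conj_trivial, hc, W, D, s, div_eq_mul_inv]
      have := (hs0 x).ne'
      simp only [s] at this
      field_simp
      norm_num
      ring
    have hc0 : 0 ≤ c := by positivity
    have hc1 : c * ‖x - x₀‖ ≤ 1 := by
      have e1 : d * d⁻¹ ≤ 1 := mul_inv_le_one
      have e2 : 1 / (1 + (s x * d⁻¹) ^ 2) ≤ 1 := by
        rw [div_le_one (by positivity)]; nlinarith [sq_nonneg (s x * d⁻¹)]
      have e3 : ‖x - x₀‖ / s x ≤ 1 := (div_le_one (hs0 x)).2 (hns x)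
      calc c * ‖x - x₀‖ = (d * d⁻¹) * (1 / (1 + (s x * d⁻¹) ^ 2)) * (‖x - x₀‖ / s x) := by
            rw [hc]; ring
        _ ≤ 1 * 1 * 1 := by gcongr
        _ = 1 := by norm_num
    rw [hgrad, norm_smul, Real.norm_eq_abs]
    have hW0 : 0 < W x := Real.exp_pos _
    rw [abs_mul, abs_mul, abs_neg, abs_of_nonneg (by positivity : 0 ≤ 2 * ϱ), abs_of_pos hW0,
      abs_of_nonneg hc0, mul_assoc]
    exact mul_le_of_le_one_right (by positivity) hc1
  · simp only [W]
    rw [Real.exp_le_exp]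
    have h1 : D x ≤ s x := by
      rcases hd.eq_or_lt with h0 | h0
      · simp only [D, ← h0, zero_mul]; exact (hs0 x).le
      · have : Real.arctan (s x / d) ≤ s x / d := by
          conv_rhs => rw [← Real.tan_arctan (s x / d)]
          exact Real.le_tan (Real.arctan_nonneg.2 (div_nonneg (hs0 x).le hd))
            (Real.arctan_lt_pi_div_two _)
        calc D x ≤ d * (s x / d) := by simp only [D]; gcongr
          _ = s x := by field_simp
    have h2 : s x ≤ 2 * r := by
      simp only [s]
      rw [Real.sqrt_le_left (by positivity)]
      nlinarith [norm_nonneg (x - x₀)]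
    nlinarith [h1.trans h2]
  · simp only [W]
    rw [Real.exp_le_exp]
    have h1 : d / 2 ≤ D x := by
      rcases hd.eq_or_lt with h0 | h0
      · simp [D, ← h0]
      · have h2 : 1 ≤ s x / d := (one_le_div h0).2 (hx.trans (hns x))
        have h3 := Real.arctan_mono h2
        rw [Real.arctan_one] at h3
        have := Real.pi_gt_three
        simp only [D]
        nlinarith
    nlinarith
end Weights

end

/-! ### Solutions on slabs and exponential decay away from the sources. -/

section
variable {n N : ℕ}

/-- The slices `u(t, ·)` are bounded in `L²(ℝⁿ)`. -/
def BddSlices (u : SpaceTime n → ℝ) : Prop :=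
  ∃ M : ℝ≥0∞, M < ⊤ ∧ ∀ᵐ t : ℝ, eLpNorm (fun x => u (t, x)) 2 volume ≤ M

theorem MemV2.bddSlices {u : SpaceTime n → ℝ} {Du : SpaceTime n → Space n}
    (h : MemV2 univ univ u Du) : BddSlices u := by
  refine ⟨_, h.essSup_lt_top, ?_⟩
  have := ENNReal.ae_le_essSup (μ := volume.restrict (univ : Set ℝ))
    (fun t => eLpNorm (fun x => u (t, x)) 2 (volume.restrict (univ : Set (Space n))))
  rw [Measure.restrict_univ] at this
  simp only [Measure.restrict_univ] at this ⊢
  exact this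

theorem BddSlices.sub {u v : SpaceTime n → ℝ} (hu : BddSlices u) (hv : BddSlices v)
    (hum : AEStronglyMeasurable u) (hvm : AEStronglyMeasurable v) :
    BddSlices (fun X => u X - v X) := by
  obtain ⟨M, hM, hu⟩ := hu
  obtain ⟨M', hM', hv⟩ := hv
  refine ⟨M + M', ENNReal.add_lt_top.2 ⟨hM, hM'⟩, ?_⟩
  filter_upwards [hu, hv, hum.prodMk_left, hvm.prodMk_left] with t h1 h2 h3 h4
  exact (eLpNorm_sub_le h3 h4 one_le_two).trans (add_le_add h1 h2)

theorem BddSlices.mul_bdd {u : SpaceTime n → ℝ} (hu : BddSlices u) {η : ℝ → ℝ} {C : ℝ}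
    (hη : ∀ t, |η t| ≤ C) : BddSlices (fun X => η X.1 * u X) := by
  obtain ⟨M, hM, hu⟩ := hu
  refine ⟨ENNReal.ofReal C * M, ENNReal.mul_lt_top ENNReal.ofReal_lt_top hM, ?_⟩
  filter_upwards [hu] with t ht
  refine (eLpNorm_le_mul_eLpNorm_of_ae_le_mul (g := fun x => u (t, x)) (c := C)
    (Eventually.of_forall fun x => ?_) 2).trans (by gcongr)
  rw [norm_mul]
  exact mul_le_mul_of_nonneg_right (hη t) (norm_nonneg _)

theorem IsTestFunction.bddSlices {U : Set (SpaceTime n)} {φ : SpaceTime n → ℝ}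
    (hφ : IsTestFunction U φ) : BddSlices φ := by
  obtain ⟨C, hC0, hC⟩ := hφ.exists_bound
  have hK : IsCompact (Prod.snd '' tsupport φ) := hφ.compact.isCompact.image continuous_snd
  refine ⟨eLpNorm ((Prod.snd '' tsupport φ).indicator fun _ => C) 2 volume,
    (memLp_indicator_const 2 hK.measurableSet C (Or.inr hK.measure_lt_top.ne)).eLpNorm_lt_top,
    Eventually.of_forall fun t => eLpNorm_mono_real fun x => ?_⟩
  by_cases hx : x ∈ Prod.snd '' tsupport φ
  · rw [indicator_of_mem hx]; exact hC _
  · rw [indicator_of_notMem hx, image_eq_zero_of_notMem_tsupport fun h => hx ⟨_, h, rfl⟩]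
    simp

section GlobalSol

variable {A : Coeff n N} {F F' w w' : Fin N → SpaceTime n → ℝ}
  {H H' Dw Dw' : Fin N → SpaceTime n → Space n} {lam Lam : ℝ}

theorem flux_sub (i : Fin N) (X : SpaceTime n) (α : Fin n) :
    flux A (fun i X => Dw i X - Dw' i X) i X α = flux A Dw i X α - flux A Dw' i X α := by
  simp only [flux_apply, PiLp.sub_apply, mul_sub, Finset.sum_sub_distrib]

theorem SlabL2.integrable_mul {f φ : SpaceTime n → ℝ} (hf : SlabL2 f)
    (hφ : IsTestFunction univ φ) : Integrable (fun X => f X * φ X) :=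
  hf.locL2.integrable_mul hφ.continuous hφ.compact

theorem IsWeakGrad.sub {u v : SpaceTime n → ℝ} {Du Dv : SpaceTime n → Space n}
    (hu : IsWeakGrad univ u Du) (hv : IsWeakGrad univ v Dv) (hu2 : SlabL2 u) (hv2 : SlabL2 v)
    (hDu2 : SlabL2 Du) (hDv2 : SlabL2 Dv) :
    IsWeakGrad univ (fun X => u X - v X) (fun X => Du X - Dv X) := by
  intro φ hφ α
  have h1 := hu φ hφ α
  have h2 := hv φ hφ α
  rw [setIntegral_univ, setIntegral_univ] at *
  simp only [PiLp.sub_apply, sub_mul]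
  rw [integral_sub (hu2.integrable_mul (hφ.spaceDeriv α)) (hv2.integrable_mul (hφ.spaceDeriv α)),
    integral_sub ((hDu2.apply α).integrable_mul hφ) ((hDv2.apply α).integrable_mul hφ), h1, h2]
  ring

theorem GlobalSol.sub (hA : IsParabolic lam Lam A) (hLam : 0 < Lam) (h : GlobalSol A F H w Dw)
    (h' : GlobalSol A F' H' w' Dw') :
    GlobalSol A (fun i X => F i X - F' i X) (fun i X => H i X - H' i X)
      (fun i X => w i X - w' i X) (fun i X => Dw i X - Dw' i X) where
  source i := (h.source i).sub (h'.source i)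
  source_flux i := (h.source_flux i).sub (h'.source_flux i)
  memL2 i := (h.memL2 i).sub (h'.memL2 i)
  memL2_grad i := (h.memL2_grad i).sub (h'.memL2_grad i)
  weakGrad i := (h.weakGrad i).sub (h'.weakGrad i) (h.memL2 i) (h'.memL2 i) (h.memL2_grad i)
    (h'.memL2_grad i)
  eqn i φ hφ := by
    have e1 := h.eqn i φ hφ
    have e2 := h'.eqn i φ hφ
    have hf := fun i => SlabL2.flux hA hLam h.memL2_grad i
    have hf' := fun i => SlabL2.flux hA hLam h'.memL2_grad i
    simp only [flux_sub, PiLp.sub_apply, sub_mul]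
    rw [integral_sub ((h.memL2 i).integrable_mul hφ.timeDeriv)
        ((h'.memL2 i).integrable_mul hφ.timeDeriv),
      integral_sub ((h.source i).integrable_mul hφ) ((h'.source i).integrable_mul hφ)]
    have s1 : ∀ α, ∫ X, (flux A Dw i X α * spaceDeriv α φ X - flux A Dw' i X α * spaceDeriv α φ X)
        = (∫ X, flux A Dw i X α * spaceDeriv α φ X) - ∫ X, flux A Dw' i X α * spaceDeriv α φ X :=
      fun α => integral_sub (((hf i).apply α).integrable_mul (hφ.spaceDeriv α))
        (((hf' i).apply α).integrable_mul (hφ.spaceDeriv α))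
    have s2 : ∀ α, ∫ X, (H i X α * spaceDeriv α φ X - H' i X α * spaceDeriv α φ X)
        = (∫ X, H i X α * spaceDeriv α φ X) - ∫ X, H' i X α * spaceDeriv α φ X :=
      fun α => integral_sub (((h.source_flux i).apply α).integrable_mul (hφ.spaceDeriv α))
        (((h'.source_flux i).apply α).integrable_mul (hφ.spaceDeriv α))
    simp only [s1, s2, Finset.sum_sub_distrib]
    linarith

/-- The energy method works with `L²` on slabs, whereas (PH) concerns solutions in `V₂`. The slice
bound needed for `V₂` is supplied by `BddSlices`; where the sources vanish the equation becomes
homogeneous. -/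
theorem GlobalSol.isWeakSolution (hA : IsParabolic lam Lam A) (hLam : 0 < Lam)
    (h : GlobalSol A F H w Dw) (hb : ∀ i, BddSlices (w i)) {I : Set ℝ} {Ω : Set (Space n)}
    {T : ℝ} (hI : I ⊆ Ioo (-T) T) (hF : ∀ i, ∀ X ∈ I ×ˢ Ω, F i X = 0)
    (hH : ∀ i, ∀ X ∈ I ×ˢ Ω, H i X = 0) : IsWeakSolution A I Ω 0 w Dw where
  memV2 i :=
    { memLp := fun T _ => (h.memL2 i T).mono_measure
        (Measure.restrict_mono (prod_mono inter_subset_right (subset_univ _)) le_rfl)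
      weakGrad := fun φ hφ α => by
        have := h.weakGrad i φ hφ.to_univ α
        rw [setIntegral_univ, setIntegral_univ] at this
        rw [(hφ.spaceDeriv α).setIntegral_mul, hφ.setIntegral_mul, this]
      memLp_grad := (h.memL2_grad i T).mono_measure
        (Measure.restrict_mono (prod_mono hI (subset_univ _)) le_rfl)
      essSup_lt_top := by
        obtain ⟨M, hM, hb⟩ := hb i
        refine lt_of_le_of_lt (essSup_le_of_ae_le M ?_) hM
        filter_upwards [ae_restrict_of_ae hb] with t ht
        exact (eLpNorm_mono_measure _ Measure.restrict_le_self).trans ht }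
  eqn φ hφ := by
    have hf := fun i => SlabL2.flux hA hLam h.memL2_grad i
    simp only [Pi.zero_apply, zero_mul, Finset.sum_const_zero, integral_zero, ellipticForm_eq]
    rw [integral_finsetSum _ fun i _ => ((h.memL2 i).integrable_mul
        (hφ i).to_univ.timeDeriv).restrict,
      integral_finsetSum _ fun i _ => integrable_finsetSum _ fun α _ =>
        (((hf i).apply α).integrable_mul ((hφ i).to_univ.spaceDeriv α)).restrict,
      ← Finset.sum_neg_distrib, ← Finset.sum_add_distrib]
    refine Finset.sum_eq_zero fun i _ => ?_
    rw [integral_finsetSum _ fun α _ =>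
        (((hf i).apply α).integrable_mul ((hφ i).to_univ.spaceDeriv α)).restrict,
      (hφ i).timeDeriv.setIntegral_mul]
    simp only [((hφ i).spaceDeriv _).setIntegral_mul]
    rw [h.eqn i _ (hφ i).to_univ]
    have z1 : ∀ X, F i X * φ i X = 0 := fun X => by
      by_cases hX : X ∈ I ×ˢ Ω
      · rw [hF i X hX, zero_mul]
      · rw [(hφ i).eq_zero hX, mul_zero]
    have z2 : ∀ α X, H i X α * spaceDeriv α (φ i) X = 0 := fun α X => by
      by_cases hX : X ∈ I ×ˢ Ω
      · rw [hH i X hX, PiLp.zero_apply, zero_mul]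
      · rw [((hφ i).spaceDeriv α).eq_zero hX, mul_zero]
    simp [z1, z2]

end GlobalSol

/-- Weighted pointwise estimate: a solution that starts from zero and whose sources vanish at
distance less than `d` from `X₀` is exponentially small at `X₀`. -/
theorem exists_pointwise_decay (n N : ℕ) {lam Lam : ℝ} (hlam : 0 < lam) (hLam : 0 < Lam)
    {μ₀ C₀ : ℝ} (hμ : 0 < μ₀) (hC₀ : 0 < C₀) :
    ∃ C : ℝ, 0 < C ∧ ∀ (Rc : ℝ≥0∞) (A : Coeff n N), IsParabolic lam Lam A →
      PropertyPH A μ₀ Rc C₀ → ∀ (X₀ : SpaceTime n) (r : ℝ), 0 < r → ENNReal.ofReal r < Rc →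
      ∀ (T a d ϱ : ℝ), a ≤ X₀.1 - r ^ 2 → X₀.1 - a ≤ T → 0 ≤ d → 0 ≤ ϱ →
      ∀ (F w : Fin N → SpaceTime n → ℝ) (H Dw : Fin N → SpaceTime n → Space n),
      GlobalSol A F H w Dw → (∀ i, BddSlices (w i)) → (∀ i, MemLp (F i) 2 volume) →
      (∀ i, MemLp (H i) 2 volume) → (∀ i X, X.1 < a → w i X = 0) →
      (∀ i X, X.1 < a → F i X = 0) → (∀ i X, X.1 < a → H i X = 0) →
      (∀ i, ∀ X ∈ backwardCyl X₀ r, F i X = 0) → (∀ i, ∀ X ∈ backwardCyl X₀ r, H i X = 0) →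
      (∀ i X, ‖X.2 - X₀.2‖ < d → F i X = 0) → (∀ i X, ‖X.2 - X₀.2‖ < d → H i X = 0) →
      (∀ i, ContinuousAt (w i) X₀) →
      ∀ i, w i X₀ ^ 2 ≤ C * ((r ^ (n + 2))⁻¹ * T
        * Real.exp (2 * energyRate lam Lam * ϱ ^ 2 * T + 4 * ϱ * r - ϱ * d)
        * (T * (∫ X, ∑ i, F i X ^ 2) + ∫ X, ∑ i, ‖H i X‖ ^ 2)) := by
  obtain ⟨C₁, hC₁, hbd⟩ := exists_forward_bound n N (lam := lam) hLam hμ hC₀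
  -- The factor `exp 2` is the loss of the time weight due to its rate `1 / T` over a duration `T`.
  -- The factor `2 + 2 / lam` collects the bounds of `w` and `Dw` by the energy, and `1 / 2 + 2 /
  -- lam` the coefficients of the two sources.
  refine ⟨C₁ * (Real.exp 2 * ((2 + 2 / lam) * (1 / 2 + 2 / lam))), by positivity, ?_⟩
  intro Rc A hA hPH X₀ r hr hRc T a d ϱ har haT hd hϱ F w H Dw hw hb hF hH hwa hFa hHa hFQ hHQ
    hFd hHd hcont i
  have hrT : r ^ 2 ≤ T := by linarith
  have hT : 0 < T := lt_of_lt_of_le (by positivity) hrT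
  set ν := energyRate lam Lam with hν
  have hν0 : 0 < ν := energyRate_pos hlam
  have hm : 0 ≤ ν * ϱ ^ 2 + 1 / T := by positivity
  obtain ⟨τ, hτ, hτc, hτ0, hτd, hτ1, hτl⟩ := exists_time_weight a X₀.1 hm
  obtain ⟨W, hW, hW0, hW1, hWd, hWr, hWl⟩ := exists_space_weight X₀.2 hr hd hϱ
  -- On the cylinder `Q` both weights are bounded below, and on the supports of the sources the
  -- spatial weight is at most `exp(-ϱd)`. The quotient of these bounds is the decay factor.
  have hen := weighted_energy hlam hLam hA hw hwa hT hτ hτc hτ0 hτd hW hW0 hW1 hWd hϱ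
  set Q := backwardCyl X₀ r with hQ
  set SF := ∫ X, ∑ i, F i X ^ 2
  set SH := ∫ X, ∑ i, ‖H i X‖ ^ 2
  have hSF : 0 ≤ SF := integral_nonneg fun X => Finset.sum_nonneg fun _ _ => sq_nonneg _
  have hSH : 0 ≤ SH := integral_nonneg fun X => Finset.sum_nonneg fun _ _ => sq_nonneg _
  have hQm : MeasurableSet Q := measurableSet_Ioo.prod measurableSet_ball
  obtain ⟨T', hT'⟩ : ∃ T', backwardInterval X₀.1 r ⊆ Ioo (-T') T' := by
    refine ⟨|X₀.1| + r ^ 2 + 1, fun t ht => ⟨?_, ?_⟩⟩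
    · linarith [ht.1, neg_abs_le X₀.1]
    · linarith [ht.2, le_abs_self X₀.1, sq_nonneg r]
  have hQT : Q ⊆ Ioo (-T') T' ×ˢ univ := prod_mono hT' (subset_univ _)
  have hwQ : ∀ i, MemLp (w i) 2 (volume.restrict Q) := fun i =>
    (hw.memL2 i T').mono_measure (Measure.restrict_mono hQT le_rfl)
  have hDwQ : ∀ i, MemLp (Dw i) 2 (volume.restrict Q) := fun i =>
    (hw.memL2_grad i T').mono_measure (Measure.restrict_mono hQT le_rfl)
  -- upper bound for the right-hand side
  have hFi : Integrable (fun X => ∑ i, F i X ^ 2) :=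
    integrable_finsetSum _ fun i _ => (hF i).integrable_sq
  have hHi : Integrable (fun X => ∑ i, ‖H i X‖ ^ 2) :=
    integrable_finsetSum _ fun i _ => (hH i).integrable_norm_pow (by norm_num)
  have hrhs : ∫ X, (T / 2 * ∑ i, F i X ^ 2 + 2 / lam * ∑ i, ‖H i X‖ ^ 2) * (τ X.1 * W X.2)
      ≤ Real.exp (-(ϱ * d)) * (T / 2 * SF + 2 / lam * SH) := by
    have hI : Integrable (fun X => Real.exp (-(ϱ * d))
        * (T / 2 * ∑ i, F i X ^ 2 + 2 / lam * ∑ i, ‖H i X‖ ^ 2)) :=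
      ((hFi.const_mul _).add (hHi.const_mul _)).const_mul _
    have hS0 : ∀ X, 0 ≤ T / 2 * ∑ i, F i X ^ 2 + 2 / lam * ∑ i, ‖H i X‖ ^ 2 := fun X => by
      have := Finset.sum_nonneg (s := Finset.univ) fun i _ => sq_nonneg (F i X)
      have := Finset.sum_nonneg (s := Finset.univ) fun i _ => sq_nonneg ‖H i X‖
      positivity
    refine (integral_mono_of_nonneg (Eventually.of_forall fun X =>
      mul_nonneg (hS0 X) (mul_nonneg (hτ0 _) (hW0 _))) hI
      (Eventually.of_forall fun X => ?_)).trans_eq ?_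
    · simp only
      by_cases h1 : X.1 < a
      · simp [hFa _ X h1, hHa _ X h1]
      by_cases h2 : ‖X.2 - X₀.2‖ < d
      · simp [hFd _ X h2, hHd _ X h2]
      rw [mul_comm (Real.exp _)]
      refine mul_le_mul_of_nonneg_left ?_ (hS0 X)
      calc τ X.1 * W X.2 ≤ 1 * Real.exp (-(ϱ * d)) :=
            mul_le_mul (hτ1 _ (not_lt.1 h1)) (hWl _ (not_lt.1 h2)) (hW0 _) zero_le_one
        _ = _ := one_mul _
    · rw [integral_const_mul, integral_add (hFi.const_mul _) (hHi.const_mul _),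
        integral_const_mul, integral_const_mul]
  -- lower bound for the left-hand side
  set e₀ := Real.exp (-2 * (ν * ϱ ^ 2 + 1 / T) * T) * Real.exp (-(4 * ϱ * r)) with he₀
  set G := ∫ X in Q, ∑ i, ‖Dw i X‖ ^ 2
  set P := ∫ X in Q, ∑ i, w i X ^ 2
  have hG0 : 0 ≤ G := integral_nonneg fun X => Finset.sum_nonneg fun _ _ => sq_nonneg _
  have hP0 : 0 ≤ P := integral_nonneg fun X => Finset.sum_nonneg fun _ _ => sq_nonneg _
  have hlhs : e₀ * (lam / 2 * G + 1 / (2 * T) * P)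
      ≤ ∫ X, (lam / 2 * ∑ i, ‖Dw i X‖ ^ 2 + 1 / (2 * T) * ∑ i, w i X ^ 2) * (τ X.1 * W X.2) := by
    have hS0 : ∀ X, 0 ≤ lam / 2 * ∑ i, ‖Dw i X‖ ^ 2 + 1 / (2 * T) * ∑ i, w i X ^ 2 := fun X => by
      have := Finset.sum_nonneg (s := Finset.univ) fun i _ => sq_nonneg (w i X)
      have := Finset.sum_nonneg (s := Finset.univ) fun i _ => sq_nonneg ‖Dw i X‖
      positivity
    have hI : Integrable (fun X =>
        (lam / 2 * ∑ i, ‖Dw i X‖ ^ 2 + 1 / (2 * T) * ∑ i, w i X ^ 2) * (τ X.1 * W X.2)) := by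
      obtain ⟨Cτ, hCτ⟩ := hτc.exists_bound_of_continuous hτ.continuous
      obtain ⟨T₂, hT₂⟩ := hτc.isCompact.isBounded.subset_ball (0 : ℝ)
      have hm : AEStronglyMeasurable (fun X : SpaceTime n => τ X.1 * W X.2) :=
        ((hτ.continuous.comp continuous_fst).mul
          (hW.continuous.comp continuous_snd)).aestronglyMeasurable
      have hC : ∀ X : SpaceTime n, |τ X.1 * W X.2| ≤ Cτ := fun X => by
        rw [abs_mul, abs_of_nonneg (hW0 X.2)]
        exact (mul_le_of_le_one_right (abs_nonneg _) (hW1 _)).trans (hCτ _)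
      have h0 : ∀ X : SpaceTime n, X.1 ∉ Ioo (-T₂) T₂ → τ X.1 * W X.2 = 0 := fun X hX => by
        have h1 : τ X.1 = 0 := image_eq_zero_of_notMem_tsupport fun h => by
          have := hT₂ h
          rw [Real.ball_eq_Ioo, zero_sub, zero_add] at this
          exact hX this
        rw [h1, zero_mul]
      have i1 : ∀ i, Integrable fun X => w i X * w i X * (τ X.1 * W X.2) := fun i =>
        (hw.memL2 i).integrable_mul_mul (hw.memL2 i) hm hC h0
      have i2 : ∀ i α, Integrable fun X => Dw i X α * Dw i X α * (τ X.1 * W X.2) := fun i α =>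
        ((hw.memL2_grad i).apply α).integrable_mul_mul ((hw.memL2_grad i).apply α) hm hC h0
      have i3 := ((integrable_finsetSum Finset.univ fun i _ => integrable_finsetSum Finset.univ
        fun α _ => i2 i α).const_mul (lam / 2)).add
        ((integrable_finsetSum Finset.univ fun i _ => i1 i).const_mul (1 / (2 * T)))
      refine i3.congr (Eventually.of_forall fun X => ?_)
      have h2 : ∀ i, ‖Dw i X‖ ^ 2 = ∑ α, Dw i X α * Dw i X α := fun i => by
        rw [EuclideanSpace.real_norm_sq_eq]; simp only [pow_two]
      simp only [Pi.add_apply, h2, ← Finset.sum_mul, pow_two (w _ X)]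
      ring
    calc e₀ * (lam / 2 * G + 1 / (2 * T) * P)
        = ∫ X in Q, e₀ * (lam / 2 * ∑ i, ‖Dw i X‖ ^ 2 + 1 / (2 * T) * ∑ i, w i X ^ 2) := by
          have j1 : Integrable (fun X => ∑ i, ‖Dw i X‖ ^ 2) (volume.restrict Q) :=
            integrable_finsetSum _ fun i _ => (hDwQ i).integrable_norm_pow (by norm_num)
          have j2 : Integrable (fun X => ∑ i, w i X ^ 2) (volume.restrict Q) :=
            integrable_finsetSum _ fun i _ => (hwQ i).integrable_sq
          rw [integral_const_mul, integral_add (j1.const_mul _) (j2.const_mul _),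
            integral_const_mul, integral_const_mul]
      _ ≤ ∫ X in Q, (lam / 2 * ∑ i, ‖Dw i X‖ ^ 2 + 1 / (2 * T) * ∑ i, w i X ^ 2)
            * (τ X.1 * W X.2) := by
          refine integral_mono_of_nonneg (Eventually.of_forall fun X =>
            mul_nonneg (by positivity) (hS0 X)) hI.restrict ?_
          filter_upwards [ae_restrict_mem hQm] with X hX
          rw [mul_comm]
          refine mul_le_mul_of_nonneg_left ?_ (hS0 X)
          have hx : ‖X.2 - X₀.2‖ ≤ r := (mem_ball_iff_norm.1 hX.2).le
          have ht1 : X₀.1 - r ^ 2 < X.1 := hX.1.1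
          have ht2 : X.1 < X₀.1 := hX.1.2
          refine mul_le_mul ((Real.exp_le_exp.2 ?_).trans (hτl X.1 (by linarith) ht2.le))
            (hWr _ hx) (Real.exp_pos _).le (hτ0 _)
          have : X.1 - a ≤ T := by linarith
          nlinarith
      _ ≤ _ := setIntegral_le_integral hI (Eventually.of_forall fun X =>
            mul_nonneg (hS0 X) (mul_nonneg (hτ0 _) (hW0 _)))
  have hall := hlhs.trans (hen.trans hrhs)
  set E := Real.exp (2 * ν * ϱ ^ 2 * T + 4 * ϱ * r - ϱ * d) with hE
  have hEE : Real.exp (-(ϱ * d)) = e₀ * (Real.exp 2 * E) := by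
    rw [he₀, hE, ← Real.exp_add, ← Real.exp_add, ← Real.exp_add]
    congr 1
    field_simp
    ring
  have he₀0 : 0 < e₀ := by positivity
  rw [hEE, mul_assoc e₀ (Real.exp 2 * E)] at hall
  have hall' : lam / 2 * G + 1 / (2 * T) * P ≤ Real.exp 2 * E * (T / 2 * SF + 2 / lam * SH) :=
    le_of_mul_le_mul_left hall he₀0
  have hS : T / 2 * SF + 2 / lam * SH ≤ (1 / 2 + 2 / lam) * (T * SF + SH) := by
    have : 0 ≤ 2 / lam * (T * SF) := by positivity
    have : 0 ≤ 1 / 2 * SH := by positivity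
    nlinarith
  have hE0 : 0 ≤ Real.exp 2 * E := by positivity
  set B := Real.exp 2 * E * ((1 / 2 + 2 / lam) * (T * SF + SH)) with hB
  have hall2 : lam / 2 * G + 1 / (2 * T) * P ≤ B :=
    hall'.trans (mul_le_mul_of_nonneg_left hS hE0)
  have hG : G ≤ 2 / lam * B := by
    have : 0 ≤ 1 / (2 * T) * P := by positivity
    rw [div_mul_eq_mul_div, le_div_iff₀ hlam]; linarith
  have hP : P ≤ 2 * T * B := by
    have h1 : 0 ≤ lam / 2 * G := by positivity
    have h2 : 1 / (2 * T) * P ≤ B := by linarith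
    rw [one_div, inv_mul_le_iff₀ (by positivity)] at h2
    exact h2
  have hB0 : 0 ≤ B := by positivity
  have hsol := hw.isWeakSolution hA hLam hb hT' hFQ hHQ
  refine (hbd Rc A hA hPH X₀ r hr hRc w Dw hsol hcont i).trans ?_
  have hPi : ∫ X in Q, w i X ^ 2 ≤ P := by
    refine integral_mono (hwQ i).integrable_sq
      (integrable_finsetSum _ fun i _ => (hwQ i).integrable_sq) fun X => ?_
    exact Finset.single_le_sum (f := fun i => w i X ^ 2) (fun _ _ => sq_nonneg _)
      (Finset.mem_univ i)
  -- Since `r² ≤ T`, the gradient term of the local bound can be given the same prefactor as the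
  -- other.
  have hrn : (r ^ n)⁻¹ ≤ T * (r ^ (n + 2))⁻¹ := by
    rw [pow_add, mul_inv, mul_left_comm]
    refine le_mul_of_one_le_right (by positivity) ?_
    rw [← div_eq_mul_inv, le_div_iff₀ (by positivity)]
    linarith
  have hr2 : 0 ≤ (r ^ (n + 2))⁻¹ := by positivity
  calc C₁ * ((r ^ (n + 2))⁻¹ * (∫ X in Q, w i X ^ 2) + (r ^ n)⁻¹ * G)
      ≤ C₁ * ((r ^ (n + 2))⁻¹ * (2 * T * B) + T * (r ^ (n + 2))⁻¹ * (2 / lam * B)) := by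
        gcongr
        exact hPi.trans hP
    _ = _ := by rw [hB]; ring

end

/-! ### Potentials of the fundamental matrix as solutions. -/

section
variable {n N : ℕ}

theorem IsTestFunction.sum {ι : Type*} (s : Finset ι) {U : Set (SpaceTime n)}
    {φ : ι → SpaceTime n → ℝ} (h : ∀ k ∈ s, IsTestFunction U (φ k)) :
    IsTestFunction U (fun X => ∑ k ∈ s, φ k X) := by
  classical
  induction s using Finset.induction_on with
  | empty => simp only [Finset.sum_empty]; exact IsTestFunction.zero
  | insert a s ha ih =>
    simp only [Finset.sum_insert ha]
    exact (h a (Finset.mem_insert_self _ _)).add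
      (ih fun k hk => h k (Finset.mem_insert_of_mem hk))

theorem IsTestFunction.pi_single {U : Set (SpaceTime n)} {φ : SpaceTime n → ℝ}
    (hφ : IsTestFunction U φ) (i j : Fin N) :
    IsTestFunction U ((Pi.single i φ : Fin N → SpaceTime n → ℝ) j) := by
  by_cases hj : j = i
  · subst hj; simpa using hφ
  · rw [Pi.single_eq_of_ne hj]; exact IsTestFunction.zero

theorem integral_spaceDeriv_mul {f g : SpaceTime n → ℝ} (hf : ContDiff ℝ ∞ f)
    (hg : IsTestFunction univ g) (α : Fin n) :
    ∫ X, spaceDeriv α f X * g X = -∫ X, f X * spaceDeriv α g X := by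
  have := integral_mul_fderiv_of_hasCompactSupport (μ := (volume : Measure (SpaceTime n)))
    hf hg.smooth hg.compact ((0, EuclideanSpace.single α 1) : SpaceTime n)
  simp only [spaceDeriv]
  rw [this, neg_neg]

theorem integral_timeDeriv_mul {f g : SpaceTime n → ℝ} (hf : ContDiff ℝ ∞ f)
    (hg : IsTestFunction univ g) :
    ∫ X, timeDeriv f X * g X = -∫ X, f X * timeDeriv g X := by
  have := integral_mul_fderiv_of_hasCompactSupport (μ := (volume : Measure (SpaceTime n)))
    hf hg.smooth hg.compact ((1, 0) : SpaceTime n)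
  simp only [timeDeriv]
  rw [this, neg_neg]

theorem memLp_toLp {h : Fin n → SpaceTime n → ℝ} (hh : ∀ α, MemLp (h α) 2 volume) :
    MemLp (fun X => (WithLp.toLp 2 fun α => h α X : Space n)) 2 volume := by
  rw [← Measure.restrict_univ (μ := (volume : Measure (SpaceTime n)))]
  exact memLp_of_apply fun α => by simpa using hh α

theorem memLp_spaceGrad {U : Set (SpaceTime n)} {φ : SpaceTime n → ℝ} (hφ : IsTestFunction U φ) :
    MemLp (spaceGrad φ) 2 volume :=
  memLp_toLp fun α => (hφ.spaceDeriv α).memLp 2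

theorem memLp_flux {A : Coeff n N} {lam Lam : ℝ} (hA : IsParabolic lam Lam A) (hLam : 0 < Lam)
    {Du : Fin N → SpaceTime n → Space n} (hDu : ∀ i, MemLp (Du i) 2 volume) (i : Fin N) :
    MemLp (flux A Du i) 2 volume := by
  rw [← Measure.restrict_univ (μ := (volume : Measure (SpaceTime n)))] at hDu ⊢
  exact memLp_of_apply fun α => MemLp.flux_apply hA hLam hDu i α

/-- A smooth vector of test functions solves the system with the obvious sources. -/
theorem globalSol_test {A : Coeff n N} {lam Lam : ℝ} (hA : IsParabolic lam Lam A) (hLam : 0 < Lam)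
    {φ : Fin N → SpaceTime n → ℝ} (hφ : ∀ i, IsTestFunction univ (φ i)) :
    GlobalSol A (fun i => timeDeriv (φ i)) (flux A fun i => spaceGrad (φ i)) φ
      (fun i => spaceGrad (φ i)) where
  source i := MemLp.slabL2 ((hφ i).timeDeriv.memLp 2)
  source_flux i := MemLp.slabL2 (memLp_flux hA hLam (fun i => memLp_spaceGrad (hφ i)) i)
  memL2 i := MemLp.slabL2 ((hφ i).memLp 2)
  memL2_grad i := MemLp.slabL2 (memLp_spaceGrad (hφ i))
  weakGrad i ψ hψ α := by
    rw [setIntegral_univ, setIntegral_univ]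
    simp only [spaceGrad]
    rw [integral_spaceDeriv_mul (hφ i).smooth hψ, neg_neg]
  eqn i ψ hψ := by rw [integral_timeDeriv_mul (hφ i).smooth hψ]

section Fundamental

variable {A : Coeff n N} {Γ : SpaceTime n → SpaceTime n → Matrix (Fin N) (Fin N) ℝ}

theorem IsFundamentalMatrix.globalSol (hΓ : IsFundamentalMatrix A Γ) {lam Lam : ℝ}
    (hA : IsParabolic lam Lam A) (hLam : 0 < Lam)
    {f : Fin N → SpaceTime n → ℝ} (hf : ∀ i, IsTestFunction univ (f i)) :
    ∃ Du : Fin N → SpaceTime n → Space n, GlobalSol A f (fun _ _ => 0) (potential Γ f) Du ∧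
      ∀ i, BddSlices (potential Γ f i) := by
  obtain ⟨Du, h1, h2⟩ := hΓ.solves f hf
  have hL2 : ∀ i, SlabL2 (potential Γ f i) := fun i T => by
    rcases le_or_gt T 0 with hT | hT
    · rw [Ioo_eq_empty (by linarith), empty_prod, Measure.restrict_empty]
      exact MemLp.zero.ae_eq (by simp [Filter.EventuallyEq])
    · simpa using (h2.memV2 i).memLp T hT
  have hDL2 : ∀ i, SlabL2 (Du i) := fun i => by
    have := (h2.memV2 i).memLp_grad
    rw [univ_prod_univ, Measure.restrict_univ] at this
    exact MemLp.slabL2 this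
  refine ⟨Du, ⟨fun i => MemLp.slabL2 ((hf i).memLp 2), fun i => MemLp.slabL2 MemLp.zero, hL2,
    hDL2, fun i => ?_, fun i φ hφ => ?_⟩, fun i => (h2.memV2 i).bddSlices⟩
  · have := (h2.memV2 i).weakGrad
    rwa [univ_prod_univ] at this
  · have h := h2.eqn (Pi.single i φ) (fun j => by
      rw [univ_prod_univ]; exact hφ.pi_single i j)
    have e1 : ∀ (g : Fin N → SpaceTime n → ℝ) X,
        ∑ j, g j X * timeDeriv ((Pi.single i φ : Fin N → SpaceTime n → ℝ) j) X
        = g i X * timeDeriv φ X := fun g X => by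
      rw [Finset.sum_eq_single i]
      · simp
      · intro j _ hj; rw [Pi.single_eq_of_ne hj, timeDeriv_zero, mul_zero]
      · simp
    have e2 : ∀ (g : Fin N → SpaceTime n → ℝ) X,
        ∑ j, g j X * ((Pi.single i φ : Fin N → SpaceTime n → ℝ) j) X
        = g i X * φ X := fun g X => by
      rw [Finset.sum_eq_single i]
      · simp
      · intro j _ hj; simp [Pi.single_eq_of_ne hj]
      · simp
    have e3 : ∀ X, ellipticForm A Du (Pi.single i φ) X
        = ∑ α, flux A Du i X α * spaceDeriv α φ X := fun X => by
      rw [ellipticForm_eq, Finset.sum_eq_single i]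
      · simp
      · intro j _ hj; simp [Pi.single_eq_of_ne hj, spaceDeriv_zero]
      · simp
    simp only [e1, e2, e3, univ_prod_univ, setIntegral_univ] at h
    rw [integral_finsetSum _ fun α _ => (((SlabL2.flux hA hLam hDL2 i).apply α).integrable_mul
      (hφ.spaceDeriv α))] at h
    simpa using h

/-- Sources in divergence form. -/
theorem GlobalSol.of_divergence {F w : Fin N → SpaceTime n → ℝ}
    {Dw : Fin N → SpaceTime n → Space n} {h : Fin N → Fin n → SpaceTime n → ℝ}
    (hF : ∀ i, SlabL2 (F i)) (hh : ∀ i α, IsTestFunction univ (h i α))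
    (hw : GlobalSol A (fun i X => F i X - ∑ α, spaceDeriv α (h i α) X) (fun _ _ => 0) w Dw) :
    GlobalSol A F (fun i X => WithLp.toLp 2 fun α => h i α X) w Dw where
  source := hF
  source_flux i := MemLp.slabL2 (memLp_toLp fun α => (hh i α).memLp 2)
  memL2 := hw.memL2
  memL2_grad := hw.memL2_grad
  weakGrad := hw.weakGrad
  eqn i φ hφ := by
    have hi : ∀ α, Integrable fun X => spaceDeriv α (h i α) X * φ X := fun α =>
      (MemLp.slabL2 (((hh i α).spaceDeriv α).memLp 2)).integrable_mul hφ
    rw [hw.eqn i φ hφ]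
    simp only [sub_mul, Finset.sum_mul, PiLp.zero_apply, zero_mul, integral_zero,
      Finset.sum_const_zero, add_zero]
    rw [integral_sub ((hF i).integrable_mul hφ) (integrable_finsetSum _ fun α _ => hi α),
      integral_finsetSum _ fun α _ => hi α, sub_eq_add_neg, ← Finset.sum_neg_distrib]
    congr 1
    refine Finset.sum_congr rfl fun α _ => ?_
    rw [integral_spaceDeriv_mul (hh i α).smooth hφ, neg_neg]

/-- Causality of `Γ`: this is the zero initial condition that the weighted energy estimate asks for.
-/
theorem IsFundamentalMatrix.potential_eq_zero (hΓ : IsFundamentalMatrix A Γ)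
    {f : Fin N → SpaceTime n → ℝ} {a : ℝ} (hf : ∀ k X, X.1 < a → f k X = 0) (i : Fin N)
    {X : SpaceTime n} (hX : X.1 < a) : potential Γ f i X = 0 := by
  have : ∀ Y, ∑ k, Γ X Y i k * f k Y = 0 := fun Y => by
    refine Finset.sum_eq_zero fun k _ => ?_
    rcases lt_or_ge X.1 Y.1 with h | h
    · rw [hΓ.causal X Y h]; simp
    · rw [hf k Y (h.trans_lt hX), mul_zero]
  simp [potential, this]

theorem IsFundamentalMatrix.continuousAt (hΓ : IsFundamentalMatrix A Γ) {X Y : SpaceTime n}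
    (h : X ≠ Y) (i k : Fin N) :
    ContinuousAt (fun p : SpaceTime n × SpaceTime n => Γ p.1 p.2 i k) (X, Y) := by
  have h1 : ContinuousAt (fun p : SpaceTime n × SpaceTime n => Γ p.1 p.2) (X, Y) :=
    hΓ.continuousOn.continuousAt ((isOpen_ne_fun continuous_fst continuous_snd).mem_nhds h)
  exact ((continuous_apply k).continuousAt.comp
    ((continuous_apply i).continuousAt.comp h1 :) :)

/-- Off the support of `f` the kernel is jointly continuous on the relevant pairs, and the integral
is over a compact set. Local boundedness concerns values at points, so this continuity is needed to
apply it to a potential. -/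
theorem IsFundamentalMatrix.continuousAt_potential (hΓ : IsFundamentalMatrix A Γ)
    {f : Fin N → SpaceTime n → ℝ} (hf : ∀ k, IsTestFunction univ (f k)) {X : SpaceTime n}
    (hX : ∀ k, X ∉ tsupport (f k)) (i : Fin N) : ContinuousAt (potential Γ f i) X := by
  set K : Set (SpaceTime n) := ⋃ k, tsupport (f k) with hKdef
  have hK : IsCompact K := isCompact_iUnion fun k => (hf k).compact
  have hXK : X ∈ Kᶜ := by simpa [hKdef] using hX
  have h0 : ∀ Y ∉ K, ∀ k, f k Y = 0 := fun Y hY k =>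
    image_eq_zero_of_notMem_tsupport fun h => hY (mem_iUnion.2 ⟨k, h⟩)
  refine ContinuousOn.continuousAt (s := Kᶜ) ?_ (hK.isClosed.isOpen_compl.mem_nhds hXK)
  refine continuousOn_integral_of_compact_support (f := fun X Y => ∑ k, Γ X Y i k * f k Y) hK ?_ ?_
  · rintro ⟨X, Y⟩ ⟨hX, -⟩
    refine ContinuousAt.continuousWithinAt ?_
    by_cases hY : Y ∈ K
    · have hne : X ≠ Y := fun h => hX (h ▸ hY)
      refine tendsto_finsetSum _ fun k _ => ?_
      exact (hΓ.continuousAt hne i k).mul ((hf k).continuous.continuousAt.comp continuousAt_snd)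
    · have : (Function.uncurry fun X Y => ∑ k, Γ X Y i k * f k Y) =ᶠ[𝓝 (X, Y)] fun _ => 0 := by
        have hn : Prod.snd ⁻¹' Kᶜ ∈ 𝓝 (X, Y) :=
          continuousAt_snd.preimage_mem_nhds (hK.isClosed.isOpen_compl.mem_nhds hY)
        filter_upwards [hn] with p hp
        simp [Function.uncurry, h0 p.2 hp]
      exact this.continuousAt
  · intro X Y _ hY
    simp [h0 Y hY]

theorem IsFundamentalMatrix.integrable_mul (hΓ : IsFundamentalMatrix A Γ) (X : SpaceTime n)
    (i k : Fin N) {f : SpaceTime n → ℝ} (hf : IsTestFunction univ f) :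
    Integrable fun Y => Γ X Y i k * f Y := by
  simpa [mul_comm] using (hΓ.locallyIntegrable X i k).integrable_smul_left_of_hasCompactSupport
    hf.continuous hf.compact

theorem IsFundamentalMatrix.potential_eq_sum (hΓ : IsFundamentalMatrix A Γ)
    {f : Fin N → SpaceTime n → ℝ} (hf : ∀ k, IsTestFunction univ (f k)) (i : Fin N)
    (X : SpaceTime n) : potential Γ f i X = ∑ k, ∫ Y, Γ X Y i k * f k Y := by
  rw [potential, integral_finsetSum _ fun k _ => hΓ.integrable_mul X i k (hf k)]

end Fundamental

end

/-! ### Density of test functions and Riesz representation. -/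

section
variable {n N : ℕ}

/-- Square integrable functions that are fixed by a smooth cutoff are limits of test functions. -/
theorem exists_tendsto_testFunction {U : Set (SpaceTime n)} {χ H : SpaceTime n → ℝ}
    (hχ : ContDiff ℝ ∞ χ) (hχ1 : ∀ X, |χ X| ≤ 1) (hχU : tsupport χ ⊆ U) (hH : MemLp H 2 volume)
    (hχH : ∀ X, χ X * H X = H X) :
    ∃ h : ℕ → SpaceTime n → ℝ, (∀ j, IsTestFunction U (h j)) ∧
      Tendsto (fun j => eLpNorm (h j - H) 2 volume) atTop (𝓝 0) := by
  have hε : ∀ j : ℕ, (0 : ℝ) < 1 / (j + 1) := fun j => by positivity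
  choose g hgc hg hgH using fun j => hH.exist_eLpNorm_sub_le (by simp) one_le_two (hε j)
  refine ⟨fun j X => χ X * g j X, fun j => ⟨hχ.mul (hg j), (hgc j).mul_left,
    (tsupport_mul_subset_left).trans hχU⟩, ?_⟩
  have hlim : Tendsto (fun j : ℕ => ENNReal.ofReal (1 / ((j : ℝ) + 1))) atTop (𝓝 0) := by
    simpa using (ENNReal.tendsto_ofReal tendsto_one_div_add_atTop_nhds_zero_nat)
  refine tendsto_of_tendsto_of_tendsto_of_le_of_le tendsto_const_nhds hlim (fun _ => zero_le)
    fun j => (eLpNorm_mono fun X => ?_).trans (hgH j)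
  simp only [Pi.sub_apply]
  rw [← norm_neg (H X - g j X), neg_sub]
  nth_rw 1 [← hχH X]
  rw [← mul_sub, norm_mul]
  exact mul_le_of_le_one_left (norm_nonneg _) (hχ1 X)

theorem exists_tendsto_testFunction_of_isCompact {U K : Set (SpaceTime n)} (hU : IsOpen U)
    (hK : IsCompact K) (hKU : K ⊆ U) {H : SpaceTime n → ℝ} (hH : MemLp H 2 volume)
    (hHK : ∀ X ∉ K, H X = 0) :
    ∃ h : ℕ → SpaceTime n → ℝ, (∀ j, IsTestFunction U (h j)) ∧
      Tendsto (fun j => eLpNorm (h j - H) 2 volume) atTop (𝓝 0) := by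
  obtain ⟨V, hV, hKV, hVU⟩ := exists_open_between_and_isCompact_closure hK hU hKU
  obtain ⟨χ, hχ, hχr, hχs, hχK⟩ := exists_contMDiff_support_eq_eq_one_iff
    (modelWithCornersSelf ℝ (SpaceTime n)) hV hK.isClosed hKV
  refine exists_tendsto_testFunction (hχ.contDiff.of_le le_rfl) (fun X => ?_) ?_ hH fun X => ?_
  · have := hχr ⟨X, rfl⟩
    rw [abs_of_nonneg this.1]; exact this.2
  · rw [tsupport, hχs]; exact hVU.1
  · by_cases hX : X ∈ K
    · rw [(hχK X).1 hX, one_mul]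
    · rw [hHK X hX, mul_zero]

section Riesz

variable {E : Type*} [MeasurableSpace E] {μ : Measure E}

theorem integral_sq_eq_norm_toLp {f : E → ℝ} (hf : MemLp f 2 μ) :
    ∫ x, f x ^ 2 ∂μ = ‖hf.toLp‖ ^ 2 := by
  rw [← real_inner_self_eq_norm_sq, L2.inner_def]
  refine integral_congr_ae ?_
  filter_upwards [hf.coeFn_toLp] with x hx
  rw [hx]; simp [pow_two]

/-- Riesz representation on a space of square integrable functions. -/
theorem exists_riesz (V : Submodule ℝ (E → ℝ)) (hV : ∀ f ∈ V, MemLp f 2 μ) (L : V →ₗ[ℝ] ℝ)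
    {K : ℝ} (hK : 0 ≤ K) (hL : ∀ f : V, L f ^ 2 ≤ K * ∫ x, (f : E → ℝ) x ^ 2 ∂μ) :
    ∃ g : E → ℝ, MemLp g 2 μ ∧ ∫ x, g x ^ 2 ∂μ ≤ K ∧
      ∀ f : V, L f = ∫ x, g x * (f : E → ℝ) x ∂μ := by
  let ι : V →ₗ[ℝ] Lp ℝ 2 μ :=
    { toFun := fun f => (hV f f.2).toLp
      map_add' := fun f g => rfl
      map_smul' := fun c f => rfl }
  have hbd : ∀ f : V, ‖L f‖ ≤ √K * ‖ι f‖ := fun f => by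
    refine abs_le_of_sq_le_sq ?_ (by positivity)
    rw [mul_pow, Real.sq_sqrt hK]
    exact (hL f).trans_eq (congrArg _ (integral_sq_eq_norm_toLp (hV f f.2)))
  -- The space `V` consists of functions, not of classes. The bound forces `L` to vanish on
  -- functions that are zero almost everywhere, so `L` descends to the image in `L²`; Hahn–Banach
  -- extends it there, and Riesz represents it.
  have hker : LinearMap.ker ι ≤ LinearMap.ker L := fun f hf => by
    have h := hbd f
    rw [LinearMap.mem_ker.1 hf, norm_zero, mul_zero] at h
    exact LinearMap.mem_ker.2 (norm_le_zero_iff.1 h)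
  let L' : LinearMap.range ι →ₗ[ℝ] ℝ :=
    ((LinearMap.ker ι).liftQ L hker).comp ι.quotKerEquivRange.symm.toLinearMap
  have hL' : ∀ f : V, L' ⟨ι f, LinearMap.mem_range_self ι f⟩ = L f := fun f => by
    have : ι.quotKerEquivRange.symm ⟨ι f, LinearMap.mem_range_self ι f⟩
        = (LinearMap.ker ι).mkQ f := by
      rw [LinearEquiv.symm_apply_eq]; rfl
    simp only [L', LinearMap.comp_apply, LinearEquiv.coe_coe, this, Submodule.mkQ_apply,
      Submodule.liftQ_apply]
  let L'' : StrongDual ℝ (LinearMap.range ι) := L'.mkContinuous (√K) (by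
    rintro ⟨_, f, rfl⟩
    rw [hL' f]; exact hbd f)
  obtain ⟨Φ, hΦ, hΦn⟩ := _root_.exists_extension_norm_eq _ L''
  let g : Lp ℝ 2 μ := (InnerProductSpace.toDual ℝ (Lp ℝ 2 μ)).symm Φ
  refine ⟨g, Lp.memLp g, ?_, fun f => ?_⟩
  · rw [integral_sq_eq_norm_toLp (Lp.memLp g), Lp.toLp_coeFn, LinearIsometryEquiv.norm_map, hΦn]
    calc ‖L''‖ ^ 2 ≤ √K ^ 2 := by
          gcongr; exact LinearMap.mkContinuous_norm_le _ (Real.sqrt_nonneg _) _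
      _ = K := Real.sq_sqrt hK
  · have h1 : Φ (ι f) = L f := by
      rw [hΦ ⟨ι f, LinearMap.mem_range_self ι f⟩, ← hL' f]; rfl
    have h2 : inner ℝ g (ι f) = Φ (ι f) := InnerProductSpace.toDual_symm_apply
    rw [← h1, ← h2, L2.inner_def]
    refine integral_congr_ae ?_
    filter_upwards [(hV f f.2).coeFn_toLp] with x hx
    have : (ι f) x = (f : E → ℝ) x := hx
    rw [this]; simp [mul_comm]

end Riesz

/-- The space of test functions. -/
def testSubmodule (U : Set (SpaceTime n)) : Submodule ℝ (SpaceTime n → ℝ) where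
  carrier := {φ | IsTestFunction U φ}
  add_mem' h h' := h.add h'
  zero_mem' := IsTestFunction.zero
  smul_mem' c _ h := h.const_mul c

/-- A functional on test functions that is bounded in the `L²`-norm. -/
theorem exists_riesz_test {U : Set (SpaceTime n)} {L : (SpaceTime n → ℝ) → ℝ}
    (hadd : ∀ φ ψ, IsTestFunction U φ → IsTestFunction U ψ →
      L (fun X => φ X + ψ X) = L φ + L ψ)
    (hsmul : ∀ (c : ℝ) φ, IsTestFunction U φ → L (fun X => c * φ X) = c * L φ)
    {K : ℝ} (hK : 0 ≤ K)
    (hL : ∀ φ, IsTestFunction U φ → L φ ^ 2 ≤ K * ∫ X, φ X ^ 2) :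
    ∃ g : SpaceTime n → ℝ, MemLp g 2 volume ∧ ∫ X, g X ^ 2 ≤ K ∧
      ∀ φ, IsTestFunction U φ → L φ = ∫ X, g X * φ X := by
  obtain ⟨g, hg, hgK, hgL⟩ := exists_riesz (μ := volume) (testSubmodule U)
    (fun f hf => IsTestFunction.memLp hf 2)
    { toFun := fun f => L f
      map_add' := fun f g => hadd f g f.2 g.2
      map_smul' := fun c f => hsmul c f f.2 } hK (fun f => hL f f.2)
  exact ⟨g, hg, hgK, fun φ hφ => hgL ⟨φ, hφ⟩⟩

end

/-! ### The kernel bound by duality. -/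

section
variable {n N : ℕ}

section Fundamental

variable {A : Coeff n N} {Γ : SpaceTime n → SpaceTime n → Matrix (Fin N) (Fin N) ℝ}

theorem IsFundamentalMatrix.continuousAt_right (hΓ : IsFundamentalMatrix A Γ) {X Y : SpaceTime n}
    (h : X ≠ Y) (i k : Fin N) : ContinuousAt (fun Y => Γ X Y i k) Y :=
  ContinuousAt.comp (f := fun Y => (X, Y)) (g := fun p : SpaceTime n × SpaceTime n =>
    Γ p.1 p.2 i k) (hΓ.continuousAt h i k) (by fun_prop)

theorem IsFundamentalMatrix.continuousAt_left (hΓ : IsFundamentalMatrix A Γ) {X Y : SpaceTime n}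
    (h : X ≠ Y) (i k : Fin N) : ContinuousAt (fun X => Γ X Y i k) X :=
  ContinuousAt.comp (f := fun X => (X, Y)) (g := fun p : SpaceTime n × SpaceTime n =>
    Γ p.1 p.2 i k) (hΓ.continuousAt h i k) (by fun_prop)

/-- Sources of the form `F + φ_t - div h` are used because subtracting `φ` from their potential
leaves a solution with source `F` and flux source `h - A Dφ`. Read from the other side, the
potential is the pairing of a row of `Γ` with these three sources, so bounds for solutions become
bounds for the row. -/
theorem IsFundamentalMatrix.potential_source (hΓ : IsFundamentalMatrix A Γ)
    {F φ : Fin N → SpaceTime n → ℝ} {h : Fin N → Fin n → SpaceTime n → ℝ}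
    (hF : ∀ k, IsTestFunction univ (F k)) (hφ : ∀ k, IsTestFunction univ (φ k))
    (hh : ∀ k α, IsTestFunction univ (h k α)) (i : Fin N) (X : SpaceTime n) :
    potential Γ (fun k Y => F k Y + timeDeriv (φ k) Y - ∑ α, spaceDeriv α (h k α) Y) i X
      = ∑ k, ((∫ Y, Γ X Y i k * F k Y) + (∫ Y, Γ X Y i k * timeDeriv (φ k) Y)
        - ∑ α, ∫ Y, Γ X Y i k * spaceDeriv α (h k α) Y) := by
  rw [hΓ.potential_eq_sum (fun k => ((hF k).add (hφ k).timeDeriv).sub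
    (IsTestFunction.sum _ fun α _ => (hh k α).spaceDeriv α))]
  refine Finset.sum_congr rfl fun k _ => ?_
  have h1 := hΓ.integrable_mul X i k (hF k)
  have h2 := hΓ.integrable_mul X i k (hφ k).timeDeriv
  have h3 := fun α => hΓ.integrable_mul X i k ((hh k α).spaceDeriv α)
  have h12 : Integrable fun Y => Γ X Y i k * F k Y + Γ X Y i k * timeDeriv (φ k) Y := h1.add h2
  simp only [mul_sub, mul_add, Finset.mul_sum]
  rw [integral_sub h12 (integrable_finsetSum _ fun α _ => h3 α), integral_add h1 h2,
    integral_finsetSum _ fun α _ => h3 α]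

end Fundamental

/-- Pointwise decay of the difference of a potential and a test function. -/
theorem exists_potential_decay (n N : ℕ) {lam Lam : ℝ} (hlam : 0 < lam) (hLam : 0 < Lam)
    {μ₀ C₀ : ℝ} (hμ : 0 < μ₀) (hC₀ : 0 < C₀) :
    ∃ C : ℝ, 0 < C ∧ ∀ (Rc : ℝ≥0∞) (A : Coeff n N), IsParabolic lam Lam A →
      PropertyPH A μ₀ Rc C₀ → ∀ Γ : SpaceTime n → SpaceTime n → Matrix (Fin N) (Fin N) ℝ,
      IsFundamentalMatrix A Γ →
      ∀ (X₀ : SpaceTime n) (r : ℝ), 0 < r → ENNReal.ofReal r < Rc →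
      ∀ (T a d ϱ : ℝ), a ≤ X₀.1 - r ^ 2 → X₀.1 - a ≤ T → 0 ≤ d → 0 ≤ ϱ →
      ∀ (F φ : Fin N → SpaceTime n → ℝ) (h : Fin N → Fin n → SpaceTime n → ℝ),
      (∀ k, IsTestFunction {X | a ≤ X.1} (F k)) → (∀ k, IsTestFunction {X | a ≤ X.1} (φ k)) →
      (∀ k α, IsTestFunction {X | a ≤ X.1} (h k α)) →
      (∀ k, ∀ X ∈ backwardCyl X₀ r, F k X = 0) →
      (∀ k, ∀ X ∈ backwardCyl X₀ r,
        (WithLp.toLp 2 fun α => h k α X) - flux A (fun i => spaceGrad (φ i)) k X = 0) →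
      (∀ k X, ‖X.2 - X₀.2‖ < d → F k X = 0) →
      (∀ k X, ‖X.2 - X₀.2‖ < d →
        (WithLp.toLp 2 fun α => h k α X) - flux A (fun i => spaceGrad (φ i)) k X = 0) →
      (∀ k, X₀ ∉ tsupport fun Y => F k Y + timeDeriv (φ k) Y - ∑ α, spaceDeriv α (h k α) Y) →
      ∀ i, (potential Γ (fun k Y => F k Y + timeDeriv (φ k) Y - ∑ α, spaceDeriv α (h k α) Y) i X₀
          - φ i X₀) ^ 2
        ≤ C * ((r ^ (n + 2))⁻¹ * T
        * Real.exp (2 * energyRate lam Lam * ϱ ^ 2 * T + 4 * ϱ * r - ϱ * d)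
        * (T * (∫ X, ∑ k, F k X ^ 2) + ∫ X, ∑ k,
          ‖(WithLp.toLp 2 fun α => h k α X) - flux A (fun i => spaceGrad (φ i)) k X‖ ^ 2)) := by
  obtain ⟨C, hC, hdecay⟩ := exists_pointwise_decay n N hlam hLam hμ hC₀
  refine ⟨C, hC, ?_⟩
  intro Rc A hA hPH Γ hΓ X₀ r hr hRc T a d ϱ har haT hd hϱ F φ h hF hφ hh hFQ hHQ hFd hHd hX₀ i
  have hsrc : ∀ k, IsTestFunction {X : SpaceTime n | a ≤ X.1}
      (fun Y => F k Y + timeDeriv (φ k) Y - ∑ α, spaceDeriv α (h k α) Y) := fun k =>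
    ((hF k).add (hφ k).timeDeriv).sub (IsTestFunction.sum _ fun α _ => (hh k α).spaceDeriv α)
  obtain ⟨Du, hsol, hbd⟩ := hΓ.globalSol hA hLam fun k => (hsrc k).to_univ
  -- The potential has source `F + φ_t` and divergence source `h`; subtracting the smooth function
  -- `φ` cancels `φ_t` and replaces `h` by `h - A Dφ`.
  have hsol' := (GlobalSol.of_divergence (F := fun k Y => F k Y + timeDeriv (φ k) Y)
    (fun k => MemLp.slabL2 (((hF k).add (hφ k).timeDeriv).memLp 2))
    (fun k α => (hh k α).to_univ) hsol).sub hA hLam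
      (globalSol_test hA hLam fun k => (hφ k).to_univ)
  simp only [add_sub_cancel_right] at hsol'
  have hz : ∀ {ψ : SpaceTime n → ℝ}, IsTestFunction {X : SpaceTime n | a ≤ X.1} ψ →
      ∀ X : SpaceTime n, X.1 < a → ψ X = 0 := fun hψ X hX =>
    hψ.eq_zero (by simpa using hX)
  have hflux0 : ∀ k (X : SpaceTime n), X.1 < a →
      (WithLp.toLp 2 fun α => h k α X) - flux A (fun i => spaceGrad (φ i)) k X = 0 := by
    intro k X hX
    ext α
    rw [PiLp.sub_apply, flux_apply]
    simp [spaceGrad, hz (hh k _) X hX, hz ((hφ _).spaceDeriv _) X hX]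
  refine hdecay Rc A hA hPH X₀ r hr hRc T a d ϱ har haT hd hϱ _ _ _ _ hsol'
    (fun k => ?_) (fun k => (hF k).memLp 2) (fun k => ?_) (fun k X hX => ?_)
    (fun k X hX => hz (hF k) X hX) hflux0 hFQ hHQ hFd hHd (fun k => ?_) i
  · exact (hbd k).sub (hφ k).bddSlices (hsol.memL2 k).locL2.aestronglyMeasurable
      (hφ k).continuous.aestronglyMeasurable
  · exact (memLp_toLp fun α => (hh k α).memLp 2).sub
      (memLp_flux hA hLam (fun i => memLp_spaceGrad (hφ i)) k)
  · rw [hΓ.potential_eq_zero (fun k Y hY => hz (hsrc k) Y hY) k hX, hz (hφ k) X hX, sub_zero]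
  · exact (hΓ.continuousAt_potential (fun k => (hsrc k).to_univ) hX₀ k).sub
      (hφ k).continuous.continuousAt

theorem integral_sq_eq_eLpNorm {E : Type*} [MeasurableSpace E] {μ : Measure E} {f : E → ℝ}
    (hf : MemLp f 2 μ) : ∫ x, f x ^ 2 ∂μ = (eLpNorm f 2 μ).toReal ^ 2 := by
  rw [integral_sq_eq_norm_toLp hf, Lp.norm_toLp]

theorem tendsto_integral_sq_sub {E : Type*} [MeasurableSpace E] {μ : Measure E} {f : ℕ → E → ℝ}
    {g : E → ℝ} (hf : ∀ j, MemLp (f j) 2 μ) (hg : MemLp g 2 μ)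
    (h : Tendsto (fun j => eLpNorm (f j - g) 2 μ) atTop (𝓝 0)) :
    Tendsto (fun j => ∫ x, (f j x - g x) ^ 2 ∂μ) atTop (𝓝 0) := by
  have h1 := ((ENNReal.tendsto_toReal ENNReal.zero_ne_top).comp h).pow 2
  simp only [ENNReal.toReal_zero, ne_eq, OfNat.ofNat_ne_zero, not_false_eq_true, zero_pow] at h1
  refine h1.congr fun j => ?_
  exact (integral_sq_eq_eLpNorm ((hf j).sub hg)).symm

/-- Transposition moves the coefficients from `Dv` onto the gradient of the test function. This is
the form in which the transposed equation will be verified. -/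
theorem ellipticForm_transpose (A : Coeff n N) (Dv : Fin N → SpaceTime n → Space n)
    (φ : Fin N → SpaceTime n → ℝ) (X : SpaceTime n) :
    ellipticForm (transposeCoeff A) Dv φ X
      = ∑ k, ∑ α, Dv k X α * flux A (fun i => spaceGrad (φ i)) k X α := by
  simp only [ellipticForm, transposeCoeff, flux_apply, spaceGrad, Finset.mul_sum]
  rw [Finset.sum_comm]
  refine Finset.sum_congr rfl fun k _ => ?_
  rw [Finset.sum_congr rfl fun i _ => Finset.sum_comm, Finset.sum_comm]
  refine Finset.sum_congr rfl fun β _ => Finset.sum_congr rfl fun i _ =>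
    Finset.sum_congr rfl fun α _ => by ring

/-- Pointwise bound of the fundamental matrix, by duality. -/
theorem exists_kernel_bound (n N : ℕ) {lam Lam : ℝ} (hlam : 0 < lam) (hLam : 0 < Lam)
    {μ₀ C₀ : ℝ} (hμ : 0 < μ₀) (hC₀ : 0 < C₀) :
    ∃ C : ℝ, 0 < C ∧ ∀ (Rc : ℝ≥0∞) (A : Coeff n N), IsParabolic lam Lam A →
      PropertyPH A μ₀ Rc C₀ → AdjointPropertyPH A μ₀ Rc C₀ →
      ∀ Γ : SpaceTime n → SpaceTime n → Matrix (Fin N) (Fin N) ℝ, IsFundamentalMatrix A Γ →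
      ∀ (X₀ Y₀ : SpaceTime n) (r T d ϱ : ℝ), 0 < r → ENNReal.ofReal r < Rc →
      X₀.1 - Y₀.1 = T → 2 * r ^ 2 < T → 0 ≤ d → 0 ≤ ϱ →
      (∀ X ∈ forwardCyl Y₀ r, d ≤ ‖X.2 - X₀.2‖) →
      ∀ i k, Γ X₀ Y₀ i k ^ 2 ≤ C * (((r ^ (n + 2))⁻¹ * T) ^ 2
        * Real.exp (2 * energyRate lam Lam * ϱ ^ 2 * T + 4 * ϱ * r - ϱ * d)) := by
  obtain ⟨C₁, hC₁, hpot⟩ := exists_potential_decay n N hlam hLam hμ hC₀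
  obtain ⟨C₂, hC₂, hadj⟩ := exists_adjoint_bound n N (lam := lam) hLam hμ hC₀
  -- The summand `1` accounts for a component of the row, and `N * n` for the entries of the
  -- gradient of the row.
  refine ⟨C₂ * (C₁ * (1 + N * n)), by positivity, ?_⟩
  intro Rc A hA hPH hPH' Γ hΓ X₀ Y₀ r T d ϱ hr hRc hT hrT hd hϱ hdist i k₀
  have hT0 : 0 < T := lt_of_le_of_lt (by positivity) hrT
  set Q := forwardCyl Y₀ r with hQ
  set E := Real.exp (2 * energyRate lam Lam * ϱ ^ 2 * T + 4 * ϱ * r - ϱ * d)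
  set B := (r ^ (n + 2))⁻¹ * T * E with hB
  have hB0 : 0 < B := by positivity
  have hQo : IsOpen Q := isOpen_Ioo.prod Metric.isOpen_ball
  have hQm : MeasurableSet Q := hQo.measurableSet
  have hQa : Q ⊆ {X | Y₀.1 ≤ X.1} := fun X hX => hX.1.1.le
  have hr2 : 0 < r ^ 2 := by positivity
  -- The condition `2r² < T` separates the forward cylinder at `Y₀` in time from the backward
  -- cylinder at `X₀`, where the potentials must solve the homogeneous equation.
  have hQt : ∀ X ∈ Q, X.1 < X₀.1 - r ^ 2 := fun X hX => by
    have : X.1 < Y₀.1 + r ^ 2 := hX.1.2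
    linarith
  have hX₀Q : X₀ ∉ Q := fun h => by linarith [hQt _ h]
  have hQQ : ∀ X ∈ backwardCyl X₀ r, X ∉ Q := fun X hX h => by
    have : X₀.1 - r ^ 2 < X.1 := hX.1.1
    linarith [hQt _ h]
  have hQd : ∀ X : SpaceTime n, ‖X.2 - X₀.2‖ < d → X ∉ Q := fun X hX h => by
    linarith [hdist X h]
  have har : Y₀.1 ≤ X₀.1 - r ^ 2 := by linarith
  have haT : X₀.1 - Y₀.1 ≤ T := hT.le
  set v : Fin N → SpaceTime n → ℝ := fun k Y => Γ X₀ Y i k with hv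
  -- the basic estimate for sources in the cylinder
  have key : ∀ (d' ϱ' : ℝ) (F φ : Fin N → SpaceTime n → ℝ) (h : Fin N → Fin n → SpaceTime n → ℝ),
      0 ≤ d' → 0 ≤ ϱ' → (∀ X : SpaceTime n, ‖X.2 - X₀.2‖ < d' → X ∉ Q) →
      (∀ k, IsTestFunction Q (F k)) → (∀ k, IsTestFunction Q (φ k)) →
      (∀ k α, IsTestFunction Q (h k α)) →
      (∑ k, ((∫ Y, v k Y * F k Y) + (∫ Y, v k Y * timeDeriv (φ k) Y)
        - ∑ α, ∫ Y, v k Y * spaceDeriv α (h k α) Y)) ^ 2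
      ≤ C₁ * ((r ^ (n + 2))⁻¹ * T
        * Real.exp (2 * energyRate lam Lam * ϱ' ^ 2 * T + 4 * ϱ' * r - ϱ' * d')
        * (T * (∫ X, ∑ k, F k X ^ 2) + ∫ X, ∑ k,
          ‖(WithLp.toLp 2 fun α => h k α X) - flux A (fun i => spaceGrad (φ i)) k X‖ ^ 2)) := by
    intro d' ϱ' F φ h hd' hϱ' hQd' hF hφ hh
    have hflux0 : ∀ k, ∀ X ∉ Q,
        (WithLp.toLp 2 fun α => h k α X) - flux A (fun i => spaceGrad (φ i)) k X = 0 := by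
      intro k X hX
      ext α
      rw [PiLp.sub_apply, flux_apply]
      simp [spaceGrad, (hh k _).eq_zero hX, ((hφ _).spaceDeriv _).eq_zero hX]
    have hsrc : ∀ k, IsTestFunction Q
        (fun Y => F k Y + timeDeriv (φ k) Y - ∑ α, spaceDeriv α (h k α) Y) := fun k =>
      ((hF k).add (hφ k).timeDeriv).sub (IsTestFunction.sum _ fun α _ => (hh k α).spaceDeriv α)
    have := hpot Rc A hA hPH Γ hΓ X₀ r hr hRc T Y₀.1 d' ϱ' har haT hd' hϱ' F φ h
      (fun k => (hF k).mono hQa) (fun k => (hφ k).mono hQa) (fun k α => (hh k α).mono hQa)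
      (fun k X hX => (hF k).eq_zero (hQQ X hX)) (fun k X hX => hflux0 k X (hQQ X hX))
      (fun k X hX => (hF k).eq_zero (hQd' X hX)) (fun k X hX => hflux0 k X (hQd' X hX))
      (fun k h => hX₀Q ((hsrc k).support h)) i
    rwa [hΓ.potential_source (fun k => (hF k).to_univ) (fun k => (hφ k).to_univ)
      (fun k α => (hh k α).to_univ), (hφ i).eq_zero hX₀Q, sub_zero] at this
  have hint : ∀ k {f : SpaceTime n → ℝ}, IsTestFunction Q f → Integrable fun Y => v k Y * f Y :=
    fun k _ hf => hΓ.integrable_mul X₀ i k hf.to_univ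
  have hzero : ∀ X k, flux A (fun _ => spaceGrad (0 : SpaceTime n → ℝ)) k X = 0 := fun X k => by
    ext α; simp [flux_apply, spaceGrad, spaceDeriv_zero]
  -- `L²` bound
  have hL2 : ∀ k, ∃ g : SpaceTime n → ℝ, MemLp g 2 volume ∧ ∫ X, g X ^ 2 ≤ C₁ * B * T ∧
      ∀ f, IsTestFunction Q f → ∫ Y, v k Y * f Y = ∫ Y, g Y * f Y := fun k => by
    refine exists_riesz_test (L := fun f => ∫ Y, v k Y * f Y) (fun f g hf hg => ?_)
      (fun c f hf => ?_) (by positivity) fun f hf => ?_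
    · simp only [mul_add]; exact integral_add (hint k hf) (hint k hg)
    · simp only [mul_left_comm _ c]; exact integral_const_mul _ _
    · have := key d ϱ (Pi.single k f) (fun _ => 0) (fun _ _ => 0) hd hϱ hQd
        (hf.pi_single k) (fun _ => IsTestFunction.zero) (fun _ _ => IsTestFunction.zero)
      have e1 : ∀ X, ∑ j, (Pi.single k f : Fin N → SpaceTime n → ℝ) j X ^ 2 = f X ^ 2 := fun X => by
        rw [Finset.sum_eq_single k]
        · simp
        · intro j _ hj; simp [Pi.single_eq_of_ne hj]
        · simp
      have e2 : ∑ j, (∫ Y, v j Y * (Pi.single k f : Fin N → SpaceTime n → ℝ) j Y)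
          = ∫ Y, v k Y * f Y := by
        rw [Finset.sum_eq_single k]
        · simp
        · intro j _ hj; simp [Pi.single_eq_of_ne hj]
        · simp
      have e3 : ∀ X k, ‖(WithLp.toLp 2 fun _ : Fin n => (0 : SpaceTime n → ℝ) X)
          - flux A (fun _ => spaceGrad (0 : SpaceTime n → ℝ)) k X‖ ^ 2 = 0 := fun X k => by
        have : (WithLp.toLp 2 fun _ : Fin n => (0 : SpaceTime n → ℝ) X) = (0 : Space n) := by
          ext α; simp
        rw [hzero X k, this, sub_zero, norm_zero, zero_pow two_ne_zero]
      simp only [timeDeriv_zero, spaceDeriv_zero, mul_zero, integral_zero,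
        Finset.sum_const_zero, add_zero, sub_zero, e1, e2, e3] at this
      refine this.trans_eq ?_
      rw [hB]; ring
  -- gradient
  have hgr : ∀ k α, ∃ g : SpaceTime n → ℝ, MemLp g 2 volume ∧ ∫ X, g X ^ 2 ≤ C₁ * B ∧
      ∀ f, IsTestFunction Q f → -∫ Y, v k Y * spaceDeriv α f Y = ∫ Y, g Y * f Y := fun k α => by
    refine exists_riesz_test (L := fun f => -∫ Y, v k Y * spaceDeriv α f Y) (fun f g hf hg => ?_)
      (fun c f hf => ?_) (by positivity) fun f hf => ?_
    · have : ∀ Y, spaceDeriv α (fun X => f X + g X) Y = spaceDeriv α f Y + spaceDeriv α g Y :=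
        fun Y => by
          simp only [spaceDeriv]
          rw [fderiv_fun_add (hf.differentiable Y) (hg.differentiable Y)]; rfl
      simp only [this, mul_add]
      rw [integral_add (hint k (hf.spaceDeriv α)) (hint k (hg.spaceDeriv α)), neg_add]
    · have : ∀ Y, spaceDeriv α (fun X => c * f X) Y = c * spaceDeriv α f Y := fun Y => by
        simp only [spaceDeriv]
        rw [fderiv_const_mul (hf.differentiable Y)]; rfl
      simp only [this, mul_left_comm _ c]
      rw [integral_const_mul, mul_neg]
    · have hs : ∀ j β, IsTestFunction Q
          ((Pi.single k (Pi.single α f) : Fin N → Fin n → SpaceTime n → ℝ) j β) := fun j β => by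
        by_cases hj : j = k
        · subst hj; rw [Pi.single_eq_same]; exact hf.pi_single α β
        · rw [Pi.single_eq_of_ne hj]; exact IsTestFunction.zero
      have := key d ϱ (fun _ => 0) (fun _ => 0) (Pi.single k (Pi.single α f)) hd hϱ hQd
        (fun _ => IsTestFunction.zero) (fun _ => IsTestFunction.zero) hs
      have e2 : ∑ j, ∑ β, (∫ Y, v j Y * spaceDeriv β
          ((Pi.single k (Pi.single α f) : Fin N → Fin n → SpaceTime n → ℝ) j β) Y)
          = ∫ Y, v k Y * spaceDeriv α f Y := by
        rw [Finset.sum_eq_single k]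
        · rw [Finset.sum_eq_single α]
          · simp
          · intro β _ hβ; simp [Pi.single_eq_of_ne hβ, spaceDeriv_zero]
          · simp
        · intro j _ hj; simp [Pi.single_eq_of_ne hj, spaceDeriv_zero]
        · simp
      have e3 : ∀ X, ∑ j, ‖(WithLp.toLp 2 fun β : Fin n =>
          (Pi.single k (Pi.single α f) : Fin N → Fin n → SpaceTime n → ℝ) j β X)
          - flux A (fun _ => spaceGrad (0 : SpaceTime n → ℝ)) j X‖ ^ 2 = f X ^ 2 := fun X => by
        rw [Finset.sum_eq_single k]
        · rw [hzero X k, sub_zero, EuclideanSpace.real_norm_sq_eq,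
            Finset.sum_eq_single α]
          · simp
          · intro β _ hβ; simp [Pi.single_eq_of_ne hβ]
          · simp
        · intro j _ hj
          rw [hzero X j, sub_zero, EuclideanSpace.real_norm_sq_eq]
          simp [Pi.single_eq_of_ne hj]
        · simp
      simp only [timeDeriv_zero, mul_zero, integral_zero, Pi.zero_apply,
        Finset.sum_const_zero, zero_add, zero_sub, e3, Finset.sum_neg_distrib, e2,
        zero_pow (two_ne_zero)] at this
      refine this.trans_eq ?_
      rw [hB]; ring
  choose g hg hgB hgv using hL2
  choose G hG hGB hGv using hgr
  set Dv : Fin N → SpaceTime n → Space n := fun k X => WithLp.toLp 2 fun α => G k α X with hDv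
  -- Even the closed cylinder avoids `X₀`, so the row is continuous on a compact set. This gives the
  -- slice bound required for `V₂` and the continuity at `Y₀`.
  have hne : ∀ Y ∈ Icc Y₀.1 (Y₀.1 + r ^ 2) ×ˢ Metric.closedBall Y₀.2 r, X₀ ≠ Y := by
    rintro Y hY rfl
    linarith [hY.1.2]
  have hvc : ∀ k, ContinuousOn (v k)
      (Icc Y₀.1 (Y₀.1 + r ^ 2) ×ˢ Metric.closedBall Y₀.2 r) := fun k Y hY =>
    (hΓ.continuousAt_right (hne Y hY) i k).continuousWithinAt
  -- The Riesz representative is identified with the row itself by the fundamental lemma of the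
  -- calculus of variations, since the row is known to be locally integrable.
  have hvae : ∀ k, v k =ᵐ[volume.restrict Q] g k := fun k => by
    have h1 : LocallyIntegrable (fun Y => v k Y - g k Y) volume :=
      (hΓ.locallyIntegrable X₀ i k).sub (MemLp.locL2 (hg k)).locallyIntegrable
    have h2 := hQo.ae_eq_zero_of_integral_contDiff_smul_eq_zero (h1.locallyIntegrableOn Q)
      fun f hf hfc hfs => by
        have hft : IsTestFunction Q f := ⟨hf, hfc, hfs⟩
        have h3 : Integrable fun Y => g k Y * f Y :=
          (MemLp.locL2 (hg k)).integrable_mul hf.continuous hfc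
        simp only [smul_eq_mul, mul_comm (f _), sub_mul]
        rw [integral_sub (hint k hft) h3, hgv k f hft, sub_self]
    rw [Filter.EventuallyEq, ae_restrict_iff' hQm]
    filter_upwards [h2] with Y hY hYQ
    exact sub_eq_zero.1 (hY hYQ)
  have hvL2 : ∀ k, MemLp (v k) 2 (volume.restrict Q) := fun k =>
    ((hg k).restrict Q).ae_eq (hvae k).symm
  have hDvL2 : ∀ k, MemLp (Dv k) 2 volume := fun k => memLp_toLp fun α => hG k α
  have hsol : IsAdjointWeakSolution A (forwardInterval Y₀.1 r) (Metric.ball Y₀.2 r) 0 v Dv := by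
    refine ⟨fun k => ⟨fun T' _ => ?_, fun φ hφ α => ?_, ?_, ?_⟩, fun φ hφ => ?_⟩
    · exact (hvL2 k).mono_measure (Measure.restrict_mono
        (prod_mono inter_subset_left subset_rfl) le_rfl)
    · rw [(hφ.spaceDeriv α).setIntegral_mul, hφ.setIntegral_mul]
      have := hGv k α φ hφ
      simp only [hDv]
      linarith
    · exact (hDvL2 k).restrict _
    · obtain ⟨M, hM⟩ := (isCompact_Icc.prod (isCompact_closedBall Y₀.2 r)).exists_bound_of_continuousOn
        (hvc k)
      refine lt_of_le_of_lt (essSup_le_of_ae_le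
        ((volume.restrict (Metric.ball Y₀.2 r)) univ ^ (2 : ℝ≥0∞).toReal⁻¹ * ENNReal.ofReal M) ?_) ?_
      · filter_upwards [ae_restrict_mem measurableSet_Ioo] with t ht
        refine eLpNorm_le_of_ae_bound ?_
        filter_upwards [ae_restrict_mem measurableSet_ball] with x hx
        exact hM _ ⟨⟨ht.1.le, ht.2.le⟩, Metric.ball_subset_closedBall hx⟩
      · refine ENNReal.mul_lt_top (ENNReal.rpow_lt_top_of_nonneg (by positivity) ?_)
          ENNReal.ofReal_lt_top
        rw [Measure.restrict_apply_univ]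
        exact measure_ball_lt_top.ne
    · change ∀ i, IsTestFunction Q (φ i) at hφ
      set K : Set (SpaceTime n) := ⋃ k, tsupport (φ k) with hKdef
      have hK : IsCompact K := isCompact_iUnion fun k => (hφ k).compact
      have hKQ : K ⊆ Q := iUnion_subset fun k => (hφ k).support
      set H := flux A fun i => spaceGrad (φ i) with hH
      have hHL2 : ∀ k α, MemLp (fun X => H k X α) 2 volume := fun k α => by
        rw [← Measure.restrict_univ (μ := (volume : Measure (SpaceTime n)))]
        exact MemLp.flux_apply hA hLam (fun i => (memLp_spaceGrad (hφ i)).restrict _) k α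
      have hHK : ∀ k α, ∀ X ∉ K, H k X α = 0 := fun k α X hX => by
        rw [hH, flux_apply]
        refine Finset.sum_eq_zero fun j _ => Finset.sum_eq_zero fun β _ => ?_
        have : spaceDeriv β (φ j) X = 0 := by
          have h1 : IsTestFunction (tsupport (φ j)) (φ j) :=
            ⟨(hφ j).smooth, (hφ j).compact, subset_rfl⟩
          exact (h1.spaceDeriv β).eq_zero fun h => hX (mem_iUnion.2 ⟨j, h⟩)
        simp [spaceGrad, this]
      -- The flux `H = A Dφ` is only an `L²` field, supported in the compact set `K`. It is
      -- approximated by test fields `h` supported in the cylinder.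
      choose h hh hhH using fun k α =>
        exists_tendsto_testFunction_of_isCompact hQo hK hKQ (hHL2 k α) (hHK k α)
      have hlim1 : Tendsto (fun m => ∑ k, ((∫ Y, v k Y * timeDeriv (φ k) Y)
          + ∑ α, ∫ Y, G k α Y * h k α m Y)) atTop (𝓝 (∑ k, ((∫ Y, v k Y * timeDeriv (φ k) Y)
          + ∑ α, ∫ Y, G k α Y * H k Y α))) := by
        refine tendsto_finsetSum _ fun k _ => tendsto_const_nhds.add
          (tendsto_finsetSum _ fun α _ => ?_)
        simp only [mul_comm (G k α _)]
        exact tendsto_integral_mul_const (Eventually.of_forall fun m => (hh k α m).memLp 2)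
          (hHL2 k α) (hG k α) (hhH k α)
      have hlim2 : Tendsto (fun m => C₁ * ((r ^ (n + 2))⁻¹ * T *
          (∑ k, ∑ α, ∫ X, (h k α m X - H k X α) ^ 2))) atTop (𝓝 0) := by
        have : Tendsto (fun m => ∑ k, ∑ α, ∫ X, (h k α m X - H k X α) ^ 2) atTop (𝓝 0) := by
          have := tendsto_finsetSum (Finset.univ : Finset (Fin N)) fun k _ =>
            tendsto_finsetSum (Finset.univ : Finset (Fin n)) fun α _ =>
              tendsto_integral_sq_sub (fun m => (hh k α m).memLp 2) (hHL2 k α) (hhH k α)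
          simpa using this
        simpa using (this.const_mul ((r ^ (n + 2))⁻¹ * T)).const_mul C₁
      have hle : ∀ m, (∑ k, ((∫ Y, v k Y * timeDeriv (φ k) Y)
          + ∑ α, ∫ Y, G k α Y * h k α m Y)) ^ 2 ≤ C₁ * ((r ^ (n + 2))⁻¹ * T *
          (∑ k, ∑ α, ∫ X, (h k α m X - H k X α) ^ 2)) := fun m => by
        -- With no weight and with flux source `h - A Dφ` the right-hand side tends to zero, while
        -- the test function itself vanishes at `X₀`. In the limit the pairing of the row with `φ_t`
        -- and of its gradient with `A Dφ` sums to zero, which is the transposed equation.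
        have := key 0 0 (fun _ => 0) φ (fun k α => h k α m) le_rfl le_rfl
          (fun X hX => absurd hX (not_lt.2 (norm_nonneg _))) (fun _ => IsTestFunction.zero) hφ
          (fun k α => hh k α m)
        simp only [← hGv _ _ _ (hh _ _ m)]
        have e1 : ∫ X, ∑ k, ‖(WithLp.toLp 2 fun α => h k α m X) - H k X‖ ^ 2
            = ∑ k, ∑ α, ∫ X, (h k α m X - H k X α) ^ 2 := by
          simp only [EuclideanSpace.real_norm_sq_eq, PiLp.sub_apply]
          have hi : ∀ k α, Integrable fun X => (h k α m X - H k X α) ^ 2 := fun k α =>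
            (((hh k α m).memLp 2).sub (hHL2 k α)).integrable_sq
          rw [integral_finsetSum _ fun k _ => integrable_finsetSum _ fun α _ => hi k α]
          exact Finset.sum_congr rfl fun k _ => integral_finsetSum _ fun α _ => hi k α
        rw [e1] at this
        simpa [Finset.sum_neg_distrib, sub_eq_add_neg] using this
      have hS := le_of_tendsto_of_tendsto' (hlim1.pow 2) hlim2 hle
      have hS0 := pow_eq_zero_iff (two_ne_zero) |>.1 (le_antisymm hS (sq_nonneg _))
      simp only [Pi.zero_apply, zero_mul, Finset.sum_const_zero, integral_zero]
      rw [← hS0, integral_finsetSum _ fun k _ => (hint k (hφ k).timeDeriv).restrict,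
        Finset.sum_add_distrib]
      congr 1
      · exact Finset.sum_congr rfl fun k _ => (hφ k).timeDeriv.setIntegral_mul _
      · simp only [ellipticForm_transpose]
        have hi : ∀ k α, Integrable fun X => Dv k X α * H k X α := fun k α =>
          (hG k α).integrable_mul (hHL2 k α)
        rw [setIntegral_eq_integral_of_forall_compl_eq_zero fun X hX => by
            refine Finset.sum_eq_zero fun k _ => Finset.sum_eq_zero fun α _ => ?_
            rw [hHK k α X fun h => hX (hKQ h), mul_zero],
          integral_finsetSum _ fun k _ => integrable_finsetSum _ fun α _ => hi k α]
        exact Finset.sum_congr rfl fun k _ => integral_finsetSum _ fun α _ => hi k α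
  have hvY : ∀ k, ContinuousAt (v k) Y₀ := fun k =>
    hΓ.continuousAt_right (hne Y₀ ⟨⟨le_rfl, by linarith⟩, Metric.mem_closedBall_self hr.le⟩) i k
  -- The exponential factor is already contained in the `L²` bounds of the row and its gradient. The
  -- local bound at `Y₀` contributes a second power of `r^(-n-2) T` but no further decay.
  have hfin := hadj Rc A hA hPH' Y₀ r hr hRc v Dv hsol hvY k₀
  have hv1 : ∫ X in Q, v k₀ X ^ 2 ≤ C₁ * B * T := by
    calc ∫ X in Q, v k₀ X ^ 2 = ∫ X in Q, g k₀ X ^ 2 :=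
          integral_congr_ae ((hvae k₀).mono fun X hX => by simp only [hX])
      _ ≤ ∫ X, g k₀ X ^ 2 := setIntegral_le_integral (hg k₀).integrable_sq
          (Eventually.of_forall fun X => sq_nonneg _)
      _ ≤ _ := hgB k₀
  have hDv1 : ∫ X in Q, ∑ k, ‖Dv k X‖ ^ 2 ≤ N * n * (C₁ * B) := by
    have hi : ∀ k, Integrable (fun X => ‖Dv k X‖ ^ 2) := fun k =>
      (hDvL2 k).integrable_norm_pow (by norm_num)
    calc ∫ X in Q, ∑ k, ‖Dv k X‖ ^ 2 ≤ ∫ X, ∑ k, ‖Dv k X‖ ^ 2 :=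
          setIntegral_le_integral (integrable_finsetSum _ fun k _ => hi k)
            (Eventually.of_forall fun X => Finset.sum_nonneg fun _ _ => sq_nonneg _)
      _ = ∑ k, ∑ α, ∫ X, G k α X ^ 2 := by
          rw [integral_finsetSum _ fun k _ => hi k]
          refine Finset.sum_congr rfl fun k _ => ?_
          simp only [EuclideanSpace.real_norm_sq_eq, hDv]
          exact integral_finsetSum _ fun α _ => (hG k α).integrable_sq
      _ ≤ ∑ k : Fin N, ∑ α : Fin n, C₁ * B :=
          Finset.sum_le_sum fun k _ => Finset.sum_le_sum fun α _ => hGB k α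
      _ = _ := by simp; ring
  have hrn : (r ^ n)⁻¹ ≤ T * (r ^ (n + 2))⁻¹ := by
    rw [pow_add, mul_inv, mul_left_comm]
    refine le_mul_of_one_le_right (by positivity) ?_
    rw [← div_eq_mul_inv, le_div_iff₀ (by positivity)]
    linarith
  have hDv0 : 0 ≤ ∫ X in Q, ∑ k, ‖Dv k X‖ ^ 2 :=
    integral_nonneg fun X => Finset.sum_nonneg fun _ _ => sq_nonneg _
  calc Γ X₀ Y₀ i k₀ ^ 2 ≤ _ := hfin
    _ ≤ C₂ * ((r ^ (n + 2))⁻¹ * (C₁ * B * T) + T * (r ^ (n + 2))⁻¹ * (N * n * (C₁ * B))) := by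
        gcongr
    _ = _ := by rw [hB]; ring

end

/-! ### The Gaussian bound. -/

section
variable {n N : ℕ}

/-- The constant in the Gaussian exponent. -/
noncomputable def gaussRate (lam Lam : ℝ) : ℝ := 1 / (32 * energyRate lam Lam)

theorem gaussRate_pos {lam Lam : ℝ} (hlam : 0 < lam) : 0 < gaussRate lam Lam := by
  have := energyRate_pos (Lam := Lam) hlam
  unfold gaussRate; positivity

theorem EuclideanSpace.norm_le_sum {ι : Type*} [Fintype ι] (v : EuclideanSpace ℝ ι) :
    ‖v‖ ≤ ∑ i, |v i| := by
  rw [EuclideanSpace.norm_eq]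
  refine Real.sqrt_le_iff.2 ⟨Finset.sum_nonneg fun _ _ => abs_nonneg _, ?_⟩
  exact Finset.sum_sq_le_sq_sum_of_nonneg fun i _ => abs_nonneg (v i)

theorem opNorm_le_of_entries {M : Matrix (Fin N) (Fin N) ℝ} {c : ℝ} (hc : 0 ≤ c)
    (h : ∀ i k, |M i k| ≤ c) : opNorm M ≤ N * N * c := by
  refine ContinuousLinearMap.opNorm_le_bound _ (by positivity) fun v => ?_
  refine (EuclideanSpace.norm_le_sum _).trans ?_
  have hv : ∀ i, |(Matrix.toEuclideanCLM (n := Fin N) (𝕜 := ℝ) M v) i| ≤ N * c * ‖v‖ := fun i => by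
    have : (Matrix.toEuclideanCLM (n := Fin N) (𝕜 := ℝ) M v) i = ∑ k, M i k * v k := rfl
    rw [this]
    refine (Finset.abs_sum_le_sum_abs _ _).trans ?_
    calc ∑ k, |M i k * v k| ≤ ∑ _k : Fin N, c * ‖v‖ := Finset.sum_le_sum fun k _ => by
          rw [abs_mul]; exact mul_le_mul (h i k) (PiLp.norm_apply_le v k) (abs_nonneg _) hc
      _ = _ := by simp; ring
  calc ∑ i, |(Matrix.toEuclideanCLM (n := Fin N) (𝕜 := ℝ) M v) i| ≤ ∑ _i : Fin N, N * c * ‖v‖ :=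
        Finset.sum_le_sum fun i _ => hv i
    _ = _ := by simp; ring

/-- Gaussian bound for the entries of the fundamental matrix. -/
theorem exists_gaussian_bound (n N : ℕ) {lam Lam : ℝ} (hlam : 0 < lam) (hLam : 0 < Lam)
    {μ₀ C₀ : ℝ} (hμ : 0 < μ₀) (hC₀ : 0 < C₀) :
    ∃ C : ℝ, 0 < C ∧ ∀ (Rc : ℝ≥0∞), 0 < Rc → ∀ (A : Coeff n N), IsParabolic lam Lam A →
      PropertyPH A μ₀ Rc C₀ → AdjointPropertyPH A μ₀ Rc C₀ →
      ∀ Γ : SpaceTime n → SpaceTime n → Matrix (Fin N) (Fin N) ℝ, IsFundamentalMatrix A Γ →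
      ∀ (t s : ℝ), s < t → ∀ (x y : Space n) (i k : Fin N),
      |Γ (t, x) (s, y) i k| ≤ C * (t - s) ^ (-(n : ℝ) / 2) *
        Real.exp (-gaussRate lam Lam * ‖x - y‖ ^ 2 / (t - s)
          + (t - s) * (Rc⁻¹).toReal ^ 2) := by
  obtain ⟨C, hC, hker⟩ := exists_kernel_bound n N hlam hLam hμ hC₀
  set ν := energyRate lam Lam with hν
  have hν0 : 0 < ν := energyRate_pos hlam
  refine ⟨√C * (4 ^ (n + 2) * ((n + 2).factorial * Real.exp 1)) * Real.exp (1 / (2 * ν)),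
    by positivity, ?_⟩
  intro Rc hRc A hA hPH hPH' Γ hΓ t s hst x y i k
  set T := t - s with hT
  have hT0 : 0 < T := sub_pos.2 hst
  set q := (Rc⁻¹).toReal with hq
  have hq0 : 0 ≤ q := ENNReal.toReal_nonneg
  set S := √T with hS
  have hS0 : 0 < S := Real.sqrt_pos.2 hT0
  have hS2 : S ^ 2 = T := Real.sq_sqrt hT0.le
  -- Here `q` is the inverse of `Rc`, with value `0` when `Rc` is infinite.
  set M := 1 + T * q ^ 2 with hM
  have hM1 : 1 ≤ M := by rw [hM]; nlinarith [mul_nonneg hT0.le (sq_nonneg q)]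
  have hM0 : 0 < M := by linarith
  -- The largest natural radius `√T` is reduced by the factor `4M`: the `4` gives `2r² < T`, and `√T
  -- q ≤ 1 + T q²` gives `r < Rc`.
  set r := S / (4 * M) with hr
  have hr0 : 0 < r := by positivity
  have hrS : r ≤ S / 4 := by
    rw [hr, div_le_div_iff₀ (by positivity) (by norm_num)]; nlinarith
  have hrT : 2 * r ^ 2 < T := by nlinarith
  have hrR : ENNReal.ofReal r < Rc := by
    rcases eq_or_ne Rc ⊤ with h | h
    · rw [h]; exact ENNReal.ofReal_lt_top
    · rw [ENNReal.ofReal_lt_iff_lt_toReal hr0.le h]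
      have hR0 : 0 < Rc.toReal := ENNReal.toReal_pos hRc.ne' h
      have hqR : q * Rc.toReal = 1 := by
        rw [hq, ENNReal.toReal_inv, inv_mul_cancel₀ hR0.ne']
      have h1 : S * q ≤ M := by rw [hM, ← hS2]; nlinarith [sq_nonneg (S * q - 1)]
      have h2 : S * 1 ≤ M * Rc.toReal := by
        rw [← hqR, ← mul_assoc]; exact mul_le_mul_of_nonneg_right h1 hR0.le
      rw [hr, div_lt_iff₀ (by positivity)]
      nlinarith [mul_pos hM0 hR0]
  set D := ‖x - y‖ with hD
  have hD0 : 0 ≤ D := norm_nonneg _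
  -- This value minimises `2νϱ²T - ϱD`, with minimum `-D² / (8νT)`. Half of the gain absorbs the
  -- linear error `5ϱr` up to a constant; the square root of the kernel bound halves the rest to
  -- `-D² / (32νT)`, the value of `gaussRate`.
  set ϱ := D / (4 * ν * T) with hϱ
  have hϱ0 : 0 ≤ ϱ := by positivity
  have hdist : ∀ X ∈ forwardCyl ((s, y) : SpaceTime n) r, max (D - r) 0
      ≤ ‖X.2 - ((t, x) : SpaceTime n).2‖ := fun X hX => by
    refine max_le ?_ (norm_nonneg _)
    have h1 : ‖X.2 - y‖ < r := mem_ball_iff_norm.1 hX.2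
    have h2 : D ≤ ‖X.2 - x‖ + ‖X.2 - y‖ := by
      rw [hD, norm_sub_rev X.2 x]; exact norm_sub_le_norm_sub_add_norm_sub x X.2 y
    change D - r ≤ ‖X.2 - x‖
    linarith
  have h := hker Rc A hA hPH hPH' Γ hΓ (t, x) (s, y) r T (max (D - r) 0) ϱ hr0 hrR rfl hrT
    (le_max_right _ _) hϱ0 hdist i k
  have hexp : 2 * ν * ϱ ^ 2 * T + 4 * ϱ * r - ϱ * max (D - r) 0
      ≤ 2 * (1 / (2 * ν) + -gaussRate lam Lam * D ^ 2 / T) := by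
    have h1 : ϱ * (D - r) ≤ ϱ * max (D - r) 0 := mul_le_mul_of_nonneg_left (le_max_left _ _) hϱ0
    have h2 : ϱ * r ≤ ϱ * (S / 4) := mul_le_mul_of_nonneg_left hrS hϱ0
    set z := D / S with hz
    have hDz : D = z * S := by rw [hz]; field_simp
    have e1 : ϱ * (S / 4) = z / (16 * ν) := by rw [hϱ, hDz, ← hS2]; field_simp; norm_num
    have e2 : ϱ * D = z ^ 2 / (4 * ν) := by rw [hϱ, hDz, ← hS2]; field_simp
    have e3 : 2 * ν * ϱ ^ 2 * T = z ^ 2 / (8 * ν) := by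
      rw [hϱ, hDz, ← hS2]; field_simp; ring
    have e4 : -gaussRate lam Lam * D ^ 2 / T = -(z ^ 2 / (32 * ν)) := by
      rw [gaussRate, ← hν, hDz, ← hS2]; field_simp
    rw [e1] at h2
    rw [e4]
    have e5 : z ^ 2 / (8 * ν) - z ^ 2 / (4 * ν) + 5 * (z / (16 * ν))
        ≤ 2 * (1 / (2 * ν) + -(z ^ 2 / (32 * ν))) := by
      have : 2 * (1 / (2 * ν) + -(z ^ 2 / (32 * ν)))
          - (z ^ 2 / (8 * ν) - z ^ 2 / (4 * ν) + 5 * (z / (16 * ν)))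
          = ((z - 5 / 2) ^ 2 + 39 / 4) / (16 * ν) := by field_simp; ring
      have h3 : 0 ≤ ((z - 5 / 2) ^ 2 + 39 / 4) / (16 * ν) := by positivity
      linarith
    have : ϱ * (D - r) = ϱ * D - ϱ * r := by ring
    nlinarith
  set e := 1 / (2 * ν) + -gaussRate lam Lam * D ^ 2 / T with he
  have h2 : Γ (t, x) (s, y) i k ^ 2 ≤ (√C * ((r ^ (n + 2))⁻¹ * T) * Real.exp e) ^ 2 := by
    refine h.trans ?_
    rw [mul_pow (√C * _), mul_pow (√C), Real.sq_sqrt hC.le, ← Real.exp_nat_mul, ← mul_assoc C]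
    exact mul_le_mul_of_nonneg_left (Real.exp_le_exp.2 (by exact_mod_cast hexp)) (by positivity)
  have h3 := abs_le_of_sq_le_sq h2 (by positivity)
  have hrn : (r ^ (n + 2))⁻¹ * T = 4 ^ (n + 2) * M ^ (n + 2) * (S ^ n)⁻¹ := by
    rw [hr, ← hS2, div_pow, mul_pow, inv_div, pow_add S]
    field_simp
  -- The polynomial loss from shrinking the radius is turned into `exp(T / Rc²)` by one term of the
  -- exponential series. This yields the coefficient `1` in front of `T / Rc²`.
  have hMe : M ^ (n + 2) ≤ (n + 2).factorial * Real.exp 1 * Real.exp (T * q ^ 2) := by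
    have := Real.pow_div_factorial_le_exp M hM0.le (n + 2)
    rw [div_le_iff₀ (by positivity)] at this
    refine this.trans_eq ?_
    rw [hM, Real.exp_add]; ring
  have hSn : (S ^ n)⁻¹ = T ^ (-(n : ℝ) / 2) := by
    rw [hS, Real.sqrt_eq_rpow, ← Real.rpow_natCast, ← Real.rpow_mul hT0.le, ← Real.rpow_neg hT0.le]
    congr 1; ring
  refine (h3 : |Γ (t, x) (s, y) i k| ≤ _).trans ?_
  rw [hrn, hSn, he, Real.exp_add, Real.exp_add]
  have hTn : 0 ≤ T ^ (-(n : ℝ) / 2) := by positivity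
  calc √C * (4 ^ (n + 2) * M ^ (n + 2) * T ^ (-(n : ℝ) / 2))
        * (Real.exp (1 / (2 * ν)) * Real.exp (-gaussRate lam Lam * D ^ 2 / T))
      ≤ √C * (4 ^ (n + 2) * ((n + 2).factorial * Real.exp 1 * Real.exp (T * q ^ 2))
          * T ^ (-(n : ℝ) / 2))
        * (Real.exp (1 / (2 * ν)) * Real.exp (-gaussRate lam Lam * D ^ 2 / T)) := by gcongr
    _ = _ := by ring

theorem integrable_exp_neg_mul_norm_sq {c : ℝ} (hc : 0 < c) (x : Space n) :
    Integrable fun z : Space n => Real.exp (-c * ‖x - z‖ ^ 2) := by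
  have h := (GaussianFourier.integrable_cexp_neg_mul_sq_norm_add (V := Space n) (b := (c : ℂ))
    (by simpa using hc) 0 0).norm
  have h2 : Integrable fun z : Space n => Real.exp (-c * ‖z‖ ^ 2) := by
    refine h.congr (Eventually.of_forall fun z => ?_)
    simp only [zero_mul, add_zero, Complex.norm_exp]
    norm_cast
  simpa using h2.comp_sub_left x

/-- The fundamental matrix is dominated by a Gaussian, uniformly for time differences in compact
subsets of `(0, ∞)`. -/
def GaussianDominated (Γ : SpaceTime n → SpaceTime n → Matrix (Fin N) (Fin N) ℝ) : Prop :=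
  ∀ δ T : ℝ, 0 < δ → ∃ M c : ℝ, 0 < M ∧ 0 < c ∧ ∀ t s : ℝ, δ ≤ t - s → t - s ≤ T →
    ∀ (x y : Space n) (i k : Fin N), |Γ (t, x) (s, y) i k| ≤ M * Real.exp (-c * ‖x - y‖ ^ 2)

/-- Away from `t = s` the singular factor is bounded, and for bounded time differences the Gaussian
can be given a fixed width. The identities below use only this weaker form, as a source of
integrable majorants. -/
theorem gaussianDominated_of_bound {Γ : SpaceTime n → SpaceTime n → Matrix (Fin N) (Fin N) ℝ}
    {C κ γ : ℝ} (hC : 0 < C) (hκ : 0 < κ) (hγ : 0 ≤ γ)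
    (h : ∀ (t s : ℝ), s < t → ∀ (x y : Space n) (i k : Fin N),
      |Γ (t, x) (s, y) i k| ≤ C * (t - s) ^ (-(n : ℝ) / 2) *
        Real.exp (-κ * ‖x - y‖ ^ 2 / (t - s) + (t - s) * γ)) : GaussianDominated Γ := by
  intro δ T hδ
  -- Taking the maximum with `δ` keeps the width positive for every real `T`.
  have hT : 0 < max δ T := lt_max_of_lt_left hδ
  refine ⟨C * δ ^ (-(n : ℝ) / 2) * Real.exp (max δ T * γ), κ / max δ T, by positivity,
    by positivity, fun t s h1 h2 x y i k => ?_⟩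
  have h0 : 0 < t - s := hδ.trans_le h1
  refine (h t s (sub_pos.1 h0) x y i k).trans ?_
  rw [Real.exp_add, mul_assoc _ (Real.exp (max δ T * γ)), mul_comm (Real.exp (max δ T * γ))]
  have hn : -(n : ℝ) / 2 ≤ 0 := by rw [neg_div, neg_nonpos]; positivity
  have h3 : t - s ≤ max δ T := h2.trans (le_max_right _ _)
  gcongr ?_ * ?_ * (?_ * ?_)
  · exact Real.rpow_le_rpow_of_nonpos hδ h1 hn
  · rw [Real.exp_le_exp, neg_mul, neg_mul, neg_div, neg_le_neg_iff, mul_comm (κ / _), mul_comm κ,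
      ← mul_div_assoc]
    exact div_le_div_of_nonneg_left (by positivity) h0 h3
  · exact Real.exp_le_exp.2 (mul_le_mul_of_nonneg_right h3 hγ)

end

/-! ### Recovering a time slice from averages in time. -/

section
variable {n N : ℕ}

/-- A smooth monotone step from `0` to `1` on the interval `[s, s + δ]`. -/
noncomputable def timeStep (s δ τ : ℝ) : ℝ := Real.smoothTransition ((τ - s) / δ)

section TimeStep

variable {s δ : ℝ}

theorem timeStep_contDiff : ContDiff ℝ ∞ (timeStep s δ) :=
  Real.smoothTransition.contDiff.comp ((contDiff_id.sub contDiff_const).div_const δ)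

theorem timeStep_deriv_contDiff : ContDiff ℝ ∞ (deriv (timeStep s δ)) :=
  (contDiff_infty_iff_deriv.1 timeStep_contDiff).2

theorem timeStep_nonneg (τ : ℝ) : 0 ≤ timeStep s δ τ := Real.smoothTransition.nonneg _

theorem timeStep_le_one (τ : ℝ) : timeStep s δ τ ≤ 1 := Real.smoothTransition.le_one _

theorem abs_timeStep_le (τ : ℝ) : |timeStep s δ τ| ≤ 1 := by
  rw [abs_of_nonneg (timeStep_nonneg τ)]; exact timeStep_le_one τ

theorem timeStep_eq_zero (hδ : 0 < δ) {τ : ℝ} (h : τ ≤ s) : timeStep s δ τ = 0 :=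
  Real.smoothTransition.zero_of_nonpos (div_nonpos_of_nonpos_of_nonneg (by linarith) hδ.le)

theorem timeStep_eq_one (hδ : 0 < δ) {τ : ℝ} (h : s + δ ≤ τ) : timeStep s δ τ = 1 :=
  Real.smoothTransition.one_of_one_le (by rw [le_div_iff₀ hδ]; linarith)

theorem timeStep_deriv_nonneg (hδ : 0 < δ) (τ : ℝ) : 0 ≤ deriv (timeStep s δ) τ := by
  have : Monotone (timeStep s δ) := fun a b hab =>
    Real.smoothTransition.monotone (div_le_div_of_nonneg_right (by linarith) hδ.le)
  exact this.deriv_nonneg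

theorem timeStep_deriv_eq_zero (hδ : 0 < δ) {τ : ℝ} (h : τ ∉ Icc s (s + δ)) :
    deriv (timeStep s δ) τ = 0 := by
  rw [mem_Icc, not_and_or, not_le, not_le] at h
  rcases h with h | h
  · have : timeStep s δ =ᶠ[𝓝 τ] fun _ => 0 := by
      filter_upwards [Iio_mem_nhds h] with t ht using timeStep_eq_zero hδ (le_of_lt ht)
    rw [this.deriv_eq, deriv_const]
  · have : timeStep s δ =ᶠ[𝓝 τ] fun _ => 1 := by
      filter_upwards [Ioi_mem_nhds h] with t ht using timeStep_eq_one hδ (le_of_lt ht)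
    rw [this.deriv_eq, deriv_const]

theorem timeStep_deriv_hasCompactSupport (hδ : 0 < δ) :
    HasCompactSupport (deriv (timeStep s δ)) :=
  HasCompactSupport.intro isCompact_Icc fun _ h => timeStep_deriv_eq_zero hδ h

theorem integral_timeStep_deriv (hδ : 0 < δ) : ∫ τ, deriv (timeStep s δ) τ = 1 := by
  have h1 : ∫ τ in s..(s + δ), deriv (timeStep s δ) τ = 1 := by
    rw [intervalIntegral.integral_deriv_eq_sub
      (fun τ _ => timeStep_contDiff.differentiable (by simp) τ)
      (timeStep_deriv_contDiff.continuous.intervalIntegrable _ _),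
      timeStep_eq_one hδ le_rfl, timeStep_eq_zero hδ le_rfl, sub_zero]
  rw [← h1, intervalIntegral.integral_of_le (by linarith), ← integral_Icc_eq_integral_Ioc,
    setIntegral_eq_integral_of_forall_compl_eq_zero fun τ h => timeStep_deriv_eq_zero hδ h]

end TimeStep

/-- The derivative of the step is bounded and supported in a compact time interval, on which `v` has
a spatial majorant independent of time; the product of the two majorants is integrable in
space-time. -/
theorem integrable_deriv_timeStep_mul {v : SpaceTime n → ℝ} {s s₁ δ : ℝ} (hδ : 0 < δ)
    (hδs : s + δ ≤ s₁) {b : Space n → ℝ} (hb : Integrable b)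
    (hv : ∀ τ ∈ Icc s s₁, ∀ y, ContinuousAt v (τ, y))
    (hvb : ∀ τ ∈ Icc s s₁, ∀ y, |v (τ, y)| ≤ b y) :
    Integrable (fun Y : SpaceTime n => deriv (timeStep s δ) Y.1 * v Y) := by
  set S : Set (SpaceTime n) := Icc s s₁ ×ˢ univ
  have hS : MeasurableSet S := measurableSet_Icc.prod MeasurableSet.univ
  obtain ⟨M, hM⟩ := (timeStep_deriv_hasCompactSupport (s := s) hδ).exists_bound_of_continuous
    timeStep_deriv_contDiff.continuous
  have hvm : AEStronglyMeasurable v (volume.restrict S) :=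
    ContinuousOn.aestronglyMeasurable
      (fun Y hY => (hv Y.1 hY.1 Y.2).continuousWithinAt) hS
  have hzero : ∀ Y ∉ S, deriv (timeStep s δ) Y.1 * v Y = 0 := fun Y hY => by
    rw [timeStep_deriv_eq_zero hδ, zero_mul]
    exact fun h => hY ⟨⟨h.1, h.2.trans hδs⟩, mem_univ _⟩
  have hbi : Integrable (fun Y : SpaceTime n => (Icc s s₁).indicator (fun _ => M) Y.1 * b Y.2) :=
    Integrable.mul_prod ((integrableOn_const measure_Icc_lt_top.ne).integrable_indicator
      measurableSet_Icc) hb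
  have h1 : AEStronglyMeasurable (fun Y : SpaceTime n => deriv (timeStep s δ) Y.1 * v Y)
      (volume.restrict S) :=
    (timeStep_deriv_contDiff.continuous.comp continuous_fst).aestronglyMeasurable.mul hvm
  refine (integrableOn_iff_integrable_of_support_subset (s := S) fun Y hY => ?_).1 ?_
  · by_contra hYS; exact hY (hzero Y hYS)
  · refine Integrable.mono' hbi.restrict h1 ?_
    filter_upwards [ae_restrict_mem hS] with Y hY
    rw [norm_mul, indicator_of_mem hY.1]
    exact mul_le_mul (hM _) (hvb Y.1 hY.1 Y.2) (norm_nonneg _) ((norm_nonneg _).trans (hM 0))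

/-- If the time averages of `v` over `[s, s + δ]` equal `c`, then so does the integral of the slice
at time `s`. -/
theorem integral_slice_eq {v : SpaceTime n → ℝ} {s s₁ c : ℝ} (hs : s < s₁) {b : Space n → ℝ}
    (hb : Integrable b) (hv : ∀ τ ∈ Icc s s₁, ∀ y, ContinuousAt v (τ, y))
    (hvb : ∀ τ ∈ Icc s s₁, ∀ y, |v (τ, y)| ≤ b y)
    (h : ∀ δ, 0 < δ → s + δ ≤ s₁ → ∫ Y : SpaceTime n, deriv (timeStep s δ) Y.1 * v Y = c) :
    ∫ y, v (s, y) = c := by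
  set g : ℝ → ℝ := fun τ => ∫ y, v (τ, y) with hg
  -- The spatial integrals depend continuously on time by dominated convergence. The derivatives of
  -- the steps are probability densities on `[s, s + δ]`, so their averages converge to the value at
  -- `s` as `δ → 0`.
  have hgc : ContinuousOn g (Icc s s₁) := by
    refine continuousOn_of_dominated (bound := b) (fun τ hτ => ?_)
      (fun τ hτ => Eventually.of_forall fun y => hvb τ hτ y) hb
      (Eventually.of_forall fun y τ hτ => ?_)
    · refine Continuous.aestronglyMeasurable (continuous_iff_continuousAt.2 fun y => ?_)
      exact ContinuousAt.comp (f := fun y => (τ, y)) (g := v) (hv τ hτ y) (by fun_prop)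
    · exact (ContinuousAt.comp (f := fun τ => (τ, y)) (g := v) (hv τ hτ y)
        (by fun_prop)).continuousWithinAt
  have hgs : ∀ δ, 0 < δ → s + δ ≤ s₁ → Integrable (fun τ => deriv (timeStep s δ) τ * g τ) ∧
      ∫ τ, deriv (timeStep s δ) τ * g τ = c := fun δ hδ hδs => by
    have hi := integrable_deriv_timeStep_mul hδ hδs hb hv hvb
    have hi' : Integrable (fun Y : ℝ × Space n => deriv (timeStep s δ) Y.1 * v Y)
      ((volume : Measure ℝ).prod (volume : Measure (Space n))) := hi
    have h2 := hi'.integral_prod_left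
    simp only [integral_const_mul] at h2
    refine ⟨h2, ?_⟩
    rw [← h δ hδ hδs]
    have h3 := integral_prod _ hi'
    simp only [integral_const_mul] at h3
    exact h3.symm
  refine eq_of_forall_dist_le fun ε hε => ?_
  have hc := Metric.continuousWithinAt_iff.1 (hgc s ⟨le_rfl, hs.le⟩) ε hε
  obtain ⟨δ', hδ', hclose⟩ := hc
  set δ := min (δ' / 2) (s₁ - s) with hδdef
  have hδ : 0 < δ := lt_min (by positivity) (by linarith)
  have hδs : s + δ ≤ s₁ := by linarith [min_le_right (δ' / 2) (s₁ - s)]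
  obtain ⟨hi, hint⟩ := hgs δ hδ hδs
  have hdi : Integrable (deriv (timeStep s δ)) :=
    timeStep_deriv_contDiff.continuous.integrable_of_hasCompactSupport
      (timeStep_deriv_hasCompactSupport hδ)
  have e1 : c - g s = ∫ τ, deriv (timeStep s δ) τ * (g τ - g s) := by
    simp only [mul_sub]
    rw [integral_sub hi (hdi.mul_const _), hint, integral_mul_const, integral_timeStep_deriv hδ,
      one_mul]
  rw [dist_comm, Real.dist_eq]
  change |c - g s| ≤ ε
  rw [e1]
  calc ‖∫ τ, deriv (timeStep s δ) τ * (g τ - g s)‖ ≤ ∫ τ, deriv (timeStep s δ) τ * ε := by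
        refine norm_integral_le_of_norm_le (hdi.mul_const _) (Eventually.of_forall fun τ => ?_)
        by_cases hτ : τ ∈ Icc s (s + δ)
        · rw [norm_mul, Real.norm_of_nonneg (timeStep_deriv_nonneg hδ τ)]
          refine mul_le_mul_of_nonneg_left (hclose ⟨hτ.1, hτ.2.trans hδs⟩ ?_).le
            (timeStep_deriv_nonneg hδ τ)
          rw [Real.dist_eq, abs_of_nonneg (by linarith [hτ.1])]
          linarith [hτ.2, min_le_left (δ' / 2) (s₁ - s)]
        · rw [timeStep_deriv_eq_zero hδ hτ]; simp
    _ = ε := by rw [integral_mul_const, integral_timeStep_deriv hδ, one_mul]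

end

/-! ### Conservation of constants. -/

section
variable {n N : ℕ}

theorem cutoff_eq_zero {k : ℕ} {x : Space n} (hx : 2 * (k + 1 : ℝ) ≤ ‖x‖) : cutoff n k x = 0 := by
  refine (baseCutoff n).zero_of_le_dist ?_
  rw [dist_zero_right, norm_smul, Real.norm_of_nonneg (by positivity), one_div,
    le_inv_mul_iff₀ (by positivity), mul_comm]
  exact hx

theorem partialDeriv_cutoff_eq_zero {k : ℕ} {x : Space n} (α : Fin n)
    (hx : ‖x‖ < k + 1 ∨ 2 * (k + 1 : ℝ) < ‖x‖) : partialDeriv α (cutoff n k) x = 0 := by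
  rcases hx with hx | hx
  · have : cutoff n k =ᶠ[𝓝 x] fun _ => 1 := by
      filter_upwards [continuous_norm.continuousAt.preimage_mem_nhds (Iio_mem_nhds hx)] with y hy
      exact cutoff_eq_one (le_of_lt hy)
    rw [partialDeriv, this.fderiv_eq]; simp
  · have : cutoff n k =ᶠ[𝓝 x] fun _ => 0 := by
      filter_upwards [continuous_norm.continuousAt.preimage_mem_nhds (Ioi_mem_nhds hx)] with y hy
      exact cutoff_eq_zero (le_of_lt hy)
    rw [partialDeriv, this.fderiv_eq]; simp

/-- Test functions that approximate a function of time. -/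
noncomputable def timeField (η : ℝ → ℝ) (x₀ : Space n) (m : ℕ) (X : SpaceTime n) : ℝ :=
  η X.1 * cutoff n m (X.2 - x₀)

section TimeField

variable {η : ℝ → ℝ} {x₀ : Space n} {m : ℕ}

theorem timeField_isTestFunction (hη : ContDiff ℝ ∞ η) (hηc : HasCompactSupport η) :
    IsTestFunction univ (timeField (n := n) η x₀ m) := by
  refine IsTestFunction.prod (W := fun x => cutoff n m (x - x₀)) hη hηc
    ((cutoff_contDiff m).comp (contDiff_id.sub contDiff_const)) ?_
  exact (cutoff_hasCompactSupport m).comp_homeomorph (Homeomorph.subRight x₀)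

theorem timeField_isTestFunction_of_le (hη : ContDiff ℝ ∞ η) (hηc : HasCompactSupport η) {a : ℝ}
    (ha : ∀ τ < a, η τ = 0) :
    IsTestFunction {X : SpaceTime n | a ≤ X.1} (timeField η x₀ m) := by
  have h := timeField_isTestFunction (x₀ := x₀) (m := m) hη hηc
  refine ⟨h.smooth, h.compact, closure_minimal (fun X hX => ?_)
    (isClosed_le continuous_const continuous_fst)⟩
  by_contra hlt
  exact hX (by simp [timeField, ha X.1 (not_le.1 hlt)])

theorem timeDeriv_timeField (hη : ContDiff ℝ ∞ η) (X : SpaceTime n) :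
    timeDeriv (timeField η x₀ m) X = deriv η X.1 * cutoff n m (X.2 - x₀) :=
  timeDeriv_prod (W := fun x => cutoff n m (x - x₀)) (hη.differentiable (by simp))
    (((cutoff_contDiff m).comp (contDiff_id.sub contDiff_const)).differentiable (by simp)) X

theorem spaceDeriv_timeField (hη : ContDiff ℝ ∞ η) (α : Fin n) (X : SpaceTime n) :
    spaceDeriv α (timeField η x₀ m) X = η X.1 * partialDeriv α (cutoff n m) (X.2 - x₀) := by
  have := spaceDeriv_prod (W := fun x => cutoff n m (x - x₀)) (hη.differentiable (by simp))
    (((cutoff_contDiff m).comp (contDiff_id.sub contDiff_const)).differentiable (by simp)) α X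
  refine this.trans ?_
  rw [partialDeriv, fderiv_comp_sub]; rfl

/-- The gradient is bounded uniformly in `m` and supported in a ball of radius `2(m + 1)` during a
fixed time interval. Only the polynomial growth matters, since it will be multiplied by `exp(-(m +
1))`. -/
theorem exists_integral_spaceGrad_timeField_le (n : ℕ) {a b : ℝ} (hab : a ≤ b) :
    ∃ C : ℝ, 0 ≤ C ∧ ∀ (η : ℝ → ℝ), ContDiff ℝ ∞ η → (∀ τ, |η τ| ≤ 1) →
      (∀ τ ∉ Icc a b, η τ = 0) → ∀ (x₀ : Space n) (m : ℕ),
      ∫ X, ‖spaceGrad (timeField η x₀ m) X‖ ^ 2 ≤ C * (m + 1 : ℝ) ^ n := by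
  obtain ⟨C, hC0, hC⟩ := exists_partialDeriv_cutoff_le n
  refine ⟨n * C ^ 2 * (b - a) * (2 ^ n * (volume (Metric.ball (0 : Space n) 1)).toReal),
    mul_nonneg (mul_nonneg (by positivity) (by linarith)) (by positivity), ?_⟩
  intro η hη hη1 hη0 x₀ m
  set S : Set (SpaceTime n) := Icc a b ×ˢ Metric.closedBall x₀ (2 * (m + 1))
  have hS : MeasurableSet S := measurableSet_Icc.prod measurableSet_closedBall
  have hSv : volume S = ENNReal.ofReal (b - a) * (ENNReal.ofReal ((2 * (m + 1 : ℝ)) ^ n) *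
      volume (Metric.ball (0 : Space n) 1)) := by
    rw [Measure.volume_eq_prod, Measure.prod_prod, Real.volume_Icc,
      Measure.addHaar_closedBall _ _ (by positivity), finrank_euclideanSpace_fin]
  have hSf : volume S ≠ ⊤ := by
    rw [hSv]
    exact ENNReal.mul_ne_top ENNReal.ofReal_ne_top
      (ENNReal.mul_ne_top ENNReal.ofReal_ne_top measure_ball_lt_top.ne)
  have hb : ∀ X, ‖spaceGrad (timeField η x₀ m) X‖ ^ 2
      ≤ S.indicator (fun _ => (n : ℝ) * C ^ 2) X := fun X => by
    rw [EuclideanSpace.real_norm_sq_eq]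
    simp only [spaceGrad, spaceDeriv_timeField hη]
    by_cases hX : X ∈ S
    · rw [indicator_of_mem hX]
      calc ∑ α, (η X.1 * partialDeriv α (cutoff n m) (X.2 - x₀)) ^ 2 ≤ ∑ _α : Fin n, C ^ 2 := by
            refine Finset.sum_le_sum fun α _ => sq_le_sq' ?_ ?_ <;>
            have h1 : |η X.1 * partialDeriv α (cutoff n m) (X.2 - x₀)| ≤ C := by
              rw [abs_mul]
              refine (mul_le_of_le_one_left (abs_nonneg _) (hη1 _)).trans ((hC m α _).trans ?_)
              exact div_le_self hC0 (by linarith [Nat.cast_nonneg (α := ℝ) m])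
            · exact (abs_le.1 h1).1
            · exact (abs_le.1 h1).2
        _ = _ := by simp
    · rw [indicator_of_notMem hX]
      refine (Finset.sum_eq_zero fun α _ => ?_).le
      by_cases h1 : X.1 ∈ Icc a b
      · have h2 : 2 * (m + 1 : ℝ) < ‖X.2 - x₀‖ := by
          by_contra hle
          exact hX ⟨h1, mem_closedBall_iff_norm.2 (not_lt.1 hle)⟩
        rw [partialDeriv_cutoff_eq_zero α (Or.inr h2), mul_zero, zero_pow two_ne_zero]
      · rw [hη0 _ h1, zero_mul, zero_pow two_ne_zero]
  calc ∫ X, ‖spaceGrad (timeField η x₀ m) X‖ ^ 2 ≤ ∫ X, S.indicator (fun _ => (n : ℝ) * C ^ 2) X :=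
        integral_mono_of_nonneg (Eventually.of_forall fun X => sq_nonneg _)
          ((integrableOn_const hSf).integrable_indicator hS) (Eventually.of_forall hb)
    _ = (volume S).toReal * (n * C ^ 2) := by
        rw [integral_indicator hS, setIntegral_const, smul_eq_mul, measureReal_def]
    _ = _ := by
        rw [hSv, ENNReal.toReal_mul, ENNReal.toReal_mul, ENNReal.toReal_ofReal (by linarith),
          ENNReal.toReal_ofReal (by positivity), mul_pow]
        ring

end TimeField

theorem exists_radius {m : ℝ} (hm : 0 < m) {Rc : ℝ≥0∞} (hRc : 0 < Rc) :
    ∃ r : ℝ, 0 < r ∧ r ≤ 1 ∧ r ^ 2 ≤ m ∧ ENNReal.ofReal r < Rc := by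
  obtain ⟨q, hq0, hq⟩ : ∃ q : ℝ, 0 < q ∧ ENNReal.ofReal q < Rc := by
    obtain ⟨q, hq0, hq⟩ := ENNReal.lt_iff_exists_nnreal_btwn.1 hRc
    exact ⟨q, by exact_mod_cast hq0, by rwa [ENNReal.ofReal_coe_nnreal]⟩
  refine ⟨min 1 (min m q), by positivity, min_le_left _ _, ?_,
    (ENNReal.ofReal_le_ofReal ((min_le_right _ _).trans (min_le_right _ _))).trans_lt hq⟩
  have h1 : min 1 (min m q) ≤ 1 := min_le_left _ _
  have h2 : min 1 (min m q) ≤ m := (min_le_right _ _).trans (min_le_left _ _)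
  have h3 : 0 < min 1 (min m q) := by positivity
  nlinarith

/-- The slices of the fundamental matrix have integral `1`. -/
theorem integral_fundamental_eq_one {lam Lam : ℝ} (hlam : 0 < lam) (hLam : 0 < Lam)
    {μ₀ C₀ : ℝ} (hμ : 0 < μ₀) (hC₀ : 0 < C₀) {Rc : ℝ≥0∞} (hRc : 0 < Rc) {A : Coeff n N}
    (hA : IsParabolic lam Lam A) (hPH : PropertyPH A μ₀ Rc C₀)
    {Γ : SpaceTime n → SpaceTime n → Matrix (Fin N) (Fin N) ℝ} (hΓ : IsFundamentalMatrix A Γ)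
    (hG : GaussianDominated Γ) {t s : ℝ} (hst : s < t) (x : Space n) (i k : Fin N) :
    Integrable (fun y => Γ (t, x) (s, y) i k) ∧
      ∫ y, Γ (t, x) (s, y) i k = (1 : Matrix (Fin N) (Fin N) ℝ) i k := by
  obtain ⟨C, hC, hpot⟩ := exists_potential_decay n N hlam hLam hμ hC₀
  set s₁ := (s + t) / 2 with hs₁
  have hs1 : s < s₁ := by rw [hs₁]; linarith
  have hs1t : s₁ < t := by rw [hs₁]; linarith
  obtain ⟨M, c, hM, hc, hdom⟩ := hG (t - s₁) (t - s) (by linarith)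
  set v : SpaceTime n → ℝ := fun Y => Γ (t, x) Y i k with hv
  have hb : Integrable fun y : Space n => M * Real.exp (-c * ‖x - y‖ ^ 2) :=
    (integrable_exp_neg_mul_norm_sq hc x).const_mul M
  have hvb : ∀ τ ∈ Icc s s₁, ∀ y, |v (τ, y)| ≤ M * Real.exp (-c * ‖x - y‖ ^ 2) :=
    fun τ hτ y => hdom t τ (by linarith [hτ.2]) (by linarith [hτ.1]) x y i k
  have hvc : ∀ τ ∈ Icc s s₁, ∀ y, ContinuousAt v (τ, y) := fun τ hτ y =>
    hΓ.continuousAt_right (fun h => by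
      have h2 : t = τ := congrArg Prod.fst h
      linarith [hτ.2]) i k
  refine ⟨?_, ?_⟩
  · refine hb.mono' (Continuous.aestronglyMeasurable (continuous_iff_continuousAt.2 fun y => ?_))
      (Eventually.of_forall fun y => hvb s ⟨le_rfl, hs1.le⟩ y)
    exact ContinuousAt.comp (f := fun y => (s, y)) (g := v) (hvc s ⟨le_rfl, hs1.le⟩ y)
      (by fun_prop)
  refine integral_slice_eq (v := v) hs1 hb hvc hvb fun δ hδ hδs => ?_
  have hpi := integrable_deriv_timeStep_mul hδ hδs hb hvc hvb
  set T := t - s with hT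
  have hT0 : 0 < T := by linarith
  obtain ⟨r, hr0, hr1, hr2, hrR⟩ := exists_radius (m := t - s₁) (by linarith) hRc
  -- The function rises from `0` to `1` on `[s, s + δ]` and equals `1` at time `t`. It is switched
  -- off only after `t + 1`, for compact support; by causality of `Γ` this is not felt at time `t`.
  set η : ℝ → ℝ := fun τ => timeStep s δ τ * (1 - timeStep (t + 1) 1 τ) with hη
  have hηs : ContDiff ℝ ∞ η := timeStep_contDiff.mul (contDiff_const.sub timeStep_contDiff)
  have hη0 : ∀ τ ∉ Icc s (t + 2), η τ = 0 := fun τ hτ => by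
    rw [mem_Icc, not_and_or, not_le, not_le] at hτ
    rcases hτ with h | h
    · simp only [hη]; rw [timeStep_eq_zero hδ h.le, zero_mul]
    · simp only [hη]; rw [timeStep_eq_one one_pos (by linarith), sub_self, mul_zero]
  have hη1 : ∀ τ, |η τ| ≤ 1 := fun τ => by
    rw [hη, abs_mul, abs_of_nonneg (sub_nonneg.2 (timeStep_le_one _))]
    refine mul_le_one₀ (abs_timeStep_le _) (sub_nonneg.2 (timeStep_le_one _)) ?_
    linarith [timeStep_nonneg (s := t + 1) (δ := 1) τ]
  have hηc : HasCompactSupport η := HasCompactSupport.intro isCompact_Icc hη0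
  have hηst : ∀ τ < t + 1, η =ᶠ[𝓝 τ] timeStep s δ := fun τ hτ => by
    filter_upwards [Iio_mem_nhds hτ] with σ hσ
    simp only [hη]; rw [timeStep_eq_zero one_pos (le_of_lt hσ), sub_zero, mul_one]
  have hηt : η t = 1 := by
    rw [(hηst t (by linarith)).self_of_nhds, timeStep_eq_one hδ (by linarith)]
  have hηlt : ∀ τ < s, η τ = 0 := fun τ hτ => hη0 τ fun h => by linarith [h.1]
  obtain ⟨C', hC'0, hC'⟩ := exists_integral_spaceGrad_timeField_le n
    (a := s) (b := t + 2) (by linarith)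
  -- A spatially cut-off version of the constant vector `e_k`, switched on in time. Its gradient
  -- vanishes within distance `m + 1` of `x`.
  set φ : ℕ → Fin N → SpaceTime n → ℝ := fun m => Pi.single k (timeField η x m) with hφ
  have hφt : ∀ m j, IsTestFunction {X : SpaceTime n | s ≤ X.1} (φ m j) := fun m j =>
    (timeField_isTestFunction_of_le hηs hηc hηlt).pi_single k j
  have htD : ∀ m j X, j ≠ k → timeDeriv (φ m j) X = 0 := fun m j X hj => by
    simp only [hφ]; rw [Pi.single_eq_of_ne hj, timeDeriv_zero]
  have hsD : ∀ (m : ℕ) j X, ‖X.2 - x‖ < m + 1 → spaceGrad (φ m j) X = 0 := fun m j X hX => by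
    ext α
    by_cases hj : j = k
    · subst hj
      simp only [spaceGrad, hφ, Pi.single_eq_same, spaceDeriv_timeField hηs]
      rw [partialDeriv_cutoff_eq_zero α (Or.inl hX)]; simp
    · simp only [spaceGrad, hφ]; rw [Pi.single_eq_of_ne hj, spaceDeriv_zero]; simp
  have hfl : ∀ (m : ℕ) j X, ‖X.2 - x‖ < m + 1 →
      (WithLp.toLp 2 fun _ : Fin n => (0 : ℝ)) - flux A (fun i => spaceGrad (φ m i)) j X = 0 :=
    fun m j X hX => by
      ext α
      rw [PiLp.sub_apply, flux_apply]
      simp [hsD m _ X hX]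
  have hkey : ∀ m : ℕ, ((∫ Y : SpaceTime n, (deriv (timeStep s δ) Y.1 * v Y)
        * cutoff n m (Y.2 - x)) - (1 : Matrix (Fin N) (Fin N) ℝ) i k) ^ 2
      ≤ C * ((r ^ (n + 2))⁻¹ * T * Real.exp (2 * energyRate lam Lam * T + 4 * r)
        * (Lam ^ 2 * C')) * ((m + 1 : ℝ) ^ n * Real.exp (-(m + 1 : ℝ))) := fun m => by
    have hball : ∀ X ∈ backwardCyl ((t, x) : SpaceTime n) r, ‖X.2 - x‖ < m + 1 := fun X hX => by
      have h1 : ‖X.2 - x‖ < r := mem_ball_iff_norm.1 hX.2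
      linarith [Nat.cast_nonneg (α := ℝ) m]
    have hnot : ∀ j, ((t, x) : SpaceTime n) ∉ tsupport fun Y => (0 : SpaceTime n → ℝ) Y
        + timeDeriv (φ m j) Y - ∑ α : Fin n, spaceDeriv α (0 : SpaceTime n → ℝ) Y := fun j => by
      rw [notMem_tsupport_iff_eventuallyEq]
      have hn : Prod.fst ⁻¹' Ioo (s + δ) (t + 1) ∈ 𝓝 ((t, x) : SpaceTime n) :=
        continuousAt_fst.preimage_mem_nhds (Ioo_mem_nhds (by
          change s + δ < t; linarith) (by change t < t + 1; linarith))
      filter_upwards [hn] with Y hY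
      have h1 : timeDeriv (φ m j) Y = 0 := by
        by_cases hj : j = k
        · subst hj
          simp only [hφ, Pi.single_eq_same]
          rw [timeDeriv_timeField hηs, (hηst Y.1 hY.2).deriv_eq,
            timeStep_deriv_eq_zero hδ fun h => by linarith [hY.1, h.2], zero_mul]
        · exact htD m j Y hj
      simp [h1, spaceDeriv_zero]
    -- With `F = 0` and `h = 0` the potential of `φ_t` differs from `φ` by a solution whose only
    -- source is the flux `-A Dφ`, located at distance at least `m + 1`. Taking `ϱ = 1` already
    -- gives the factor `exp(-(m + 1))`.
    have h := hpot Rc A hA hPH Γ hΓ (t, x) r hr0 hrR T s (m + 1) 1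
      (by change s ≤ t - r ^ 2; linarith) le_rfl (by positivity) zero_le_one
      (fun _ => (0 : SpaceTime n → ℝ)) (φ m)
      (fun _ _ => (0 : SpaceTime n → ℝ)) (fun _ => IsTestFunction.zero) (hφt m)
      (fun _ _ => IsTestFunction.zero)
      (fun _ _ _ => rfl) (fun j X hX => hfl m j X (hball X hX)) (fun _ _ _ => rfl)
      (fun j X hX => hfl m j X hX) hnot i
    have hpv := hΓ.potential_source (F := fun _ => (0 : SpaceTime n → ℝ)) (φ := φ m)
      (h := fun _ _ => (0 : SpaceTime n → ℝ))
      (fun _ => IsTestFunction.zero) (fun j => (hφt m j).to_univ)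
      (fun _ _ => IsTestFunction.zero) i (t, x)
    rw [hpv] at h
    have e1 : ∑ j, ((∫ Y, Γ (t, x) Y i j * (0 : SpaceTime n → ℝ) Y)
        + (∫ Y, Γ (t, x) Y i j * timeDeriv (φ m j) Y)
        - ∑ α : Fin n, ∫ Y, Γ (t, x) Y i j * spaceDeriv α (0 : SpaceTime n → ℝ) Y)
        = ∫ Y : SpaceTime n, (deriv (timeStep s δ) Y.1 * v Y) * cutoff n m (Y.2 - x) := by
      simp only [Pi.zero_apply, mul_zero, integral_zero, zero_add, spaceDeriv_zero,
        Finset.sum_const_zero, sub_zero]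
      rw [Finset.sum_eq_single k]
      · refine integral_congr_ae (Eventually.of_forall fun Y => ?_)
        simp only [hφ, Pi.single_eq_same, hv]
        rw [timeDeriv_timeField hηs]
        -- For times after `t` the kernel vanishes; up to `t` the derivative of `η` is that of the
        -- step.
        rcases lt_or_ge t Y.1 with hY | hY
        · rw [hΓ.causal (t, x) Y hY]; simp
        · rw [(hηst Y.1 (by linarith)).deriv_eq]; ring
      · intro j _ hj; simp [htD m j _ hj]
      · simp
    have e2 : φ m i (t, x) = (1 : Matrix (Fin N) (Fin N) ℝ) i k := by
      by_cases hik : i = k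
      · subst hik
        rw [Matrix.one_apply_eq]
        simp only [hφ, Pi.single_eq_same, timeField, hηt, sub_self, one_mul]
        exact cutoff_eq_one (by rw [norm_zero]; positivity)
      · rw [Matrix.one_apply_ne hik]
        simp only [hφ]; rw [Pi.single_eq_of_ne hik]; rfl
    rw [e1, e2] at h
    refine h.trans ?_
    have e3 : ∫ X : SpaceTime n, ∑ _j : Fin N, (0 : SpaceTime n → ℝ) X ^ 2 = 0 := by simp
    have e4 : ∫ X, ∑ j, ‖(WithLp.toLp 2 fun _ : Fin n => (0 : SpaceTime n → ℝ) X)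
        - flux A (fun i => spaceGrad (φ m i)) j X‖ ^ 2 ≤ Lam ^ 2 * (C' * (m + 1 : ℝ) ^ n) := by
      have h5 : ∀ X, ∑ j, ‖spaceGrad (φ m j) X‖ ^ 2 = ‖spaceGrad (timeField η x m) X‖ ^ 2 :=
        fun X => by
          rw [Finset.sum_eq_single k]
          · simp [hφ]
          · intro j _ hj
            have : spaceGrad (φ m j) X = 0 := by
              ext α; simp only [spaceGrad, hφ]; rw [Pi.single_eq_of_ne hj, spaceDeriv_zero]; simp
            rw [this, norm_zero, zero_pow two_ne_zero]
          · simp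
      have h6 : Integrable fun X => ‖spaceGrad (timeField η x m) X‖ ^ 2 :=
        (memLp_spaceGrad (timeField_isTestFunction hηs hηc)).integrable_norm_pow (by norm_num)
      calc _ ≤ ∫ X, Lam ^ 2 * ‖spaceGrad (timeField η x m) X‖ ^ 2 := by
            refine integral_mono_of_nonneg (Eventually.of_forall fun X =>
              Finset.sum_nonneg fun _ _ => sq_nonneg _) (h6.const_mul _)
              (Eventually.of_forall fun X => ?_)
            simp only
            rw [← h5]
            refine le_trans (le_of_eq ?_) (flux_sq_le hA _ X)
            refine Finset.sum_congr rfl fun j _ => ?_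
            have : (WithLp.toLp 2 fun _ : Fin n => (0 : SpaceTime n → ℝ) X) = (0 : Space n) := by
              ext α; simp
            rw [this, zero_sub, norm_neg]
        _ = Lam ^ 2 * ∫ X, ‖spaceGrad (timeField η x m) X‖ ^ 2 := integral_const_mul _ _
        _ ≤ _ := by gcongr; exact hC' η hηs hη1 hη0 x m
    have e5 : Real.exp (2 * energyRate lam Lam * 1 ^ 2 * T + 4 * 1 * r - 1 * (m + 1 : ℝ))
        = Real.exp (2 * energyRate lam Lam * T + 4 * r) * Real.exp (-(m + 1 : ℝ)) := by
      rw [← Real.exp_add]; congr 1; ring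
    rw [e3, mul_zero, zero_add, e5]
    calc _ ≤ C * ((r ^ (n + 2))⁻¹ * T * (Real.exp (2 * energyRate lam Lam * T + 4 * r)
          * Real.exp (-(m + 1 : ℝ))) * (Lam ^ 2 * (C' * (m + 1 : ℝ) ^ n))) := by gcongr
      _ = _ := by ring
  have hlim1 : Tendsto (fun m : ℕ => ∫ Y : SpaceTime n, (deriv (timeStep s δ) Y.1 * v Y)
      * cutoff n m (Y.2 - x)) atTop (𝓝 (∫ Y : SpaceTime n, deriv (timeStep s δ) Y.1 * v Y)) := by
    refine tendsto_integral_of_dominated_convergence _ (fun m => ?_) hpi.norm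
      (fun m => Eventually.of_forall fun Y => ?_) (Eventually.of_forall fun Y => ?_)
    · exact hpi.aestronglyMeasurable.mul (((cutoff_contDiff m).continuous.comp
        (continuous_snd.sub continuous_const)).aestronglyMeasurable)
    · rw [norm_mul]
      exact mul_le_of_le_one_right (norm_nonneg _) (abs_cutoff_le m _)
    · simpa using (tendsto_cutoff (Y.2 - x)).const_mul (deriv (timeStep s δ) Y.1 * v Y)
  have hlim2 : Tendsto (fun m : ℕ => C * ((r ^ (n + 2))⁻¹ * T
      * Real.exp (2 * energyRate lam Lam * T + 4 * r)
      * (Lam ^ 2 * C')) * ((m + 1 : ℝ) ^ n * Real.exp (-(m + 1 : ℝ)))) atTop (𝓝 0) := by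
    have h1 : Tendsto (fun m : ℕ => (m + 1 : ℝ)) atTop atTop :=
      tendsto_atTop_add_const_right _ _ tendsto_natCast_atTop_atTop
    simpa using ((Real.tendsto_pow_mul_exp_neg_atTop_nhds_zero n).comp h1).const_mul _
  -- As `m → ∞` the cutoffs disappear and the error tends to zero, so the time average of the entry
  -- of `Γ` is exactly that of the identity matrix.
  have hS := le_of_tendsto_of_tendsto' ((hlim1.sub_const _).pow 2) hlim2 hkey
  exact sub_eq_zero.1 (pow_eq_zero_iff two_ne_zero |>.1 (le_antisymm hS (sq_nonneg _)))

end

/-! ### Cutoffs in time, bounds of potentials, and approximate identities. -/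

section
variable {n N : ℕ}

theorem SlabL2.bdd_mul {G : Type*} [NormedAddCommGroup G] [NormedSpace ℝ G]
    {f : SpaceTime n → G} (hf : SlabL2 f) {η : ℝ → ℝ}
    (hη : Continuous η) {C : ℝ} (hC : ∀ τ, |η τ| ≤ C) : SlabL2 (fun X => η X.1 • f X) := fun T =>
  MemLp.of_le_mul (c := C) (hf T)
    ((hη.comp continuous_fst).aestronglyMeasurable.smul (hf T).aestronglyMeasurable)
    (Eventually.of_forall fun X => by
      rw [norm_smul]; exact mul_le_mul_of_nonneg_right (hC _) (norm_nonneg _))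

theorem SlabL2.memLp_mul {f : SpaceTime n → ℝ} (hf : SlabL2 f) {h : ℝ → ℝ} (hh : Continuous h)
    (hc : HasCompactSupport h) : MemLp (fun X => h X.1 * f X) 2 volume := by
  obtain ⟨C, hC⟩ := hc.exists_bound_of_continuous hh
  obtain ⟨T, hT⟩ := hc.isCompact.isBounded.subset_ball (0 : ℝ)
  have hS : MeasurableSet (Ioo (-T) T ×ˢ (univ : Set (Space n))) :=
    measurableSet_Ioo.prod MeasurableSet.univ
  have h1 := (memLp_indicator_iff_restrict hS).2 (hf.bdd_mul hh hC T)
  refine h1.ae_eq (Eventually.of_forall fun X => ?_)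
  by_cases hX : X ∈ Ioo (-T) T ×ˢ (univ : Set (Space n))
  · rw [indicator_of_mem hX]; rfl
  · have h0 : h X.1 = 0 := image_eq_zero_of_notMem_tsupport fun hX' => by
      have := hT hX'
      rw [Real.ball_eq_Ioo, zero_sub, zero_add] at this
      exact hX ⟨this, mem_univ _⟩
    rw [indicator_of_notMem hX]; simp only [h0, zero_mul]

/-- Multiplication of a solution by a function of time. -/
theorem GlobalSol.time_mul {A : Coeff n N} {F u : Fin N → SpaceTime n → ℝ} {Du : Fin N → SpaceTime n → Space n}
    (hu : GlobalSol A F (fun _ _ => 0) u Du) {η : ℝ → ℝ} (hη : ContDiff ℝ ∞ η) {C C' : ℝ}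
    (hC : ∀ τ, |η τ| ≤ C) (hC' : ∀ τ, |deriv η τ| ≤ C') (hηF : ∀ i X, η X.1 * F i X = 0) :
    GlobalSol A (fun i X => deriv η X.1 * u i X) (fun _ _ => 0) (fun i X => η X.1 * u i X)
      (fun i X => η X.1 • Du i X) := by
  have hη' : Continuous (deriv η) := (contDiff_infty_iff_deriv.1 hη).2.continuous
  have hηs : ContDiff ℝ ∞ fun X : SpaceTime n => η X.1 := hη.comp contDiff_fst
  have hηd : Differentiable ℝ fun X : SpaceTime n => η X.1 := hηs.differentiable (by simp)
  have hsd : ∀ {φ : SpaceTime n → ℝ}, IsTestFunction univ φ → ∀ α X,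
      spaceDeriv α (fun X => η X.1 * φ X) X = η X.1 * spaceDeriv α φ X := fun {φ} hφ α X => by
    rw [spaceDeriv_mul α (hηd X) (hφ.differentiable X),
      spaceDeriv_fst η (hη.differentiable (by simp)), zero_mul, add_zero]
  have htd : ∀ {φ : SpaceTime n → ℝ}, IsTestFunction univ φ → ∀ X,
      timeDeriv (fun X => η X.1 * φ X) X = η X.1 * timeDeriv φ X + deriv η X.1 * φ X :=
    fun {φ} hφ X => by
      rw [timeDeriv_mul (hηd X) (hφ.differentiable X),
        timeDeriv_fst η (hη.differentiable (by simp))]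
  refine ⟨fun i => (hu.memL2 i).bdd_mul hη' hC', fun i => MemLp.slabL2 MemLp.zero,
    fun i => (hu.memL2 i).bdd_mul hη.continuous hC,
    fun i => (hu.memL2_grad i).bdd_mul hη.continuous hC, fun i φ hφ α => ?_, fun i φ hφ => ?_⟩
  · have h := hu.weakGrad i _ (hφ.mul_left hηs) α
    rw [setIntegral_univ, setIntegral_univ] at *
    simp only [hsd hφ] at h
    simp only [PiLp.smul_apply, smul_eq_mul]
    convert h using 2
    · ext X; ring
    · congr 1; ext X; ring
  · have h := hu.eqn i _ (hφ.mul_left hηs)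
    simp only [hsd hφ, htd hφ, PiLp.zero_apply, zero_mul, integral_zero, Finset.sum_const_zero,
      add_zero] at h ⊢
    have i1 : Integrable fun X => u i X * (η X.1 * timeDeriv φ X) :=
      (hu.memL2 i).integrable_mul (hφ.timeDeriv.mul_left hηs)
    have i2 : Integrable fun X => u i X * (deriv η X.1 * φ X) := by
      have := ((hu.memL2 i).bdd_mul hη' hC').integrable_mul hφ
      refine this.congr (Eventually.of_forall fun X => ?_)
      simp only [smul_eq_mul]; ring
    have e0 : ∫ X, F i X * (η X.1 * φ X) = 0 := by
      rw [← integral_zero (SpaceTime n) ℝ]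
      refine integral_congr_ae (Eventually.of_forall fun X => ?_)
      simp only
      rw [← mul_assoc, mul_comm (F i X), hηF, zero_mul]
    simp only [mul_add] at h
    rw [integral_add i1 i2, e0] at h
    have e1 : ∫ X, η X.1 * u i X * timeDeriv φ X = ∫ X, u i X * (η X.1 * timeDeriv φ X) :=
      integral_congr_ae (Eventually.of_forall fun X => by simp only; ring)
    have e2 : ∫ X, deriv η X.1 * u i X * φ X = ∫ X, u i X * (deriv η X.1 * φ X) :=
      integral_congr_ae (Eventually.of_forall fun X => by simp only; ring)
    have e3 : ∀ α, ∫ X, flux A (fun i X => η X.1 • Du i X) i X α * spaceDeriv α φ X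
        = ∫ X, flux A Du i X α * (η X.1 * spaceDeriv α φ X) := fun α =>
      integral_congr_ae (Eventually.of_forall fun X => by
        simp only [flux_apply, PiLp.smul_apply, smul_eq_mul, Finset.sum_mul]
        exact Finset.sum_congr rfl fun j _ => Finset.sum_congr rfl fun β _ => by ring)
    rw [e1, e2]
    simp only [e3]
    linarith

/-- A crude `L¹`–`L^∞` bound. It is used where time separation makes the kernel bounded, and its
constant depends on the source only through its mass, so it is uniform for approximations of a Dirac
mass. -/
theorem abs_potential_le {Γ : SpaceTime n → SpaceTime n → Matrix (Fin N) (Fin N) ℝ}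
    {f : Fin N → SpaceTime n → ℝ} {U : Set (SpaceTime n)} (hf : ∀ j, IsTestFunction U (f j))
    {M : ℝ} {X : SpaceTime n} (i : Fin N) (hM : ∀ Y ∈ U, ∀ j, |Γ X Y i j| ≤ M) :
    |potential Γ f i X| ≤ M * ∑ j, ∫ Y, |f j Y| := by
  rw [← integral_finsetSum _ fun j _ => (hf j).integrable.abs, ← integral_const_mul]
  change ‖∫ Y, ∑ j, Γ X Y i j * f j Y‖ ≤ _
  refine norm_integral_le_of_norm_le
    ((integrable_finsetSum _ fun j _ => (hf j).integrable.abs).const_mul M)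
    (Eventually.of_forall fun Y => ?_)
  rw [Finset.mul_sum]
  refine (norm_sum_le _ _).trans (Finset.sum_le_sum fun j _ => ?_)
  by_cases hY : Y ∈ U
  · rw [norm_mul]; exact mul_le_mul_of_nonneg_right (hM Y hY j) (abs_nonneg _)
  · rw [(hf j).eq_zero hY]; simp

/-- Averages against a mollifier converge at points of continuity. -/
theorem tendsto_integral_mul_mollifier {g : SpaceTime n → ℝ} {x : SpaceTime n}
    (hg : ContinuousAt g x)
    (hi : ∀ m, Integrable fun y => g y * mollifier (volume : Measure (SpaceTime n)) m (x - y)) :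
    Tendsto (fun m => ∫ y, g y * mollifier (volume : Measure (SpaceTime n)) m (x - y)) atTop
      (𝓝 (g x)) := by
  have hmi : ∀ m, Integrable fun y => mollifier (volume : Measure (SpaceTime n)) m (x - y) :=
    fun m => (mollifier_comp_sub_contDiff m x).continuous.integrable_of_hasCompactSupport
      (mollifier_comp_sub_hasCompactSupport m x)
  have hm1 : ∀ m, ∫ y, mollifier (volume : Measure (SpaceTime n)) m (x - y) = 1 := fun m => by
    rw [integral_sub_left_eq_self]
    exact ContDiffBump.integral_normed _
  rw [Metric.tendsto_atTop]
  intro ε hε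
  obtain ⟨δ, hδ, hcl⟩ := Metric.continuousAt_iff.1 hg (ε / 2) (by positivity)
  obtain ⟨m₀, hm₀⟩ := exists_nat_one_div_lt hδ
  refine ⟨m₀, fun m hm => ?_⟩
  have e1 : (∫ y, g y * mollifier (volume : Measure (SpaceTime n)) m (x - y)) - g x
      = ∫ y, (g y - g x) * mollifier (volume : Measure (SpaceTime n)) m (x - y) := by
    simp only [sub_mul]
    rw [integral_sub (hi m) ((hmi m).const_mul _), integral_const_mul, hm1, mul_one]
  have e2 : ∫ y, ε / 2 * mollifier (volume : Measure (SpaceTime n)) m (x - y) = ε / 2 := by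
    rw [integral_const_mul, hm1, mul_one]
  rw [dist_eq_norm, e1]
  refine lt_of_le_of_lt ((norm_integral_le_of_norm_le ((hmi m).const_mul (ε / 2))
    (Eventually.of_forall fun y => ?_)).trans_eq e2) (by linarith)
  rw [norm_mul, Real.norm_of_nonneg (mollifier_nonneg m _)]
  by_cases hy : (1 : ℝ) / (m + 1) ≤ ‖x - y‖
  · rw [mollifier_eq_zero m hy]; simp
  · refine mul_le_mul_of_nonneg_right (hcl ?_).le (mollifier_nonneg m _)
    rw [dist_comm, dist_eq_norm]
    exact (not_le.1 hy).trans_le ((one_div_le_one_div_of_le (by positivity)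
      (by exact_mod_cast Nat.add_le_add_right hm 1)).trans hm₀.le)

end

/-! ### Propagation of potentials and the Chapman–Kolmogorov identity. -/

section
variable {n N : ℕ}

/-- Potentials are propagated by the fundamental matrix. -/
theorem integral_mul_potential_eq {lam Lam : ℝ} (hlam : 0 < lam) (hLam : 0 < Lam)
    {μ₀ C₀ : ℝ} (hμ : 0 < μ₀) (hC₀ : 0 < C₀) {Rc : ℝ≥0∞} (hRc : 0 < Rc) {A : Coeff n N}
    (hA : IsParabolic lam Lam A) (hPH : PropertyPH A μ₀ Rc C₀)
    {Γ : SpaceTime n → SpaceTime n → Matrix (Fin N) (Fin N) ℝ} (hΓ : IsFundamentalMatrix A Γ)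
    (hG : GaussianDominated Γ) {t ρ σ a : ℝ} (hσρ : σ < ρ) (hρt : ρ < t) (x : Space n)
    {f : Fin N → SpaceTime n → ℝ}
    (hf : ∀ k, IsTestFunction {X : SpaceTime n | a ≤ X.1 ∧ X.1 ≤ σ} (f k)) (i : Fin N) :
    ∫ z, ∑ k, Γ (t, x) (ρ, z) i k * potential Γ f k (ρ, z) = potential Γ f i (t, x) := by
  obtain ⟨C, hC, hpot⟩ := exists_pointwise_decay n N hlam hLam hμ hC₀
  -- The averaging takes place in `[ρ, s₁]`, and the approximating sources live before `s₂`. This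
  -- leaves room below `t` for a cylinder in which all sources vanish.
  set s₁ := (ρ + t) / 2 with hs₁
  set s₂ := (s₁ + t) / 2 with hs₂
  have hρs : ρ < s₁ := by linarith
  have hs12 : s₁ < s₂ := by linarith
  have hs2t : s₂ < t := by linarith
  have hft : ∀ k, IsTestFunction univ (f k) := fun k => (hf k).to_univ
  obtain ⟨B, hB⟩ : ∃ B : ℝ, ∀ τ ∈ Icc ρ s₁, ∀ z k, |potential Γ f k (τ, z)| ≤ B := by
    obtain ⟨M, c, hM, hc, hdom⟩ := hG (ρ - σ) (t - a) (by linarith)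
    refine ⟨M * ∑ j, ∫ Y, |f j Y|, fun τ hτ z k => abs_potential_le hf k fun Y hY j => ?_⟩
    refine (hdom τ Y.1 (by linarith [hτ.1, hY.2]) (by linarith [hτ.2, hY.1]) z Y.2 k j).trans ?_
    refine mul_le_of_le_one_right hM.le (Real.exp_le_one_iff.2 ?_)
    nlinarith [sq_nonneg ‖z - Y.2‖]
  obtain ⟨M, c, hM, hc, hdom⟩ := hG (t - s₂) (t - (ρ - 1)) (by linarith)
  have hgi : Integrable fun y : Space n => Real.exp (-c * ‖x - y‖ ^ 2) :=
    integrable_exp_neg_mul_norm_sq hc x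
  have hΓb : ∀ τ, ρ - 1 ≤ τ → τ ≤ s₂ → ∀ z k,
      |Γ (t, x) (τ, z) i k| ≤ M * Real.exp (-c * ‖x - z‖ ^ 2) := fun τ h1 h2 z k =>
    hdom t τ (by linarith) (by linarith) x z i k
  have hΓc : ∀ Y : SpaceTime n, Y.1 ≤ s₂ → ∀ k, ContinuousAt (fun Y => Γ (t, x) Y i k) Y :=
    fun Y hY k => hΓ.continuousAt_right (fun h => by
      have h2 : t = Y.1 := congrArg Prod.fst h
      linarith) i k
  have huc : ∀ Y : SpaceTime n, σ < Y.1 → ∀ k, ContinuousAt (potential Γ f k) Y := fun Y hY k =>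
    hΓ.continuousAt_potential hft (fun j h => by
      have := ((hf j).support h).2
      linarith) k
  set v : SpaceTime n → ℝ := fun Y => ∑ k, Γ (t, x) Y i k * potential Γ f k Y with hv
  have hb : Integrable fun y : Space n => ∑ _k : Fin N, M * Real.exp (-c * ‖x - y‖ ^ 2) * B :=
    integrable_finsetSum _ fun k _ => (hgi.const_mul M).mul_const B
  have hvc : ∀ τ ∈ Icc ρ s₁, ∀ z, ContinuousAt v (τ, z) := fun τ hτ z =>
    tendsto_finsetSum _ fun k _ => (hΓc (τ, z) (by change τ ≤ s₂; linarith [hτ.2]) k).mul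
      (huc (τ, z) (by change σ < τ; linarith [hτ.1]) k)
  have hvb : ∀ τ ∈ Icc ρ s₁, ∀ z, |v (τ, z)| ≤ ∑ _k : Fin N, M * Real.exp (-c * ‖x - z‖ ^ 2) * B :=
    fun τ hτ z => by
      refine (Finset.abs_sum_le_sum_abs _ _).trans (Finset.sum_le_sum fun k _ => ?_)
      rw [abs_mul]
      exact mul_le_mul (hΓb τ (by linarith [hτ.1]) (by linarith [hτ.2]) z k) (hB τ hτ z k)
        (abs_nonneg _) (by positivity)
  refine integral_slice_eq (v := v) hρs hb hvc hvb fun δ hδ hδs => ?_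
  set h : ℝ → ℝ := deriv (timeStep ρ δ) with hh
  have hhc : Continuous h := timeStep_deriv_contDiff.continuous
  have hhcs : HasCompactSupport h := timeStep_deriv_hasCompactSupport hδ
  obtain ⟨C', hC'⟩ := hhcs.exists_bound_of_continuous hhc
  have hh0 : ∀ τ, τ ∉ Icc ρ s₁ → h τ = 0 := fun τ hτ =>
    timeStep_deriv_eq_zero hδ fun h => hτ ⟨h.1, h.2.trans hδs⟩
  obtain ⟨Du, hu, hub⟩ := hΓ.globalSol hA hLam hft
  -- Let `θ` be the time step starting at `ρ`. As `f` vanishes after `σ < ρ`, the product `θu`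
  -- solves the equation with source `θ'u` alone, and it equals `u` at time `t`.
  have hw := hu.time_mul (timeStep_contDiff (s := ρ) (δ := δ))
    (abs_timeStep_le (s := ρ) (δ := δ)) hC' (fun j X => by
      by_cases hX : X.1 ≤ ρ
      · rw [timeStep_eq_zero hδ hX, zero_mul]
      · rw [(hf j).eq_zero fun h => hX (by linarith [h.2]), mul_zero])
  set F : Fin N → SpaceTime n → ℝ := fun k X => h X.1 * potential Γ f k X with hF
  have hFL2 : ∀ k, MemLp (F k) 2 volume := fun k => (hu.memL2 k).memLp_mul hhc hhcs
  -- approximation of the source by test functions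
  set U : Set (SpaceTime n) := {X | ρ - 1 ≤ X.1 ∧ X.1 ≤ s₂} with hU
  have hUc : IsClosed U := (isClosed_le continuous_const continuous_fst).inter
    (isClosed_le continuous_fst continuous_const)
  set χ : SpaceTime n → ℝ := fun X =>
    timeStep (ρ - 1) 1 X.1 * (1 - timeStep s₁ (s₂ - s₁) X.1) with hχ
  have hχ0 : ∀ X ∉ U, χ X = 0 := fun X hX => by
    by_cases h1 : ρ - 1 ≤ X.1
    · have h2 : s₂ < X.1 := by
        by_contra h2; exact hX ⟨h1, not_lt.1 h2⟩
      simp only [hχ]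
      rw [timeStep_eq_one (s := s₁) (by linarith) (by linarith), sub_self, mul_zero]
    · simp only [hχ]
      rw [timeStep_eq_zero (s := ρ - 1) one_pos (by linarith), zero_mul]
  have hχs : ContDiff ℝ ∞ χ := (timeStep_contDiff.comp contDiff_fst).mul
    (contDiff_const.sub (timeStep_contDiff.comp contDiff_fst))
  choose g hg hgF using fun k => exists_tendsto_testFunction (U := U) (H := F k) hχs
    (fun X => by
      rw [hχ, abs_mul, abs_of_nonneg (sub_nonneg.2 (timeStep_le_one _))]
      refine mul_le_one₀ (abs_timeStep_le _) (sub_nonneg.2 (timeStep_le_one _)) ?_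
      linarith [timeStep_nonneg (s := s₁) (δ := s₂ - s₁) X.1])
    (closure_minimal (fun X hX => by by_contra h; exact hX (hχ0 X h)) hUc) (hFL2 k)
    (fun X => by
      by_cases hX : X.1 ∈ Icc ρ s₁
      · simp only [hχ]
        rw [timeStep_eq_one (s := ρ - 1) one_pos (by linarith [hX.1]),
          timeStep_eq_zero (s := s₁) (by linarith) hX.2]
        ring
      · simp only [hF]; rw [hh0 _ hX]; ring)
  obtain ⟨r, hr0, hr1, hr2, hrR⟩ := exists_radius (m := t - s₂) (by linarith) hRc
  set T := t - (ρ - 1) with hT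
  have hUa : ∀ X : SpaceTime n, X.1 < ρ - 1 → X ∉ U := fun X hX h => by linarith [h.1]
  have hUI : ∀ X : SpaceTime n, X.1 < ρ - 1 → X.1 ∉ Icc ρ s₁ := fun X hX h => by linarith [h.1]
  have hQt : ∀ X ∈ backwardCyl ((t, x) : SpaceTime n) r, s₂ < X.1 := fun X hX => by
    have : t - r ^ 2 < X.1 := hX.1.1
    linarith
  have hts₂ : ((t, x) : SpaceTime n) ∉ U := fun h => by
    have : t ≤ s₂ := h.2
    linarith
  -- The source `θ'u` lies in `L²` but is not a test function. The difference between the potential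
  -- of `g` and `θu` has source `g - θ'u`, so the decay estimate without weight bounds it at `(t,
  -- x)` by the `L²` error.
  have hkey : ∀ m, (potential Γ (fun k => g k m) i (t, x) - potential Γ f i (t, x)) ^ 2
      ≤ C * ((r ^ (n + 2))⁻¹ * T * (T * ∑ k, ∫ X, (g k m X - F k X) ^ 2)) := fun m => by
    obtain ⟨Dg, hgs, hgb⟩ := hΓ.globalSol hA hLam fun k => (hg k m).to_univ
    have hd := hgs.sub hA hLam hw
    have h1 := hpot Rc A hA hPH (t, x) r hr0 hrR T (ρ - 1) 0 0
      (by change ρ - 1 ≤ t - r ^ 2; linarith) le_rfl le_rfl le_rfl _ _ _ _ hd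
      (fun k => (hgb k).sub ((hub k).mul_bdd abs_timeStep_le)
        (hgs.memL2 k).locL2.aestronglyMeasurable (hw.memL2 k).locL2.aestronglyMeasurable)
      (fun k => ((hg k m).memLp 2).sub (hFL2 k))
      (fun k => by simp)
      (fun k X hX => ?_) (fun k X hX => ?_) (fun k X hX => sub_self _) (fun k X hX => ?_)
      (fun k X hX => sub_self _) (fun k X hX => absurd hX (not_lt.2 (norm_nonneg _)))
      (fun k X hX => sub_self _) (fun k => ?_) i
    · rw [timeStep_eq_one hδ (by linarith : ρ + δ ≤ ((t, x) : SpaceTime n).1), one_mul] at h1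
      refine h1.trans_eq ?_
      have e1 : ∫ X, ∑ k, (g k m X - F k X) ^ 2 = ∑ k, ∫ X, (g k m X - F k X) ^ 2 :=
        integral_finsetSum _ fun k _ => (((hg k m).memLp 2).sub (hFL2 k)).integrable_sq
      simp only [sub_self, norm_zero, mul_zero, zero_mul, add_zero, Real.exp_zero, mul_one,
        ne_eq, OfNat.ofNat_ne_zero, not_false_eq_true, zero_pow, Finset.sum_const_zero,
        integral_zero]
      rw [← e1]
    · rw [hΓ.potential_eq_zero (fun k Y hY => (hg k m).eq_zero (hUa Y hY)) k hX,
        timeStep_eq_zero hδ (by linarith)]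
      ring
    · rw [(hg k m).eq_zero (hUa X hX)]
      change 0 - h X.1 * _ = 0
      rw [hh0 _ (hUI X hX)]; ring
    · rw [(hg k m).eq_zero fun h => by linarith [h.2, hQt X hX]]
      change 0 - h X.1 * _ = 0
      rw [hh0 _ fun h => by linarith [h.2, hQt X hX]]; ring
    · refine (hΓ.continuousAt_potential (fun j => (hg j m).to_univ)
        (fun j h => hts₂ ((hg j m).support h)) k).sub (ContinuousAt.mul ?_
          (huc (t, x) (by change σ < t; linarith) k))
      exact (timeStep_contDiff.continuous.comp continuous_fst).continuousAt
  have hlim2 : Tendsto (fun m => C * ((r ^ (n + 2))⁻¹ * T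
      * (T * ∑ k, ∫ X, (g k m X - F k X) ^ 2))) atTop (𝓝 0) := by
    have h1 := tendsto_finsetSum (Finset.univ : Finset (Fin N)) fun k _ =>
      tendsto_integral_sq_sub (fun m => (hg k m).memLp 2) (hFL2 k) (hgF k)
    simp only [Finset.sum_const_zero] at h1
    simpa using ((h1.const_mul T).const_mul ((r ^ (n + 2))⁻¹ * T)).const_mul C
  -- convergence of the potentials of the approximations
  have hUm : MeasurableSet U := hUc.measurableSet
  -- On the time slab `U`, at positive distance from `t`, the row of `Γ` is bounded and dominated by
  -- a Gaussian, hence square integrable. It can therefore be paired with the `L²`-convergent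
  -- sources.
  have hΓL2 : ∀ k, MemLp (U.indicator fun Y => Γ (t, x) Y i k) 2 volume := fun k => by
    have hm : AEStronglyMeasurable (U.indicator fun Y => Γ (t, x) Y i k) volume := by
      rw [aestronglyMeasurable_indicator_iff hUm]
      exact ContinuousOn.aestronglyMeasurable
        (fun Y hY => (hΓc Y hY.2 k).continuousWithinAt) hUm
    rw [memLp_two_iff_integrable_sq hm]
    have hbi : Integrable (fun Y : SpaceTime n => (Icc (ρ - 1) s₂).indicator (fun _ => M) Y.1
        * (M * Real.exp (-c * ‖x - Y.2‖ ^ 2))) :=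
      Integrable.mul_prod (f := (Icc (ρ - 1) s₂).indicator fun _ => M)
        ((integrableOn_const measure_Icc_lt_top.ne).integrable_indicator measurableSet_Icc)
        (hgi.const_mul M)
    refine hbi.mono' (hm.pow 2) (Eventually.of_forall fun Y => ?_)
    by_cases hY : Y ∈ U
    · rw [indicator_of_mem hY, indicator_of_mem (show Y.1 ∈ Icc (ρ - 1) s₂ from hY), norm_pow, pow_two]
      have h1 := hΓb Y.1 hY.1 hY.2 Y.2 k
      have h2 : Real.exp (-c * ‖x - Y.2‖ ^ 2) ≤ 1 :=
        Real.exp_le_one_iff.2 (by nlinarith [sq_nonneg ‖x - Y.2‖])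
      exact mul_le_mul (h1.trans (mul_le_of_le_one_right hM.le h2)) h1 (norm_nonneg _) hM.le
    · rw [indicator_of_notMem hY, indicator_of_notMem fun h : Y.1 ∈ Icc (ρ - 1) s₂ => hY h]
      simp
  have hlim1 : Tendsto (fun m => potential Γ (fun k => g k m) i (t, x)) atTop
      (𝓝 (∫ Y : SpaceTime n, h Y.1 * v Y)) := by
    have e1 : ∀ m, potential Γ (fun k => g k m) i (t, x)
        = ∑ k, ∫ Y, g k m Y * (U.indicator (fun Y => Γ (t, x) Y i k) Y) := fun m => by
      rw [hΓ.potential_eq_sum fun k => (hg k m).to_univ]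
      refine Finset.sum_congr rfl fun k _ => integral_congr_ae (Eventually.of_forall fun Y => ?_)
      by_cases hY : Y ∈ U
      · simp only; rw [indicator_of_mem hY, mul_comm]
      · simp only; rw [indicator_of_notMem hY, (hg k m).eq_zero hY]; ring
    have e2 : ∫ Y : SpaceTime n, h Y.1 * v Y
        = ∑ k, ∫ Y, F k Y * (U.indicator (fun Y => Γ (t, x) Y i k) Y) := by
      have hi : ∀ k, Integrable fun Y => F k Y * (U.indicator (fun Y => Γ (t, x) Y i k) Y) :=
        fun k => (hFL2 k).integrable_mul (hΓL2 k)
      rw [← integral_finsetSum _ fun k _ => hi k]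
      refine integral_congr_ae (Eventually.of_forall fun Y => ?_)
      simp only [hv, Finset.mul_sum, hF]
      refine Finset.sum_congr rfl fun k _ => ?_
      by_cases hY : Y ∈ U
      · rw [indicator_of_mem hY]; ring
      · rw [hh0 Y.1 fun h => hY ⟨by linarith [h.1], by linarith [h.2]⟩]; ring
    simp only [e1, e2]
    exact tendsto_finsetSum _ fun k _ => tendsto_integral_mul_const
      (Eventually.of_forall fun m => (hg k m).memLp 2) (hFL2 k) (hΓL2 k) (hgF k)
  have hS := le_of_tendsto_of_tendsto' ((hlim1.sub_const _).pow 2) hlim2 hkey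
  exact sub_eq_zero.1 (pow_eq_zero_iff two_ne_zero |>.1 (le_antisymm hS (sq_nonneg _)))

/-- The Chapman–Kolmogorov identity. -/
theorem fundamental_chapman_kolmogorov {lam Lam : ℝ} (hlam : 0 < lam) (hLam : 0 < Lam)
    {μ₀ C₀ : ℝ} (hμ : 0 < μ₀) (hC₀ : 0 < C₀) {Rc : ℝ≥0∞} (hRc : 0 < Rc) {A : Coeff n N}
    (hA : IsParabolic lam Lam A) (hPH : PropertyPH A μ₀ Rc C₀)
    {Γ : SpaceTime n → SpaceTime n → Matrix (Fin N) (Fin N) ℝ} (hΓ : IsFundamentalMatrix A Γ)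
    (hG : GaussianDominated Γ) {t s ρ : ℝ} (hsρ : s < ρ) (hρt : ρ < t) (x y : Space n)
    (i k : Fin N) :
    Integrable (fun z => (Γ (t, x) (ρ, z) * Γ (ρ, z) (s, y)) i k) ∧
      Γ (t, x) (s, y) i k = ∫ z, (Γ (t, x) (ρ, z) * Γ (ρ, z) (s, y)) i k := by
  set σ := (s + ρ) / 2 with hσ
  obtain ⟨M₁, c₁, hM₁, hc₁, hdom₁⟩ := hG (t - ρ) (t - ρ) (by linarith)
  obtain ⟨M₂, c₂, hM₂, hc₂, hdom₂⟩ := hG (ρ - σ) (ρ - (s - 1)) (by linarith)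
  -- One Gaussian factor suffices for integrability; the other factor of the product only needs to
  -- be bounded, which holds because `ρ` stays away from the times in `[s - 1, σ]`.
  have hb : Integrable fun z : Space n =>
      ∑ _j : Fin N, M₁ * Real.exp (-c₁ * ‖x - z‖ ^ 2) * M₂ :=
    integrable_finsetSum _ fun j _ =>
      ((integrable_exp_neg_mul_norm_sq hc₁ x).const_mul M₁).mul_const M₂
  have hbd₁ : ∀ z j, |Γ (t, x) (ρ, z) i j| ≤ M₁ * Real.exp (-c₁ * ‖x - z‖ ^ 2) := fun z j =>
    hdom₁ t ρ le_rfl le_rfl x z i j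
  have hbd₂ : ∀ τ, s - 1 ≤ τ → τ ≤ σ → ∀ z w j l, |Γ (ρ, z) (τ, w) j l| ≤ M₂ :=
    fun τ h1 h2 z w j l => (hdom₂ ρ τ (by linarith) (by linarith) z w j l).trans
      (mul_le_of_le_one_right hM₂.le (Real.exp_le_one_iff.2 (by
        nlinarith [sq_nonneg ‖z - w‖])))
  have hc1 : ∀ j, Continuous fun z : Space n => Γ (t, x) (ρ, z) i j := fun j =>
    continuous_iff_continuousAt.2 fun z => ContinuousAt.comp (f := fun z => (ρ, z))
      (g := fun Y => Γ (t, x) Y i j) (hΓ.continuousAt_right (fun h => by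
        have h2 : t = ρ := congrArg Prod.fst h
        linarith) i j) (by fun_prop)
  have hc2 : ∀ j, Continuous fun z : Space n => Γ (ρ, z) (s, y) j k := fun j =>
    continuous_iff_continuousAt.2 fun z => ContinuousAt.comp (f := fun z => (ρ, z))
      (g := fun X => Γ X (s, y) j k) (hΓ.continuousAt_left (fun h => by
        have h2 : ρ = s := congrArg Prod.fst h
        linarith) j k) (by fun_prop)
  have hmul : ∀ z, (Γ (t, x) (ρ, z) * Γ (ρ, z) (s, y)) i k
      = ∑ j, Γ (t, x) (ρ, z) i j * Γ (ρ, z) (s, y) j k := fun z => Matrix.mul_apply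
  simp only [hmul]
  refine ⟨hb.mono' (continuous_finsetSum _ fun j _ => (hc1 j).mul (hc2 j)).aestronglyMeasurable
    (Eventually.of_forall fun z => ?_), ?_⟩
  · refine (norm_sum_le _ _).trans (Finset.sum_le_sum fun j _ => ?_)
    rw [norm_mul]
    exact mul_le_mul (hbd₁ z j) (hbd₂ s (by linarith) (by linarith) z y j k) (norm_nonneg _)
      (by positivity)
  -- approximate the Dirac mass at `(s, y)`
  obtain ⟨m₀, hm₀⟩ := exists_nat_one_div_lt (show 0 < min 1 (σ - s) by
    exact lt_min one_pos (by linarith))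
  -- The index is shifted by `m₀` so that all mollifiers are supported in times between `s - 1` and
  -- `σ`, before `ρ`.
  set ψ : ℕ → SpaceTime n → ℝ := fun m Y =>
    mollifier (volume : Measure (SpaceTime n)) (m + m₀) (((s, y) : SpaceTime n) - Y) with hψ
  have hψt : ∀ m, IsTestFunction {X : SpaceTime n | s - 1 ≤ X.1 ∧ X.1 ≤ σ} (ψ m) := fun m => by
    refine ⟨mollifier_comp_sub_contDiff _ _, mollifier_comp_sub_hasCompactSupport _ _,
      closure_minimal (fun X hX => ?_) ((isClosed_le continuous_const continuous_fst).inter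
        (isClosed_le continuous_fst continuous_const))⟩
    have h1 : ‖((s, y) : SpaceTime n) - X‖ < 1 / ((m + m₀ : ℕ) + 1 : ℝ) := by
      by_contra hcon
      exact hX (mollifier_eq_zero _ (not_lt.1 hcon))
    have h2 : (1 : ℝ) / ((m + m₀ : ℕ) + 1 : ℝ) ≤ 1 / (m₀ + 1 : ℝ) :=
      one_div_le_one_div_of_le (by positivity) (by push_cast; linarith [Nat.cast_nonneg (α := ℝ) m])
    have h3 : |s - X.1| < min 1 (σ - s) :=
      ((norm_fst_le (((s, y) : SpaceTime n) - X)).trans_lt h1).trans_le (h2.trans hm₀.le)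
    have h4 := abs_lt.1 (h3.trans_le (min_le_left _ _))
    have h5 := abs_lt.1 (h3.trans_le (min_le_right _ _))
    exact ⟨by linarith [h4.2], by linarith [h5.1]⟩
  have hψ1 : ∀ m, ∫ Y, |ψ m Y| = 1 := fun m => by
    have : ∀ Y, |ψ m Y| = ψ m Y := fun Y => abs_of_nonneg (mollifier_nonneg _ _)
    simp only [this]
    simp only [hψ]
    rw [integral_sub_left_eq_self (mollifier (volume : Measure (SpaceTime n)) (m + m₀))]
    exact ContDiffBump.integral_normed _
  set f : ℕ → Fin N → SpaceTime n → ℝ := fun m => Pi.single k (ψ m) with hfdef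
  have hft : ∀ m j, IsTestFunction {X : SpaceTime n | s - 1 ≤ X.1 ∧ X.1 ≤ σ} (f m j) :=
    fun m j => (hψt m).pi_single k j
  have hfp : ∀ m j X, potential Γ (f m) j X = ∫ Y, Γ X Y j k * ψ m Y := fun m j X => by
    rw [hΓ.potential_eq_sum fun j => (hft m j).to_univ, Finset.sum_eq_single k]
    · simp [hfdef]
    · intro l _ hl; simp [hfdef, Pi.single_eq_of_ne hl]
    · simp
  have hplim : ∀ j (X : SpaceTime n), X ≠ (s, y) →
      Tendsto (fun m => potential Γ (f m) j X) atTop (𝓝 (Γ X (s, y) j k)) := fun j X hX => by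
    simp only [hfp]
    exact (tendsto_integral_mul_mollifier (g := fun Y => Γ X Y j k) (x := (s, y))
      (hΓ.continuousAt_right hX j k) fun m => hΓ.integrable_mul X j k
        ⟨mollifier_comp_sub_contDiff m _, mollifier_comp_sub_hasCompactSupport m _,
          subset_univ _⟩).comp (tendsto_add_atTop_nat m₀)
  have hpb : ∀ m j z, |potential Γ (f m) j (ρ, z)| ≤ M₂ := fun m j z => by
    refine (abs_potential_le (hft m) j (M := M₂)
      fun Y hY l => hbd₂ Y.1 hY.1 hY.2 z Y.2 j l).trans_eq ?_
    rw [Finset.sum_eq_single k]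
    · simp [hfdef, hψ1]
    · intro l _ hl; simp [hfdef, Pi.single_eq_of_ne hl]
    · simp
  have hck := fun m => integral_mul_potential_eq hlam hLam hμ hC₀ hRc hA hPH hΓ hG
    (show σ < ρ by linarith) hρt x (hft m) i
  have hl1 := hplim i (t, x) (fun h => by
    have h2 : t = s := congrArg Prod.fst h
    linarith)
  -- The propagated potentials converge to `Γ(t, x, s, y)` on one side. On the other side they
  -- converge pointwise under a fixed integrable majorant.
  refine tendsto_nhds_unique hl1 ?_
  simp only [← hck]
  refine tendsto_integral_of_dominated_convergence _ (fun m => ?_) hb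
    (fun m => Eventually.of_forall fun z => ?_) (Eventually.of_forall fun z => ?_)
  · refine Continuous.aestronglyMeasurable (continuous_finsetSum _ fun j _ => (hc1 j).mul ?_)
    refine continuous_iff_continuousAt.2 fun z => ContinuousAt.comp (f := fun z => (ρ, z))
      (g := potential Γ (f m) j) (hΓ.continuousAt_potential (fun l => (hft m l).to_univ)
        (fun l h => ?_) j) (by fun_prop)
    have : ρ ≤ σ := ((hft m l).support h).2
    linarith
  · refine (norm_sum_le _ _).trans (Finset.sum_le_sum fun j _ => ?_)
    rw [norm_mul]
    exact mul_le_mul (hbd₁ z j) (hpb m j z) (norm_nonneg _) (by positivity)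
  · refine tendsto_finsetSum _ fun j _ => (hplim j (ρ, z) fun h => ?_).const_mul _
    have h2 : ρ = s := congrArg Prod.fst h
    linarith

end

end ParabolicSystem

/-! ### The main theorem. -/

theorem theorem2 (lam Lam : ℝ) (hlam : 0 < lam) (hLam : 0 < Lam) :
    ∃ κ : ℝ, 0 < κ ∧
    ∀ (n N : ℕ), 1 ≤ n → 1 ≤ N →
    ∀ (μ₀ C₀ : ℝ), 0 < μ₀ → μ₀ ≤ 1 → 0 < C₀ →
    ∃ C γ : ℝ, 0 < C ∧ 0 < γ ∧
    ∀ (Rc : ℝ≥0∞), 0 < Rc →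
    ∀ (A : ParabolicSystem.Coeff n N), ParabolicSystem.IsParabolic lam Lam A →
      ParabolicSystem.PropertyPH A μ₀ Rc C₀ →
      ParabolicSystem.AdjointPropertyPH A μ₀ Rc C₀ →
    ∀ (Γ : ParabolicSystem.SpaceTime n → ParabolicSystem.SpaceTime n →
        Matrix (Fin N) (Fin N) ℝ), ParabolicSystem.IsFundamentalMatrix A Γ →
      (∀ (t s : ℝ), s < t → ∀ x y : ParabolicSystem.Space n,
        ParabolicSystem.opNorm (Γ (t, x) (s, y)) ≤
          C * (t - s) ^ (-(n : ℝ) / 2) *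
            Real.exp (-κ * ‖x - y‖ ^ 2 / (t - s) + γ * (t - s) * (Rc⁻¹).toReal ^ 2)) ∧
      (Rc = ⊤ → ∀ (t s : ℝ), s < t → ∀ x y : ParabolicSystem.Space n,
        ParabolicSystem.opNorm (Γ (t, x) (s, y)) ≤
          C * (t - s) ^ (-(n : ℝ) / 2) * Real.exp (-κ * ‖x - y‖ ^ 2 / (t - s))) ∧
      (∀ (t s : ℝ), s < t → ∀ x y : ParabolicSystem.Space n, ∀ r ∈ Ioo s t, ∀ i k : Fin N,
        Integrable (fun z : ParabolicSystem.Space n =>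
          (Γ (t, x) (r, z) * Γ (r, z) (s, y)) i k) volume ∧
        Γ (t, x) (s, y) i k =
          ∫ z : ParabolicSystem.Space n, (Γ (t, x) (r, z) * Γ (r, z) (s, y)) i k) ∧
      (∀ (t s : ℝ), s < t → ∀ x : ParabolicSystem.Space n, ∀ i k : Fin N,
        Integrable (fun y : ParabolicSystem.Space n => Γ (t, x) (s, y) i k) volume ∧
        ∫ y : ParabolicSystem.Space n, Γ (t, x) (s, y) i k =
          (1 : Matrix (Fin N) (Fin N) ℝ) i k) := by
  refine ⟨ParabolicSystem.gaussRate lam Lam, ParabolicSystem.gaussRate_pos hlam,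
    fun n N _ hN μ₀ C₀ hμ _ hC₀ => ?_⟩
  obtain ⟨C, hC, hbound⟩ := ParabolicSystem.exists_gaussian_bound n N hlam hLam hμ hC₀
  have hN0 : (0 : ℝ) < N := by exact_mod_cast hN
  -- The factor `N²` passes from entries to the operator norm; `γ = 1` is the coefficient found in
  -- the bound for the entries.
  refine ⟨N * N * C, 1, by positivity, one_pos, fun Rc hRc A hA hPH hPH' Γ hΓ => ?_⟩
  have hΓb := hbound Rc hRc A hA hPH hPH' Γ hΓ
  have hG := ParabolicSystem.gaussianDominated_of_bound hC
    (ParabolicSystem.gaussRate_pos (Lam := Lam) hlam) (sq_nonneg (Rc⁻¹).toReal) hΓb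
  have hop : ∀ (t s : ℝ), s < t → ∀ x y : ParabolicSystem.Space n,
      ParabolicSystem.opNorm (Γ (t, x) (s, y)) ≤
        N * N * C * (t - s) ^ (-(n : ℝ) / 2) *
          Real.exp (-ParabolicSystem.gaussRate lam Lam * ‖x - y‖ ^ 2 / (t - s)
            + 1 * (t - s) * (Rc⁻¹).toReal ^ 2) := fun t s hst x y => by
    have hts : 0 ≤ t - s := (sub_pos.2 hst).le
    refine (ParabolicSystem.opNorm_le_of_entries (by positivity)
      fun i k => hΓb t s hst x y i k).trans_eq ?_
    rw [one_mul]
    ring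
  refine ⟨hop, fun hRc' t s hst x y => ?_, fun t s hst x y r hr i k => ?_,
    fun t s hst x i k => ?_⟩
  -- The inverse of an infinite `Rc` is zero, so the growing exponential disappears.
  · simpa [hRc'] using hop t s hst x y
  · exact ParabolicSystem.fundamental_chapman_kolmogorov hlam hLam hμ hC₀ hRc hA hPH hΓ hG
      hr.1 hr.2 x y i k
  · exact ParabolicSystem.integral_fundamental_eq_one hlam hLam hμ hC₀ hRc hA hPH hΓ hG hst x i k
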